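/- Network. Let $\mathcal G=(\mathcal N,\mathcal E)$ be a connected simple graph with nodes (microgrids) $\mathcal N=\{1,\dots,n\}$ and $m$ lines; $N_i$ is the set of neighbours of $i$, and $i\sim k$ means that $i$ and $k$ are joined by a line. Given are line resistances $r_{ik}=r_{ki}>0$, loads $p_i^d>0$, generation limits $\overline p_i^g$, voltage limits $0<\underline V_i\le\overline V_i$ with $\overline V_1=\dots=\overline V_n$, droop coefficients $k_i>0$, references $v_i^*\in\mathbb R$ and costs $f_i:\mathbb R\to\mathbb R$; write $G_i=f_i'$. Problem ESOCP. Over $p^g,v,\hat p\in\mathbb R^n$, $P=(P_{ik})$ indexed by ordered pairs $i\sim k$, and $l=(l_{ik})$ with $l_{ik}=l_{ki}$ indexed by lines, minimize $$\sum_i f_i(p_i^g)+\sum_i\tfrac12y_i^2+\sum_i\tfrac12z_i^2,\qquad y_i=v_i+k_ip_i^g-v_i^*-k_i\hat p_i,\quad z_i=p_i^g-p_i^d-\sum_{k\in N_i}P_{ik},$$ subject to $v_i-v_i^*=-k_i(p_i^g-\hat p_i)$, $p_i^g-p_i^d=\sum_{k\in N_i}P_{ik}$, $0\le p_i^g\le\overline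 p_i^g$ and $\underline V_i^2\le v_i\le\overline V_i^2$ for all $i$, and $P_{ik}+P_{ki}=r_{ik}l_{ik}$, $v_i-v_k=r_{ik}(P_{ik}-P_{ki})$ and $l_{ik}\ge P_{ik}^2/v_i$ for all $i\sim k$. Dynamics. The state is $x=(p^g,v,P,l,\hat p,\mu,\epsilon,\lambda,\gamma,\rho)$, where $\mu,\epsilon$ are indexed by nodes, $\lambda,\gamma$ by lines ($\lambda_{ik}=\lambda_{ki}$, $\gamma_{ik}=-\gamma_{ki}$) and $\rho$ by ordered pairs $i\sim k$. Let $[b]^+_a=b$ if $a>0$ or $b>0$, and $[b]^+_a=0$ otherwise. Let $F(x)$ be the vector with the components $$\begin{aligned} p_i^g:\;& G_i(p_i^g)+k_i\epsilon_i-\mu_i+z_i+k_iy_i, & v_i:\;& y_i+\sum_{k\in N_i}\gamma_{ik}+\epsilon_i-\sum_{k\in N_i}\rho_{ik}P_{ik}^2/v_i^2,\\ P_{ik}:\;& \mu_i+\lambda_{ik}-\gamma_{ik}r_{ik}+2\rho_{ik}P_{ik}/v_i-z_i, & l_{ik}:\;& -\lambda_{ik}r_{ik}-\rho_{ik}-\rho_{ki},\\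 \hat p_i:\;& -k_i\epsilon_i-k_iy_i, & \mu_i:\;& p_i^g-p_i^d-\sum_{k\in N_i}P_{ik},\\ \epsilon_i:\;& -(v_i+k_ip_i^g-v_i^*-k_i\hat p_i), & \lambda_{ik}:\;& -(P_{ik}+P_{ki}-r_{ik}l_{ik}),\\ \gamma_{ik}:\;& -(v_i-v_k-r_{ik}(P_{ik}-P_{ki})), & \rho_{ik}:\;& -[P_{ik}^2/v_i-l_{ik}]^+_{\rho_{ik}}. \end{aligned}$$ Let $S$ be the set of all states with $0\le p_i^g\le\overline p_i^g$ and $\underline V_i^2\le v_i\le\overline V_i^2$ for all $i$, let $H(x)=\mathrm{Proj}_S(x-F(x))$ be the Euclidean projection, and let $E=\{x\in S: H(x)=x\}$ be the set of equilibria. A trajectory is a (Carathéodory) solution on $[0,\infty)$ of $$\dot x(t)=H(x(t))-x(t).$$ Assumptions. A1: each $f_i$ is strictly increasing on $[-p_i^d,\infty)$ and twice continuously differentiable, and $f_i''\ge\alpha$ for some constant $\alpha>0$. A2: the optimal power flow problem is feasible, that is, there are $p^g,v,W$ with $0\le p_i^g\le\overline p_i^g$, $\underline V_i^2\le v_i\le\overline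 V_i^2$, $p_i^g-p_i^d=\sum_{k\in N_i}(v_i-W_{ik})/r_{ik}$ for all $i$, and, for all $i\sim k$, $W_{ik}=W_{ki}\ge0$ and $\begin{pmatrix}v_i&W_{ik}\\W_{ki}&v_k\end{pmatrix}$ positive semidefinite of rank $1$. A3: the initial state is finite with $0\le p_i^g(0)\le\overline p_i^g$ and $\underline V_i^2\le v_i(0)\le\overline V_i^2$ for all $i$ (that is, $x(0)\in S$), and $\rho_{ik}(0)\ge0$ for all $i\sim k$. A4: Slater's condition holds for ESOCP, that is, some feasible point of ESOCP satisfies $l_{ik}>P_{ik}^2/v_i$ for all $i\sim k$. Theorem 4. Assume A1–A4. Then every trajectory $x(t)$ converges, as $t\to+\infty$, to some equilibrium $x^*\in E$ whose primal part $(p^{g*},P^*,l^*,v^*,\hat p^*)$ is an optimal solution of ESOCP. -/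

import Mathlib

open Filter Topology MeasureTheory

/-- A stand-alone DC network of `n` microgrids: a connected graph with line resistances `r`,
loads `pd`, generation limits `pmax`, voltage limits `Vmin`, `Vmax`, droop coefficients `k`,
squared-voltage references `vref` and generation costs `f`. -/
structure DCNetwork (n : ℕ) where
  G : SimpleGraph (Fin n)
  connected : G.Connected
  /-- the resistance of the line joining `i` and `j` is `r s(i, j)` -/
  r : Sym2 (Fin n) → ℝ
  r_pos : ∀ e ∈ G.edgeSet, 0 < r e
  pd : Fin n → ℝ
  pmax : Fin n → ℝ
  Vmin : Fin n → ℝ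
  Vmin_pos : ∀ i, 0 < Vmin i
  Vmax : Fin n → ℝ
  k : Fin n → ℝ
  k_pos : ∀ i, 0 < k i
  vref : Fin n → ℝ
  f : Fin n → ℝ → ℝ

namespace DCNetwork

variable {n : ℕ} (N : DCNetwork n)

noncomputable instance : DecidableRel N.G.Adj := Classical.decRel _

/-- Ordered pairs `(i, k)` of adjacent nodes (each line occurs twice). -/
abbrev Arc : Type := N.G.Dart

/-- Lines, each one oriented from its smaller to its larger end node (each line occurs once). -/
abbrev Line : Type := {a : N.Arc // a.fst < a.snd}

variable {N}

/-- The line that carries a given ordered pair. -/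
def lineOf (a : N.Arc) : N.Line :=
  if h : a.fst < a.snd then ⟨a, h⟩
  else ⟨a.symm, lt_of_le_of_ne (not_lt.mp h) a.adj.ne'⟩

/-- The sign of an ordered pair with respect to the orientation of its line. -/
def sgn (a : N.Arc) : ℝ := if a.fst < a.snd then 1 else -1

variable (N)

/-- The resistance `r_ik`. -/
def res (a : N.Arc) : ℝ := N.r a.edge

/-! ### The optimization problems -/

/-- Feasibility of `(p, v, W)` for the (nonconvex) optimal power flow problem. -/
structure OPFFeasible (p v : Fin n → ℝ) (W : N.Arc → ℝ) : Prop where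
  gen : ∀ i, 0 ≤ p i ∧ p i ≤ N.pmax i
  volt : ∀ i, N.Vmin i ^ 2 ≤ v i ∧ v i ≤ N.Vmax i ^ 2
  balance : ∀ i, p i - N.pd i = ∑ a : N.Arc with a.fst = i, (v i - W a) / N.res a
  W_nonneg : ∀ a, 0 ≤ W a
  W_symm : ∀ a, W a = W a.symm
  psd : ∀ a : N.Arc, Matrix.PosSemidef !![v a.fst, W a; W a.symm, v a.snd]
  rank_one : ∀ a : N.Arc, Matrix.rank !![v a.fst, W a; W a.symm, v a.snd] = 1

/-- The decision variables `(p^g, P, l, v, p̂)` of ESOCP. -/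
structure Primal where
  p : Fin n → ℝ
  P : N.Arc → ℝ
  l : N.Line → ℝ
  v : Fin n → ℝ
  phat : Fin n → ℝ

namespace Primal

variable {N}

/-- `y_i`, the droop residual. -/
def y (q : N.Primal) (i : Fin n) : ℝ := q.v i + N.k i * q.p i - N.vref i - N.k i * q.phat i

/-- `z_i`, the power balance residual. -/
noncomputable def z (q : N.Primal) (i : Fin n) : ℝ := q.p i - N.pd i - ∑ a : N.Arc with a.fst = i, q.P a

/-- The objective of ESOCP. -/
noncomputable def objective (q : N.Primal) : ℝ :=
  ∑ i, N.f i (q.p i) + ∑ i, 1 / 2 * q.y i ^ 2 + ∑ i, 1 / 2 * q.z i ^ 2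

/-- The constraints of ESOCP. -/
structure Feasible (q : N.Primal) : Prop where
  droop : ∀ i, q.v i - N.vref i = -N.k i * (q.p i - q.phat i)
  balance : ∀ i, q.p i - N.pd i = ∑ a : N.Arc with a.fst = i, q.P a
  gen : ∀ i, 0 ≤ q.p i ∧ q.p i ≤ N.pmax i
  loss : ∀ a : N.Arc, q.P a + q.P a.symm = N.res a * q.l (lineOf a)
  drop : ∀ a : N.Arc, q.v a.fst - q.v a.snd = N.res a * (q.P a - q.P a.symm)
  cone : ∀ a : N.Arc, q.P a ^ 2 / q.v a.fst ≤ q.l (lineOf a)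
  volt : ∀ i, N.Vmin i ^ 2 ≤ q.v i ∧ q.v i ≤ N.Vmax i ^ 2

/-- `q` is an optimal solution of ESOCP. -/
def IsOptimal (q : N.Primal) : Prop :=
  q.Feasible ∧ ∀ q' : N.Primal, q'.Feasible → q.objective ≤ q'.objective

end Primal

/-! ### The assumptions on the network -/

/-- A1: the costs are strictly increasing for `p ≥ -p^d`, twice continuously differentiable,
and their second derivatives are bounded below by a positive constant. -/
def A1 : Prop :=
  (∀ i, StrictMonoOn (N.f i) (Set.Ici (-N.pd i))) ∧ (∀ i, ContDiff ℝ 2 (N.f i)) ∧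
    ∃ α : ℝ, 0 < α ∧ ∀ i p, α ≤ deriv (deriv (N.f i)) p

/-- A2: the optimal power flow problem is feasible. -/
def A2 : Prop := ∃ p v W, N.OPFFeasible p v W

/-- A4: Slater's condition for ESOCP. The conic constraints, which are the only constraints
that are not affine, hold strictly at some feasible point. -/
def A4 : Prop :=
  ∃ q : N.Primal, q.Feasible ∧ ∀ a : N.Arc, q.P a ^ 2 / q.v a.fst < q.l (lineOf a)

/-! ### The projected primal-dual dynamics -/

/-- Labels of the `5n + 7m` coordinates of the state
`(p^g, v, P, l, p̂, μ, ε, λ, γ, ρ)`. -/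
inductive Idx : Type
  | pg (i : Fin n)
  | v (i : Fin n)
  | P (a : N.Arc)
  | l (e : N.Line)
  | phat (i : Fin n)
  | mu (i : Fin n)
  | eps (i : Fin n)
  | lam (e : N.Line)
  | gam (e : N.Line)
  | rho (a : N.Arc)

/-- Each label is a node, a line or an ordered pair, tagged with its kind. -/
def Idx.equiv : N.Idx ≃ (Fin 5 × Fin n) ⊕ (Fin 3 × N.Line) ⊕ (Fin 2 × N.Arc) where
  toFun
    | .pg i => .inl (0, i)
    | .v i => .inl (1, i)
    | .phat i => .inl (2, i)
    | .mu i => .inl (3, i)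
    | .eps i => .inl (4, i)
    | .l e => .inr (.inl (0, e))
    | .lam e => .inr (.inl (1, e))
    | .gam e => .inr (.inl (2, e))
    | .P a => .inr (.inr (0, a))
    | .rho a => .inr (.inr (1, a))
  invFun
    | .inl (0, i) => .pg i
    | .inl (1, i) => .v i
    | .inl (2, i) => .phat i
    | .inl (3, i) => .mu i
    | .inl (4, i) => .eps i
    | .inr (.inl (0, e)) => .l e
    | .inr (.inl (1, e)) => .lam e
    | .inr (.inl (2, e)) => .gam e
    | .inr (.inr (0, a)) => .P a
    | .inr (.inr (1, a)) => .rho a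
  left_inv x := by cases x <;> rfl
  right_inv x := by
    rcases x with ⟨c, i⟩ | ⟨c, e⟩ | ⟨c, a⟩ <;> fin_cases c <;> rfl

noncomputable instance : Fintype N.Idx := Fintype.ofEquiv _ (Idx.equiv N).symm

/-- The state space, with the Euclidean norm. -/
abbrev State : Type := EuclideanSpace ℝ N.Idx

variable {N}

/-- The primal part of a state. -/
def State.primal (x : N.State) : N.Primal where
  p i := x (.pg i)
  P a := x (.P a)
  l e := x (.l e)
  v i := x (.v i)
  phat i := x (.phat i)

variable (N)

/-- `[x]⁺_a`: equal to `x` if `a > 0` or `x > 0`, and to `0` otherwise. -/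
noncomputable def posProj (a x : ℝ) : ℝ := open Classical in if 0 < a ∨ 0 < x then x else 0

/-- The vector field `F`. The multiplier `λ` of a line is the same for its two ordered pairs, the
multiplier `γ` changes sign with the direction. -/
noncomputable def F (x : N.State) : N.State :=
  let q := State.primal x
  WithLp.toLp 2 fun
    | .pg i => deriv (N.f i) (q.p i) + N.k i * x (.eps i) - x (.mu i) + q.z i + N.k i * q.y i
    | .v i => q.y i + (∑ a : N.Arc with a.fst = i, sgn a * x (.gam (lineOf a))) + x (.eps i)
        - ∑ a : N.Arc with a.fst = i, x (.rho a) * (q.P a ^ 2 / q.v i ^ 2)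
    | .P a => x (.mu a.fst) + x (.lam (lineOf a)) - sgn a * x (.gam (lineOf a)) * N.res a
        + 2 * x (.rho a) * (q.P a / q.v a.fst) - q.z a.fst
    | .l e => -x (.lam e) * N.res e.1 - x (.rho e.1) - x (.rho e.1.symm)
    | .phat i => -N.k i * x (.eps i) - N.k i * q.y i
    | .mu i => q.p i - N.pd i - ∑ a : N.Arc with a.fst = i, q.P a
    | .eps i => -(q.v i + N.k i * q.p i - N.vref i - N.k i * q.phat i)
    | .lam e => -(q.P e.1 + q.P e.1.symm - N.res e.1 * q.l e)
    | .gam e => -(q.v e.1.fst - q.v e.1.snd - N.res e.1 * (q.P e.1 - q.P e.1.symm))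
    | .rho a => -posProj (x (.rho a)) (q.P a ^ 2 / q.v a.fst - q.l (lineOf a))

/-- The set `S`: generations and squared voltages within their limits, all other coordinates
free. -/
def S : Set N.State :=
  {x | (∀ i, 0 ≤ x (.pg i) ∧ x (.pg i) ≤ N.pmax i) ∧
    ∀ i, N.Vmin i ^ 2 ≤ x (.v i) ∧ x (.v i) ≤ N.Vmax i ^ 2}

/-- `y` is a point of `S` nearest to `w`, in the Euclidean norm. -/
def IsNearest (w y : N.State) : Prop := y ∈ N.S ∧ ∀ y' ∈ N.S, ‖y - w‖ ≤ ‖y' - w‖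

/-- `Proj_S(w) = argmin_{y ∈ S} ‖y - w‖`. -/
noncomputable def proj (w : N.State) : N.State := Classical.epsilon fun y => N.IsNearest w y

/-- `H(x) = Proj_S(x - F(x))`. -/
noncomputable def H (x : N.State) : N.State := N.proj (x - N.F x)

/-- `x` solves `ẋ = H(x) - x` on `[0, ∞)`. As the right-hand side jumps where a coordinate of `ρ`
reaches zero, solutions are taken in the sense of Carathéodory: locally absolutely continuous
functions that satisfy the equation almost everywhere, that is, solutions of the integrated
equation. -/
def IsTrajectory (x : ℝ → N.State) : Prop :=
  ∀ t, 0 ≤ t → IntervalIntegrable (fun s => N.H (x s) - x s) volume 0 t ∧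
    x t = x 0 + ∫ s in (0 : ℝ)..t, (N.H (x s) - x s)

/-- The set `E` of equilibria. -/
def equilibria : Set N.State := {x | x ∈ N.S ∧ N.H x - x = 0}

end DCNetwork

/-!
The vector field `F` consists of the partial derivatives of an augmented Lagrangian of ESOCP,
which is convex in the primal variables and affine in the multipliers, with the opposite sign for
the multipliers and a positive projection for `ρ`; `force` is `F` without that projection. The
proof has three parts.

**Equilibria.** A compactness argument gives an optimal point of ESOCP. Slater's condition and a
separation argument give multipliers of the conic constraints, and Farkas' lemma, which needs no
qualification, gives those of the affine constraints; together they form an equilibrium with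
`ρ ≥ 0` (`exists_equilibrium`). Conversely, the primal part of each such equilibrium is optimal, by
convexity (`isOptimal_of_equilibrium`). At an equilibrium every line carries a positive conic
multiplier in at least one direction (`exists_rho_pos`). This is the dual form of the exactness of
the relaxation: the prices `μ` are positive, since a node with a nonpositive price does not
generate, hence lies below the common upper voltage limit, from which it follows that the price
spreads over the connected network; but then nobody would serve the loads.

**Lyapunov function.** For an equilibrium `c`, the function `energy c` adds the regularized gap of
the variational inequality to half of the squared distance to `c`. Both pairings that occur in its
derivative, of the force with the displacement and of the derivative of the force with the
velocity, are nonnegative, because the saddle structure cancels the terms that couple primal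
variables and multipliers (`sum_field_mul`, `force_monotone`, `sum_forceDeriv`). The velocities of
the multipliers `ρ` may jump, so the energy is compared at almost all times only
(`coordEnergy_nonneg`, `IsTrajectory.energy_sub_le`). Hence trajectories are bounded, and the
integral of the dissipation is finite.

**Convergence.** The dissipation does not control all velocities. Instead of an invariance
principle, the proof uses time averages: a function is `Negligible` if the means of its absolute
value tend to zero. Derivatives of bounded functions have mean zero, which makes it possible to
propagate negligibility from the dissipation to the velocities at the nodes (`droop_negligible`)
and, by means of the positive multiplier of an equilibrium, to all velocities of a line
(`line_negligible`). So all velocities are simultaneously small at arbitrarily late times. A limit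
point of the bounded trajectory along such times is an equilibrium `y`, and `energy y` tends to
zero along these times; as `energy y` does not increase and dominates the squared distance to `y`,
the trajectory converges to `y` (`IsTrajectory.exists_tendsto`).
-/

/-! ### Essentially bounded functions and locally Lipschitz functions of time -/

/-- `a` is measurable and essentially bounded on the set `I`. -/
structure EssBdd (I : Set ℝ) (a : ℝ → ℝ) : Prop where
  meas : AEStronglyMeasurable a (volume.restrict I)
  bdd : ∃ C, ∀ᵐ t ∂(volume.restrict I), |a t| ≤ C

namespace EssBdd

variable {I : Set ℝ} {a b : ℝ → ℝ}

lemma mono {J : Set ℝ} (h : EssBdd I a) (hJ : J ⊆ I) : EssBdd J a := by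
  obtain ⟨C, hC⟩ := h.bdd
  exact ⟨h.meas.mono_measure (Measure.restrict_mono hJ le_rfl), C,
      ae_restrict_of_ae_restrict_of_subset hJ hC⟩

lemma congr (h : EssBdd I a) (hab : ∀ᵐ t ∂(volume.restrict I), a t = b t) : EssBdd I b := by
  obtain ⟨C, hC⟩ := h.bdd
  refine ⟨h.meas.congr hab, C, ?_⟩
  filter_upwards [hC, hab] with t h1 h2
  rwa [← h2]

lemma const (c : ℝ) : EssBdd I (fun _ => c) :=
  ⟨aestronglyMeasurable_const, |c|, Eventually.of_forall fun _ => le_rfl⟩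

lemma add (ha : EssBdd I a) (hb : EssBdd I b) : EssBdd I (fun t => a t + b t) := by
  obtain ⟨C, hC⟩ := ha.bdd
  obtain ⟨D, hD⟩ := hb.bdd
  refine ⟨ha.meas.add hb.meas, C + D, ?_⟩
  filter_upwards [hC, hD] with t h1 h2
  exact (abs_add_le _ _).trans (add_le_add h1 h2)

lemma mul (ha : EssBdd I a) (hb : EssBdd I b) : EssBdd I (fun t => a t * b t) := by
  obtain ⟨C, hC⟩ := ha.bdd
  obtain ⟨D, hD⟩ := hb.bdd
  refine ⟨ha.meas.mul hb.meas, C * D, ?_⟩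
  filter_upwards [hC, hD] with t h1 h2
  rw [abs_mul]
  exact mul_le_mul h1 h2 (abs_nonneg _) ((abs_nonneg _).trans h1)

lemma const_mul (c : ℝ) (ha : EssBdd I a) : EssBdd I (fun t => c * a t) := (const c).mul ha

lemma neg (ha : EssBdd I a) : EssBdd I (fun t => -a t) := by
  simpa using ha.const_mul (-1)

lemma sub (ha : EssBdd I a) (hb : EssBdd I b) : EssBdd I (fun t => a t - b t) := by
  simpa [sub_eq_add_neg] using ha.add hb.neg

lemma sq (ha : EssBdd I a) : EssBdd I (fun t => a t ^ 2) := by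
  simpa [_root_.sq] using ha.mul ha

lemma abs (ha : EssBdd I a) : EssBdd I (fun t => |a t|) := by
  obtain ⟨C, hC⟩ := ha.bdd
  exact ⟨by simpa using ha.meas.norm, C, by simpa using hC⟩

lemma intervalIntegrable {s t : ℝ} (h : EssBdd (Set.Ioc s t) a) (hst : s ≤ t) :
    IntervalIntegrable a volume s t := by
  obtain ⟨C, hC⟩ := h.bdd
  rw [intervalIntegrable_iff_integrableOn_Ioc_of_le hst]
  exact Integrable.of_bound h.meas C hC

end EssBdd

/-- `A` is Lipschitz on the bounded intervals of `[0, ∞)`, and `a` is its derivative almost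
everywhere. -/
structure LipDeriv (A a : ℝ → ℝ) : Prop where
  lip : ∀ T, ∃ K, ∀ s ∈ Set.Icc 0 T, ∀ t ∈ Set.Icc 0 T, |A s - A t| ≤ K * |s - t|
  hasDeriv : ∀ᵐ t, 0 < t → HasDerivAt A (a t) t

namespace LipDeriv

variable {A B a b : ℝ → ℝ}

lemma exists_lip_nonneg (h : LipDeriv A a) (T : ℝ) :
    ∃ K, 0 ≤ K ∧ ∀ s ∈ Set.Icc 0 T, ∀ t ∈ Set.Icc 0 T, |A s - A t| ≤ K * |s - t| := by
  obtain ⟨K, hK⟩ := h.lip T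
  refine ⟨|K|, abs_nonneg _, fun s hs t ht => (hK s hs t ht).trans ?_⟩
  gcongr
  exact le_abs_self K

lemma exists_bound (h : LipDeriv A a) (T : ℝ) : ∃ C, 0 ≤ C ∧ ∀ s ∈ Set.Icc 0 T, |A s| ≤ C := by
  obtain ⟨K, hK0, hK⟩ := h.exists_lip_nonneg T
  refine ⟨|A 0| + K * |T|, by positivity, fun s hs => ?_⟩
  have h0 : (0 : ℝ) ∈ Set.Icc 0 T := ⟨le_rfl, hs.1.trans hs.2⟩
  have h1 := hK s hs 0 h0
  have h2 : |s - 0| ≤ |T| := by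
    rw [sub_zero, abs_of_nonneg hs.1]; exact hs.2.trans (le_abs_self T)
  have h3 : |A s| ≤ |A 0| + |A s - A 0| := by
    have := abs_add_le (A 0) (A s - A 0); simpa using this
  nlinarith [mul_le_mul_of_nonneg_left h2 hK0]

lemma absolutelyContinuous (h : LipDeriv A a) {s t : ℝ} (hs : 0 ≤ s) (hst : s ≤ t) :
    AbsolutelyContinuousOnInterval A s t := by
  obtain ⟨K, hK0, hK⟩ := h.exists_lip_nonneg t
  apply LipschitzOnWith.absolutelyContinuousOnInterval (K := K.toNNReal)
  refine LipschitzOnWith.of_dist_le_mul fun u hu v hv => ?_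
  rw [Set.uIcc_of_le hst] at hu hv
  rw [Real.dist_eq, Real.dist_eq, Real.coe_toNNReal _ hK0]
  exact hK u ⟨hs.trans hu.1, hu.2⟩ v ⟨hs.trans hv.1, hv.2⟩

lemma continuousOn (h : LipDeriv A a) : ContinuousOn A (Set.Ici 0) := by
  intro t ht
  have h1 : ContinuousOn A (Set.Icc 0 (t + 1)) := by
    have := (h.absolutelyContinuous le_rfl
      (by linarith [Set.mem_Ici.1 ht] : (0 : ℝ) ≤ t + 1)).continuousOn
    rwa [Set.uIcc_of_le (by linarith [Set.mem_Ici.1 ht])] at this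
  have h2 := h1 t ⟨ht, by linarith⟩
  refine h2.mono_of_mem_nhdsWithin ?_
  filter_upwards [self_mem_nhdsWithin, mem_nhdsWithin_of_mem_nhds
      (Iic_mem_nhds (by linarith : t < t + 1))]
    with u hu1 hu2 using ⟨hu1, hu2⟩

lemma deriv_eq (h : LipDeriv A a) : ∀ᵐ t, 0 < t → deriv A t = a t := by
  filter_upwards [h.hasDeriv] with t ht h0 using (ht h0).deriv

/-- The fundamental theorem of calculus. -/
lemma integral_eq (h : LipDeriv A a) {s t : ℝ} (hs : 0 ≤ s) (hst : s ≤ t) :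
    ∫ u in s..t, a u = A t - A s := by
  rw [← (h.absolutelyContinuous hs hst).integral_deriv_eq_sub]
  refine intervalIntegral.integral_congr_ae ?_
  filter_upwards [h.deriv_eq] with u hu hu2
  rw [Set.uIoc_of_le hst] at hu2
  exact (hu (hs.trans_lt hu2.1)).symm

lemma essBdd_left (h : LipDeriv A a) (T : ℝ) : EssBdd (Set.Ioc 0 T) A := by
  obtain ⟨C, -, hC⟩ := h.exists_bound T
  refine ⟨(h.continuousOn.mono fun t ht => ht.1.le).aestronglyMeasurable measurableSet_Ioc, C, ?_⟩
  exact (ae_restrict_iff' measurableSet_Ioc).2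
    (Eventually.of_forall fun t ht => hC t ⟨ht.1.le, ht.2⟩)

/-- The difference quotients of a Lipschitz function bound its derivative. -/
lemma abs_deriv_le {K c t l r : ℝ} (hl : l < t) (hr : t < r)
    (hK : ∀ s ∈ Set.Ioo l r, |A s - A t| ≤ K * |s - t|) (hd : HasDerivAt A c t) : |c| ≤ K := by
  have h1 := hd.tendsto_slope.abs
  refine le_of_tendsto h1 ?_
  filter_upwards [self_mem_nhdsWithin, mem_nhdsWithin_of_mem_nhds (Ioo_mem_nhds hl hr)] with s
      hs1 hs2
  rw [slope_def_field, abs_div, div_le_iff₀ (abs_pos.2 (sub_ne_zero.2 hs1))]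
  exact hK s hs2

lemma aestronglyMeasurable_right (h : LipDeriv A a) :
    AEStronglyMeasurable a (volume.restrict (Set.Ioi 0)) := by
  have h1 : AEStronglyMeasurable (deriv A) (volume.restrict (Set.Ioi 0)) :=
    (measurable_deriv A).aestronglyMeasurable
  refine h1.congr ((ae_restrict_iff' measurableSet_Ioi).2 ?_)
  filter_upwards [h.deriv_eq] with t ht ht0 using ht ht0

lemma essBdd_right (h : LipDeriv A a) (T : ℝ) : EssBdd (Set.Ioc 0 T) a := by
  obtain ⟨K, hK⟩ := h.lip (T + 1)
  refine ⟨h.aestronglyMeasurable_right.mono_measure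
    (Measure.restrict_mono (fun t ht => ht.1) le_rfl), K, ?_⟩
  rw [ae_restrict_iff' measurableSet_Ioc]
  filter_upwards [h.hasDeriv] with t ht ht2
  exact abs_deriv_le ht2.1 (by linarith [ht2.2] : t < T + 1)
    (fun s hs => hK s ⟨hs.1.le, hs.2.le⟩ t ⟨ht2.1.le, by linarith [ht2.2]⟩) (ht ht2.1)

lemma const (c : ℝ) : LipDeriv (fun _ => c) (fun _ => 0) :=
  ⟨fun _ => ⟨0, by simp⟩, Eventually.of_forall fun t _ => hasDerivAt_const t c⟩

lemma add (ha : LipDeriv A a) (hb : LipDeriv B b) :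
    LipDeriv (fun t => A t + B t) (fun t => a t + b t) := by
  constructor
  · intro T
    obtain ⟨K, hK⟩ := ha.lip T
    obtain ⟨L, hL⟩ := hb.lip T
    refine ⟨K + L, fun s hs t ht => ?_⟩
    calc |A s + B s - (A t + B t)| = |(A s - A t) + (B s - B t)| := by ring_nf
      _ ≤ _ := abs_add_le _ _
      _ ≤ _ := by rw [add_mul]; exact add_le_add (hK s hs t ht) (hL s hs t ht)
  · filter_upwards [ha.hasDeriv, hb.hasDeriv] with t h1 h2 h0 using (h1 h0).add (h2 h0)

lemma mul (ha : LipDeriv A a) (hb : LipDeriv B b) :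
    LipDeriv (fun t => A t * B t) (fun t => a t * B t + A t * b t) := by
  constructor
  · intro T
    obtain ⟨K, hK0, hK⟩ := ha.exists_lip_nonneg T
    obtain ⟨L, hL0, hL⟩ := hb.exists_lip_nonneg T
    obtain ⟨C, hC0, hC⟩ := ha.exists_bound T
    obtain ⟨D, hD0, hD⟩ := hb.exists_bound T
    refine ⟨K * D + C * L, fun s hs t ht => ?_⟩
    calc |A s * B s - A t * B t| = |(A s - A t) * B s + A t * (B s - B t)| := by ring_nf
      _ ≤ |(A s - A t) * B s| + |A t * (B s - B t)| := abs_add_le _ _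
      _ = |A s - A t| * |B s| + |A t| * |B s - B t| := by rw [abs_mul, abs_mul]
      _ ≤ (K * |s - t|) * D + C * (L * |s - t|) := by
        gcongr
        · exact hK s hs t ht
        · exact hD s hs
        · exact hC t ht
        · exact hL s hs t ht
      _ = _ := by ring
  · filter_upwards [ha.hasDeriv, hb.hasDeriv] with t h1 h2 h0 using (h1 h0).mul (h2 h0)

lemma const_mul (c : ℝ) (ha : LipDeriv A a) : LipDeriv (fun t => c * A t) (fun t => c * a t) := by
  simpa using (const c).mul ha

lemma neg (ha : LipDeriv A a) : LipDeriv (fun t => -A t) (fun t => -a t) := by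
  simpa using ha.const_mul (-1)

lemma sub (ha : LipDeriv A a) (hb : LipDeriv B b) :
    LipDeriv (fun t => A t - B t) (fun t => a t - b t) := by
  simpa [sub_eq_add_neg] using ha.add hb.neg

lemma sub_const (ha : LipDeriv A a) (c : ℝ) : LipDeriv (fun t => A t - c) a := by
  simpa using ha.sub (const c)

lemma comp {φ φ' : ℝ → ℝ} (ha : LipDeriv A a) (hφ : ∀ t, 0 ≤ t → HasDerivAt φ (φ' (A t)) (A t))
    (hlip : ∀ T, ∃ K, 0 ≤ K ∧ ∀ s ∈ Set.Icc 0 T, ∀ t ∈ Set.Icc 0 T,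
      |φ (A s) - φ (A t)| ≤ K * |A s - A t|) :
    LipDeriv (fun t => φ (A t)) (fun t => φ' (A t) * a t) := by
  constructor
  · intro T
    obtain ⟨K, hK⟩ := ha.lip T
    obtain ⟨L, hL0, hL⟩ := hlip T
    refine ⟨L * K, fun s hs t ht => (hL s hs t ht).trans ?_⟩
    rw [mul_assoc]
    exact mul_le_mul_of_nonneg_left (hK s hs t ht) hL0
  · filter_upwards [ha.hasDeriv] with t h1 h0
    exact (hφ t h0.le).comp t (h1 h0)

lemma inv (ha : LipDeriv A a) {c : ℝ} (hc : 0 < c) (hA : ∀ t, 0 ≤ t → c ≤ A t) :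
    LipDeriv (fun t => (A t)⁻¹) (fun t => -((A t)⁻¹ ^ 2) * a t) := by
  refine ha.comp (φ := fun x => x⁻¹) (φ' := fun x => -(x⁻¹ ^ 2)) (fun t ht => ?_) fun T => ?_
  · have h0 : A t ≠ 0 := (hc.trans_le (hA t ht)).ne'
    simpa using hasDerivAt_inv h0
  · refine ⟨(c * c)⁻¹, by positivity, fun s hs t ht => ?_⟩
    have h1 := hA s hs.1
    have h2 := hA t ht.1
    have e : (A s)⁻¹ - (A t)⁻¹ = (A s * A t)⁻¹ * (A t - A s) := by
      have := (hc.trans_le h1).ne'; have := (hc.trans_le h2).ne'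
      field_simp
    rw [e, abs_mul, abs_sub_comm (A t), abs_of_pos (inv_pos.2
        (mul_pos (hc.trans_le h1) (hc.trans_le h2)))]
    gcongr
    exact hc.le.trans h1

lemma comp_contDiff {φ : ℝ → ℝ} (hφ : ContDiff ℝ 1 φ) (ha : LipDeriv A a) :
    LipDeriv (fun t => φ (A t)) (fun t => deriv φ (A t) * a t) := by
  refine ha.comp (φ' := deriv φ) (fun t _ => (hφ.differentiable one_ne_zero _).hasDerivAt)
    fun T => ?_
  obtain ⟨C, hC0, hC⟩ := ha.exists_bound T
  obtain ⟨K, hK⟩ := (isCompact_Icc (a := -C) (b := C)).exists_bound_of_continuousOn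
    (hφ.continuous_deriv_one).continuousOn
  refine ⟨|K|, abs_nonneg _, fun s hs t ht => ?_⟩
  have := (convex_Icc (-C) C).norm_image_sub_le_of_norm_deriv_le (f := φ) (C := |K|)
    (fun x _ => hφ.differentiable one_ne_zero x) (fun x hx => (hK x hx).trans (le_abs_self K))
    (abs_le.1 (hC t ht)) (abs_le.1 (hC s hs))
  simpa using this

end LipDeriv

/-! ### Energy estimates for a single coordinate -/

/-- The point of `[a, b]` nearest to `s`. -/
noncomputable def clip (a b s : ℝ) : ℝ := max a (min b s)

lemma clip_mem {a b : ℝ} (hab : a ≤ b) (s : ℝ) : a ≤ clip a b s ∧ clip a b s ≤ b :=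
  ⟨le_max_left _ _, max_le hab (min_le_left _ _)⟩

/-- The variational inequality that characterizes the nearest point of an interval. -/
lemma clip_variational {a b : ℝ} (s : ℝ) {x : ℝ} (hx : a ≤ x ∧ x ≤ b) :
    0 ≤ (s - clip a b s) * (clip a b s - x) := by
  unfold clip
  rcases le_total b s with h | h
  · rw [min_eq_left h, max_eq_right (hx.1.trans hx.2)]
    exact mul_nonneg (by linarith) (by linarith [hx.2])
  · rw [min_eq_right h]
    rcases le_total a s with h' | h'
    · rw [max_eq_right h']; simp
    · rw [max_eq_left h']
      exact mul_nonneg_of_nonpos_of_nonpos (by linarith) (by linarith [hx.1])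

lemma half_sq_sub_clip_bounds {a b : ℝ} (hab : a ≤ b) (s t : ℝ) :
    0 ≤ 1 / 2 * (t - clip a b t) ^ 2 - 1 / 2 * (s - clip a b s) ^ 2 - (s - clip a b s) * (t - s) ∧
    1 / 2 * (t - clip a b t) ^ 2 - 1 / 2 * (s - clip a b s) ^ 2 - (s - clip a b s) * (t - s)
      ≤ 1 / 2 * (t - s) ^ 2 := by
  have h1 := clip_variational s (clip_mem hab t)
  have h2 := clip_variational t (clip_mem hab s)
  constructor
  · nlinarith [sq_nonneg ((t - clip a b t) - (s - clip a b s))]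
  · nlinarith [sq_nonneg (clip a b t - clip a b s)]

/-- Half of the squared distance to an interval is differentiable, although the projection is not.
-/
lemma hasDerivAt_half_sq_sub_clip {a b : ℝ} (hab : a ≤ b) (s : ℝ) :
    HasDerivAt (fun x => 1 / 2 * (x - clip a b x) ^ 2) (s - clip a b s) s := by
  rw [hasDerivAt_iff_isLittleO]
  refine Asymptotics.IsBigO.trans_isLittleO (g := fun x : ℝ => (x - s) ^ 2) ?_ ?_
  · refine Asymptotics.IsBigO.of_bound (1 / 2) (Eventually.of_forall fun x => ?_)
    obtain ⟨h1, h2⟩ := half_sq_sub_clip_bounds hab s x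
    rw [smul_eq_mul, mul_comm (x - s), Real.norm_eq_abs, abs_of_nonneg h1, Real.norm_eq_abs,
      abs_of_nonneg (sq_nonneg _)]
    exact h2
  · simpa using Asymptotics.isLittleO_pow_sub_sub s (one_lt_two (α := ℕ))

lemma LipDeriv.half_sq_sub_clip {a b : ℝ} (hab : a ≤ b) {A α : ℝ → ℝ} (h : LipDeriv A α) :
    LipDeriv (fun t => 1 / 2 * (A t - clip a b (A t)) ^ 2)
      (fun t => (A t - clip a b (A t)) * α t) := by
  refine h.comp (φ := fun x => 1 / 2 * (x - clip a b x) ^ 2) (φ' := fun x => x - clip a b x)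
    (fun t _ => hasDerivAt_half_sq_sub_clip hab _) fun T => ?_
  obtain ⟨C, hC0, hC⟩ := h.exists_bound T
  obtain ⟨K, hK⟩ := (isCompact_Icc (a := -C) (b := C)).exists_bound_of_continuousOn
    (f := fun x => x - clip a b x) (by unfold clip; fun_prop)
  refine ⟨|K|, abs_nonneg _, fun s hs t ht => ?_⟩
  have := (convex_Icc (-C) C).norm_image_sub_le_of_norm_hasDerivWithin_le (C := |K|)
    (fun x _ => (hasDerivAt_half_sq_sub_clip hab x).hasDerivWithinAt)
    (fun x hx => (hK x hx).trans (le_abs_self K))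
    (abs_le.1 (hC t ht)) (abs_le.1 (hC s hs))
  simpa using this

/-- The energy of a coordinate `X` with velocity `κ` and force `Φ`, relative to `c`: the regularized
gap `-Φ κ - κ² / 2` plus half of the squared distance to `c`. -/
noncomputable def coordEnergy (X κ Φ : ℝ → ℝ) (c t : ℝ) : ℝ :=
  -(Φ t * κ t) - 1 / 2 * κ t ^ 2 + 1 / 2 * (X t - c) ^ 2

/-- A free coordinate, which moves with velocity `-Φ`. -/
lemma coordEnergy_free {X κ Φ φ : ℝ → ℝ} (hX : LipDeriv X κ) (hΦ : LipDeriv Φ φ)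
    (hκ : ∀ t, 0 ≤ t → κ t = -Φ t) (c : ℝ) {s t : ℝ} (hs : 0 ≤ s) (hst : s ≤ t) :
    coordEnergy X κ Φ c t - coordEnergy X κ Φ c s
      ≤ ∫ u in s..t, (-(κ u * φ u) - Φ u * (X u - c)) := by
  have h := ((hΦ.mul hΦ).const_mul (1 / 2)).add
    (((hX.sub_const c).mul (hX.sub_const c)).const_mul (1 / 2))
  have e : ∀ u, 0 ≤ u → coordEnergy X κ Φ c u
      = 1 / 2 * (Φ u * Φ u) + 1 / 2 * ((X u - c) * (X u - c)) := fun u hu => by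
    unfold coordEnergy; rw [hκ u hu]; ring
  rw [e t (hs.trans hst), e s hs, ← h.integral_eq hs hst]
  refine (intervalIntegral.integral_congr fun u hu => ?_).le
  rw [Set.uIcc_of_le hst] at hu
  have := hκ u (hs.trans hu.1)
  simp only [this]; ring

/-- A coordinate confined to `[a, b]`, which moves towards the projection of `X - Φ`. -/
lemma coordEnergy_box {X κ Φ φ : ℝ → ℝ} {a b : ℝ} (hX : LipDeriv X κ) (hΦ : LipDeriv Φ φ)
    (hκ : ∀ t, 0 ≤ t → κ t = clip a b (X t - Φ t) - X t) {c : ℝ} (hc : a ≤ c ∧ c ≤ b)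
    {s t : ℝ} (hs : 0 ≤ s) (hst : s ≤ t) :
    coordEnergy X κ Φ c t - coordEnergy X κ Φ c s
      ≤ ∫ u in s..t, (-(κ u * φ u) - Φ u * (X u - c)) := by
  have hab := hc.1.trans hc.2
  have h := (((hΦ.mul hΦ).const_mul (1 / 2)).sub ((hX.sub hΦ).half_sq_sub_clip hab)).add
    (((hX.sub_const c).mul (hX.sub_const c)).const_mul (1 / 2))
  have e : ∀ u, 0 ≤ u → coordEnergy X κ Φ c u
      = 1 / 2 * (Φ u * Φ u) - 1 / 2 * ((X u - Φ u) - clip a b (X u - Φ u)) ^ 2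
        + 1 / 2 * ((X u - c) * (X u - c)) := fun u hu => by
    unfold coordEnergy; rw [hκ u hu]; ring
  have hkX : ∀ u, 0 ≤ u → clip a b (X u - Φ u) = κ u + X u := fun u hu => by rw [hκ u hu]; ring
  have i1 : EssBdd (Set.Ioc s t) _ :=
    (((hX.essBdd_right t).mul (hΦ.essBdd_right t)).neg.sub
      ((hΦ.essBdd_left t).mul ((hX.sub_const c).essBdd_left t))).mono
      (Set.Ioc_subset_Ioc_left hs)
  rw [e t (hs.trans hst), e s hs, ← h.integral_eq hs hst]
  refine intervalIntegral.integral_mono_on hst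
    ((h.essBdd_right t).mono (Set.Ioc_subset_Ioc_left hs) |>.intervalIntegrable hst)
    (i1.intervalIntegrable hst) fun u hu => ?_
  have hv := clip_variational (X u - Φ u) hc
  rw [hkX u (hs.trans hu.1)] at hv ⊢
  nlinarith

/-- A nonnegative coordinate `X`, which moves with velocity `g` while it is positive and with
velocity `max g 0` while it vanishes. The velocity has downward jumps, so the energy need not be
continuous; the estimate comes from the difference quotients of `X`, which obey a monotone law. -/
lemma coordEnergy_nonneg {X κ g γ : ℝ → ℝ} (hX : LipDeriv X κ) (hg : LipDeriv g γ)
    (hκ : ∀ t, 0 ≤ t → κ t = DCNetwork.posProj (X t) (g t)) (hX0 : ∀ t, 0 ≤ t → 0 ≤ X t)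
    {c : ℝ} {s t : ℝ} (hs : 0 < s) (hst : s ≤ t)
    (hds : HasDerivAt X (κ s) s) (hdt : HasDerivAt X (κ t) t) :
    coordEnergy X κ (fun u => -g u) c t - coordEnergy X κ (fun u => -g u) c s
      ≤ ∫ u in s..t, (κ u * γ u + g u * (X u - c) - (κ u - g u) * c) := by
  -- the part of the velocity that keeps `X` nonnegative
  have hη0 : ∀ u, 0 ≤ u → 0 ≤ κ u - g u := fun u hu => by
    rw [hκ u hu, DCNetwork.posProj]; split_ifs with h
    · simp
    · push Not at h; linarith [h.2]
  have hηX : ∀ u, 0 ≤ u → (κ u - g u) * X u = 0 := fun u hu => by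
    rw [hκ u hu, DCNetwork.posProj]; split_ifs with h
    · simp
    · push Not at h
      rw [le_antisymm h.1 (hX0 u hu), mul_zero]
  have hκκ : ∀ u, 0 ≤ u → κ u * κ u = g u * κ u := fun u hu => by
    rw [hκ u hu, DCNetwork.posProj]; split_ifs with h <;> simp
  have e : ∀ u, 0 ≤ u → coordEnergy X κ (fun u => -g u) c u
      = 1 / 2 * κ u ^ 2 + 1 / 2 * ((X u - c) * (X u - c)) := fun u hu => by
    unfold coordEnergy
    have := hκκ u hu
    linear_combination -this
  have hsub : Set.Ioc s t ⊆ Set.Ioc 0 t := Set.Ioc_subset_Ioc_left hs.le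
  have i1 : IntervalIntegrable (fun u => κ u * γ u) volume s t :=
    (((hX.essBdd_right t).mul (hg.essBdd_right t)).mono hsub).intervalIntegrable hst
  have i2 : IntervalIntegrable (fun u => g u * (X u - c) - (κ u - g u) * c) volume s t :=
    ((((hg.essBdd_left t).mul ((hX.sub_const c).essBdd_left t)).sub
      (((hX.essBdd_right t).sub (hg.essBdd_left t)).mul (EssBdd.const c))).mono
      hsub).intervalIntegrable hst
  -- the squared distance
  have hdist : 1 / 2 * ((X t - c) * (X t - c)) - 1 / 2 * ((X s - c) * (X s - c))
      = ∫ u in s..t, (g u * (X u - c) - (κ u - g u) * c) := by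
    have h := ((hX.sub_const c).mul (hX.sub_const c)).const_mul (1 / 2)
    rw [← h.integral_eq hs.le hst]
    refine intervalIntegral.integral_congr fun u hu => ?_
    rw [Set.uIcc_of_le hst] at hu
    have := hηX u (hs.le.trans hu.1)
    linear_combination this
  -- the squared velocity
  have hvel : 1 / 2 * κ t ^ 2 - 1 / 2 * κ s ^ 2 ≤ ∫ u in s..t, κ u * γ u := by
    obtain ⟨K, hK0, hK⟩ := hX.exists_lip_nonneg (t + 1)
    obtain ⟨L, hL0, hL⟩ := hg.exists_lip_nonneg (t + 1)
    obtain ⟨h, hpos, hle, hlim⟩ : ∃ h : ℕ → ℝ, (∀ n, 0 < h n) ∧ (∀ n, h n ≤ 1) ∧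
        Tendsto h atTop (𝓝 0) := by
      refine ⟨fun n => 1 / ((n : ℝ) + 1), fun n => Nat.one_div_pos_of_nat, fun n => ?_,
        tendsto_one_div_add_atTop_nhds_zero_nat⟩
      rw [div_le_one (by positivity)]
      linarith [(Nat.cast_nonneg n : (0 : ℝ) ≤ n)]
    have hslope : ∀ {f : ℝ → ℝ} {f' u : ℝ}, HasDerivAt f f' u →
        Tendsto (fun n => (f (u + h n) - f u) / h n) atTop (𝓝 f') := by
      intro f f' u hf
      have h1 := hf.tendsto_slope
      have h2 : Tendsto (fun n => u + h n) atTop (𝓝[≠] u) := by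
        refine tendsto_nhdsWithin_iff.2 ⟨by simpa using hlim.const_add u, ?_⟩
        exact Eventually.of_forall fun n => by simp [(hpos n).ne']
      refine (h1.comp h2).congr fun n => ?_
      simp [slope_def_field]
    have hshift : ∀ n, LipDeriv (fun u => X (u + h n) - X u) (fun u => κ (u + h n) - κ u) := by
      intro n
      refine LipDeriv.sub ⟨fun T => ?_, ?_⟩ hX
      · obtain ⟨M, hM⟩ := hX.lip (T + 1)
        refine ⟨M, fun p hp q hq => ?_⟩
        have := hM (p + h n) ⟨by linarith [hp.1, hpos n], by linarith [hp.2, hle n]⟩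
          (q + h n) ⟨by linarith [hq.1, hpos n], by linarith [hq.2, hle n]⟩
        simpa using this
      · have := (measurePreserving_add_right (volume : Measure ℝ) (h n)).quasiMeasurePreserving.ae
          hX.hasDeriv
        filter_upwards [this] with u hu hu0
        simpa using (hu (by linarith [hpos n])).comp_add_const u (h n)
    have hineq : ∀ n, 1 / 2 * ((X (t + h n) - X t) / h n) ^ 2
        - 1 / 2 * ((X (s + h n) - X s) / h n) ^ 2
        ≤ ∫ u in s..t, ((X (u + h n) - X u) / h n) * ((g (u + h n) - g u) / h n) := by
      intro n
      have hsq := ((hshift n).mul (hshift n)).const_mul (1 / (2 * h n ^ 2))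
      have := hsq.integral_eq hs.le hst
      have e1 : 1 / 2 * ((X (t + h n) - X t) / h n) ^ 2 - 1 / 2 * ((X (s + h n) - X s) / h n) ^ 2
          = ∫ u in s..t, 1 / (2 * h n ^ 2) * ((κ (u + h n) - κ u) * (X (u + h n) - X u)
            + (X (u + h n) - X u) * (κ (u + h n) - κ u)) := by
        rw [this]; field_simp
      rw [e1]
      refine intervalIntegral.integral_mono_on hst
        (((hsq.essBdd_right t).mono hsub).intervalIntegrable hst) ?_ fun u hu => ?_
      · have hgs : ContinuousOn (fun u => ((X (u + h n) - X u) / h n) * ((g (u + h n) - g u) / h n))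
            (Set.uIcc s t) := by
          have hm : Set.MapsTo (fun u => u + h n) (Set.uIcc s t) (Set.Ici 0) := fun u hu => by
            rw [Set.uIcc_of_le hst] at hu; exact (by linarith [hu.1, hpos n] : (0 : ℝ) ≤ u + h n)
          have hm' : Set.uIcc s t ⊆ Set.Ici 0 := fun u hu => by
            rw [Set.uIcc_of_le hst] at hu; exact (by linarith [hu.1] : (0 : ℝ) ≤ u)
          have a1 := hX.continuousOn.comp (by fun_prop) hm
          have a2 := hg.continuousOn.comp (by fun_prop) hm
          exact ((a1.sub (hX.continuousOn.mono hm')).div_const _).mul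
            ((a2.sub (hg.continuousOn.mono hm')).div_const _)
        exact hgs.intervalIntegrable
      · have hu0 : 0 ≤ u := hs.le.trans hu.1
        have hu1 : 0 ≤ u + h n := by linarith [hpos n]
        have m : (X (u + h n) - X u) * (κ (u + h n) - κ u)
            ≤ (X (u + h n) - X u) * (g (u + h n) - g u) := by
          have a1 := hηX u hu0
          have a2 := hηX _ hu1
          have a3 := mul_nonneg (hη0 u hu0) (hX0 _ hu1)
          have a4 := mul_nonneg (hη0 _ hu1) (hX0 _ hu0)
          nlinarith
        have e2 : ((X (u + h n) - X u) / h n) * ((g (u + h n) - g u) / h n)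
            = 1 / h n ^ 2 * ((X (u + h n) - X u) * (g (u + h n) - g u)) := by
          field_simp
        rw [e2]
        have e3 : 1 / (2 * h n ^ 2) * ((κ (u + h n) - κ u) * (X (u + h n) - X u)
            + (X (u + h n) - X u) * (κ (u + h n) - κ u))
            = 1 / h n ^ 2 * ((X (u + h n) - X u) * (κ (u + h n) - κ u)) := by
          field_simp; ring
        rw [e3]
        exact mul_le_mul_of_nonneg_left m (by positivity)
    have hR : Tendsto (fun n => ∫ u in s..t, ((X (u + h n) - X u) / h n) *
        ((g (u + h n) - g u) / h n))
        atTop (𝓝 (∫ u in s..t, κ u * γ u)) := by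
      refine intervalIntegral.tendsto_integral_filter_of_dominated_convergence (fun _ => K * L)
        (Eventually.of_forall fun n => ?_) (Eventually.of_forall fun n => ?_) (by simp) ?_
      · have hm : Set.MapsTo (fun u => u + h n) (Set.uIoc s t) (Set.Ici 0) := fun u hu => by
          rw [Set.uIoc_of_le hst] at hu; exact (by linarith [hu.1, hpos n] : (0 : ℝ) ≤ u + h n)
        have hm' : Set.uIoc s t ⊆ Set.Ici 0 := fun u hu => by
          rw [Set.uIoc_of_le hst] at hu; exact (by linarith [hu.1] : (0 : ℝ) ≤ u)
        have a1 := hX.continuousOn.comp (by fun_prop) hm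
        have a2 := hg.continuousOn.comp (by fun_prop) hm
        exact (((a1.sub (hX.continuousOn.mono hm')).div_const _).mul
          ((a2.sub (hg.continuousOn.mono hm')).div_const _)).aestronglyMeasurable
          measurableSet_uIoc
      · refine Eventually.of_forall fun u hu => ?_
        rw [Set.uIoc_of_le hst] at hu
        have m1 : u ∈ Set.Icc 0 (t + 1) := ⟨by linarith [hu.1], by linarith [hu.2]⟩
        have m2 : u + h n ∈ Set.Icc 0 (t + 1) :=
          ⟨by linarith [hu.1, hpos n], by linarith [hu.2, hle n]⟩
        have b1 := hK _ m2 _ m1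
        have b2 := hL _ m2 _ m1
        rw [add_sub_cancel_left, abs_of_pos (hpos n)] at b1 b2
        rw [norm_mul, Real.norm_eq_abs, Real.norm_eq_abs, abs_div, abs_div, abs_of_pos (hpos n)]
        exact mul_le_mul ((div_le_iff₀ (hpos n)).2 b1) ((div_le_iff₀ (hpos n)).2 b2)
          (div_nonneg (abs_nonneg _) (hpos n).le) hK0
      · filter_upwards [hX.hasDeriv, hg.hasDeriv] with u h1 h2 hu
        rw [Set.uIoc_of_le hst] at hu
        exact (hslope (h1 (hs.trans hu.1))).mul (hslope (h2 (hs.trans hu.1)))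
    exact le_of_tendsto_of_tendsto' ((((hslope hdt).pow 2).const_mul _).sub
      (((hslope hds).pow 2).const_mul _)) hR hineq
  rw [e t (hs.le.trans hst), e s hs.le]
  have : ∫ u in s..t, (κ u * γ u + g u * (X u - c) - (κ u - g u) * c)
      = (∫ u in s..t, κ u * γ u) + ∫ u in s..t, (g u * (X u - c) - (κ u - g u) * c) := by
    rw [← intervalIntegral.integral_add i1 i2]
    exact intervalIntegral.integral_congr fun u _ => by ring
  rw [this, ← hdist]
  linarith

/-! ### Time averages -/

/-- `a` is essentially bounded on `(0, ∞)` and its time averages tend to `0`. -/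
structure MeanZero (a : ℝ → ℝ) : Prop where
  essBdd : EssBdd (Set.Ioi 0) a
  lim : Tendsto (fun T : ℝ => T⁻¹ * ∫ t in (0 : ℝ)..T, a t) atTop (𝓝 0)

/-- `a` is essentially bounded on `(0, ∞)` and the time averages of `|a|` tend to `0`. -/
structure Negligible (a : ℝ → ℝ) : Prop where
  essBdd : EssBdd (Set.Ioi 0) a
  abs : MeanZero fun t => |a t|

lemma EssBdd.intervalIntegrable_Ioi {a : ℝ → ℝ} (h : EssBdd (Set.Ioi 0) a) {s t : ℝ} (hs : 0 ≤ s)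
    (hst : s ≤ t) : IntervalIntegrable a volume s t :=
  (h.mono fun _ hu => hs.trans_lt hu.1).intervalIntegrable hst

lemma integral_mono_of_ae_pos {a b : ℝ → ℝ} {s t : ℝ} (hs : 0 ≤ s) (hst : s ≤ t)
    (ha : IntervalIntegrable a volume s t) (hb : IntervalIntegrable b volume s t)
    (h : ∀ᵐ u, 0 < u → a u ≤ b u) : ∫ u in s..t, a u ≤ ∫ u in s..t, b u := by
  rw [intervalIntegral.integral_of_le hst, intervalIntegral.integral_of_le hst]
  refine setIntegral_mono_ae_restrict ha.1 hb.1 ((ae_restrict_iff' measurableSet_Ioc).2 ?_)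
  filter_upwards [h] with u hu hu2 using hu (hs.trans_lt hu2.1)

namespace MeanZero

variable {a b : ℝ → ℝ}

lemma congr (h : MeanZero a) (hab : ∀ᵐ t, 0 < t → a t = b t) : MeanZero b := by
  refine ⟨h.essBdd.congr ((ae_restrict_iff' measurableSet_Ioi).2 hab), h.lim.congr' ?_⟩
  filter_upwards [eventually_ge_atTop 0] with T hT
  congr 1
  refine intervalIntegral.integral_congr_ae ?_
  filter_upwards [hab] with t ht htT
  rw [Set.uIoc_of_le hT] at htT
  exact ht htT.1

lemma congr' (h : MeanZero a) (hab : ∀ t, 0 ≤ t → a t = b t) : MeanZero b :=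
  h.congr (Eventually.of_forall fun t ht => hab t ht.le)

lemma add (ha : MeanZero a) (hb : MeanZero b) : MeanZero (fun t => a t + b t) := by
  refine ⟨ha.essBdd.add hb.essBdd, ?_⟩
  have := ha.lim.add hb.lim
  rw [add_zero] at this
  refine this.congr' ?_
  filter_upwards [eventually_ge_atTop 0] with T hT
  rw [intervalIntegral.integral_add (ha.essBdd.intervalIntegrable_Ioi le_rfl hT)
    (hb.essBdd.intervalIntegrable_Ioi le_rfl hT), mul_add]

lemma const_mul (c : ℝ) (ha : MeanZero a) : MeanZero (fun t => c * a t) := by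
  refine ⟨ha.essBdd.const_mul c, ?_⟩
  have := ha.lim.const_mul c
  rw [mul_zero] at this
  refine this.congr fun T => ?_
  rw [intervalIntegral.integral_const_mul]; ring

lemma neg (ha : MeanZero a) : MeanZero (fun t => -a t) := by
  simpa using ha.const_mul (-1)

lemma sub (ha : MeanZero a) (hb : MeanZero b) : MeanZero (fun t => a t - b t) := by
  simpa [sub_eq_add_neg] using ha.add hb.neg

lemma of_abs_le {ε : ℝ → ℝ → ℝ} (ha : EssBdd (Set.Ioi 0) a)
    (hε : ∀ δ, 0 < δ → MeanZero (ε δ))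
    (h : ∀ δ, 0 < δ → ∀ᵐ t, 0 < t → |a t| ≤ δ + ε δ t) : MeanZero a := by
  refine ⟨ha, Metric.tendsto_atTop.2 fun δ hδ => ?_⟩
  have h1 := (hε (δ / 2) (by positivity)).lim
  obtain ⟨T₀, hT₀⟩ := Metric.tendsto_atTop.1 h1 (δ / 2) (by positivity)
  refine ⟨max T₀ 1, fun T hT => ?_⟩
  have hT1 : 1 ≤ T := (le_max_right _ _).trans hT
  have hT0 : 0 ≤ T := by linarith
  have h2 := hT₀ T ((le_max_left _ _).trans hT)
  rw [Real.dist_eq, sub_zero] at h2 ⊢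
  have hi := (hε (δ / 2) (by positivity)).essBdd.intervalIntegrable_Ioi le_rfl hT0
  have h3 : |∫ t in (0 : ℝ)..T, a t| ≤ ∫ t in (0 : ℝ)..T, (δ / 2 + ε (δ / 2) t) := by
    refine (intervalIntegral.abs_integral_le_integral_abs hT0).trans ?_
    exact integral_mono_of_ae_pos le_rfl hT0 (ha.abs.intervalIntegrable_Ioi le_rfl hT0)
      (intervalIntegrable_const.add hi) (h _ (by positivity))
  rw [intervalIntegral.integral_add intervalIntegrable_const hi] at h3
  rw [abs_mul, abs_of_pos (by positivity : 0 < T⁻¹)]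
  calc T⁻¹ * |∫ t in (0 : ℝ)..T, a t| ≤ T⁻¹ * (T * (δ / 2) + ∫ t in (0 : ℝ)..T, ε (δ / 2) t) := by
        gcongr; simpa [mul_div_assoc] using h3
    _ = δ / 2 + T⁻¹ * ∫ t in (0 : ℝ)..T, ε (δ / 2) t := by field_simp
    _ < δ := by linarith [(abs_lt.1 h2).2]

/-- An essentially nonnegative function of mean zero is negligible. -/
lemma negligible (ha : MeanZero a) (h0 : ∀ᵐ t, 0 < t → 0 ≤ a t) : Negligible a := by
  refine ⟨ha.essBdd, ha.congr ?_⟩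
  filter_upwards [h0] with t ht h using (abs_of_nonneg (ht h)).symm

end MeanZero

namespace Negligible

variable {a b : ℝ → ℝ}

lemma congr (h : Negligible a) (hab : ∀ᵐ t, 0 < t → a t = b t) : Negligible b := by
  refine ⟨h.essBdd.congr ((ae_restrict_iff' measurableSet_Ioi).2 hab), h.abs.congr ?_⟩
  filter_upwards [hab] with t ht h0
  rw [ht h0]

lemma congr' (h : Negligible a) (hab : ∀ t, 0 ≤ t → a t = b t) : Negligible b :=
  h.congr (Eventually.of_forall fun t ht => hab t ht.le)

lemma of_abs_le (ha : EssBdd (Set.Ioi 0) a) (hb : Negligible b) (C : ℝ)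
    (h : ∀ᵐ t, 0 < t → |a t| ≤ C * |b t|) : Negligible a := by
  refine ⟨ha, MeanZero.of_abs_le ha.abs (ε := fun _ t => C * |b t|) (fun _ _ => hb.abs.const_mul C)
    fun δ hδ => ?_⟩
  filter_upwards [h] with t ht h0
  rw [abs_abs]; linarith [ht h0]

lemma meanZero (ha : Negligible a) : MeanZero a := by
  refine MeanZero.of_abs_le ha.essBdd (ε := fun _ t => |a t|) (fun _ _ => ha.abs) fun δ hδ => ?_
  exact Eventually.of_forall fun t _ => by linarith

lemma mul (ha : Negligible a) (hb : EssBdd (Set.Ioi 0) b) : Negligible (fun t => a t * b t) := by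
  obtain ⟨C, hC⟩ := hb.bdd
  refine of_abs_le (ha.essBdd.mul hb) ha C ?_
  filter_upwards [(ae_restrict_iff' measurableSet_Ioi).1 hC] with t ht h0
  rw [abs_mul, mul_comm]
  exact mul_le_mul_of_nonneg_right (ht h0) (abs_nonneg _)

lemma const_mul (c : ℝ) (ha : Negligible a) : Negligible (fun t => c * a t) :=
  (ha.mul (EssBdd.const c)).congr' fun _ _ => mul_comm _ _

lemma neg (ha : Negligible a) : Negligible (fun t => -a t) := by
  simpa using ha.const_mul (-1)

lemma add (ha : Negligible a) (hb : Negligible b) : Negligible (fun t => a t + b t) := by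
  refine ⟨ha.essBdd.add hb.essBdd, MeanZero.of_abs_le (ha.essBdd.add hb.essBdd).abs
    (ε := fun _ t => |a t| + |b t|) (fun _ _ => ha.abs.add hb.abs) fun δ hδ => ?_⟩
  exact Eventually.of_forall fun t _ => by
    rw [abs_abs]; linarith [abs_add_le (a t) (b t)]

lemma sub (ha : Negligible a) (hb : Negligible b) : Negligible (fun t => a t - b t) := by
  simpa [sub_eq_add_neg] using ha.add hb.neg

lemma sum {ι : Type*} (s : Finset ι) {a : ι → ℝ → ℝ} (h : ∀ i ∈ s, Negligible (a i)) :
    Negligible (fun t => ∑ i ∈ s, a i t) := by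
  classical
  induction s using Finset.induction_on with
  | empty =>
    simp only [Finset.sum_empty]
    exact ⟨EssBdd.const 0, by simpa using EssBdd.const 0, by simp⟩
  | insert i s hi ih =>
    simp only [Finset.sum_insert hi]
    exact (h i (by simp)).add (ih fun j hj => h j (by simp [hj]))

/-- A bounded function is negligible as soon as its square has mean zero. -/
lemma of_sq (ha : EssBdd (Set.Ioi 0) a) (h : MeanZero (fun t => a t ^ 2)) : Negligible a := by
  refine ⟨ha, MeanZero.of_abs_le ha.abs (ε := fun δ t => 1 / (4 * δ) * a t ^ 2)
    (fun _ _ => h.const_mul _) fun δ hδ => Eventually.of_forall fun t _ => ?_⟩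
  rw [abs_abs]
  have h1 : δ + 1 / (4 * δ) * a t ^ 2 - |a t| = (2 * δ - |a t|) ^ 2 / (4 * δ) := by
    field_simp; rw [← sq_abs (a t)]; ring
  have h2 : 0 ≤ (2 * δ - |a t|) ^ 2 / (4 * δ) := by positivity
  linarith

/-- A nonnegative function whose integrals stay bounded is negligible. -/
lemma of_integral_le (ha : EssBdd (Set.Ioi 0) a) (h0 : ∀ᵐ t, 0 < t → 0 ≤ a t) {s C : ℝ}
    (hs : 0 ≤ s) (hC : ∀ T, ∃ t, T ≤ t ∧ ∫ u in s..t, a u ≤ C) : Negligible a := by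
  refine MeanZero.negligible ⟨ha, ?_⟩ h0
  have hnn : ∀ p q, 0 ≤ p → p ≤ q → 0 ≤ ∫ u in p..q, a u := fun p q hp hpq => by
    have := integral_mono_of_ae_pos hp hpq intervalIntegrable_const
      (ha.intervalIntegrable_Ioi hp hpq) h0
    simpa using this
  have hb : ∀ T, 0 ≤ T → ∫ u in (0 : ℝ)..T, a u ≤ C + ∫ u in (0 : ℝ)..s, a u := fun T hT => by
    obtain ⟨t, ht, hle⟩ := hC (max T s)
    have h1 : T ≤ t := (le_max_left _ _).trans ht
    have h2 : s ≤ t := (le_max_right _ _).trans ht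
    have e1 := intervalIntegral.integral_add_adjacent_intervals
      (ha.intervalIntegrable_Ioi le_rfl hT) (ha.intervalIntegrable_Ioi hT h1)
    have e2 := intervalIntegral.integral_add_adjacent_intervals
      (ha.intervalIntegrable_Ioi le_rfl hs) (ha.intervalIntegrable_Ioi hs h2)
    linarith [hnn T t hT h1]
  refine squeeze_zero' (g := fun T => T⁻¹ * (C + ∫ u in (0 : ℝ)..s, a u)) ?_ ?_ ?_
  · filter_upwards [eventually_ge_atTop 0] with T hT
    exact mul_nonneg (inv_nonneg.2 hT) (hnn 0 T le_rfl hT)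
  · filter_upwards [eventually_ge_atTop 0] with T hT
    exact mul_le_mul_of_nonneg_left (hb T hT) (inv_nonneg.2 hT)
  · simpa using tendsto_inv_atTop_zero.mul_const (C + ∫ u in (0 : ℝ)..s, a u)

/-- A negligible function is small at arbitrarily late times outside any null set. -/
lemma exists_small (ha : Negligible a) {p : ℝ → Prop} (hp : ∀ᵐ t, p t) {ε : ℝ} (hε : 0 < ε)
    (T : ℝ) :
    ∃ t, T ≤ t ∧ p t ∧ |a t| < ε := by
  by_contra! hcon
  set s := max T 0 with hs
  have hs0 : 0 ≤ s := le_max_right _ _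
  have h1 : ∀ t, s ≤ t → ε * (t - s) ≤ ∫ u in (0 : ℝ)..t, |a u| := fun t ht => by
    have i1 := ha.abs.essBdd.intervalIntegrable_Ioi le_rfl hs0
    have i2 := ha.abs.essBdd.intervalIntegrable_Ioi hs0 ht
    have e := intervalIntegral.integral_add_adjacent_intervals i1 i2
    have n1 : 0 ≤ ∫ u in (0 : ℝ)..s, |a u| :=
      intervalIntegral.integral_nonneg hs0 fun _ _ => abs_nonneg _
    have n2 : ∫ u in s..t, ε ≤ ∫ u in s..t, |a u| := by
      rw [intervalIntegral.integral_of_le ht, intervalIntegral.integral_of_le ht]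
      refine setIntegral_mono_ae_restrict (by simp) i2.1
        ((ae_restrict_iff' measurableSet_Ioc).2 ?_)
      filter_upwards [hp] with u hu hu2
      exact hcon u ((le_max_left _ _).trans hu2.1.le) hu
    rw [intervalIntegral.integral_const, smul_eq_mul] at n2
    linarith
  have h2 : Tendsto (fun t : ℝ => t⁻¹ * (ε * (t - s))) atTop (𝓝 ε) := by
    have : Tendsto (fun t : ℝ => ε - ε * s * t⁻¹) atTop (𝓝 (ε - ε * s * 0)) :=
      tendsto_const_nhds.sub (tendsto_inv_atTop_zero.const_mul _)
    rw [mul_zero, sub_zero] at this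
    refine this.congr' ?_
    filter_upwards [eventually_gt_atTop 0] with t ht
    field_simp
  have h3 := le_of_tendsto_of_tendsto h2 ha.abs.lim (by
    filter_upwards [eventually_ge_atTop s] with t ht
    exact mul_le_mul_of_nonneg_left (h1 t ht) (inv_nonneg.2 (hs0.trans ht)))
  linarith

end Negligible

/-- A bounded locally Lipschitz function `A` of time with essentially bounded derivative `a`. -/
structure BddDeriv (A a : ℝ → ℝ) : Prop extends LipDeriv A a where
  bdd : ∃ C, ∀ t, 0 ≤ t → |A t| ≤ C
  bdd_deriv : EssBdd (Set.Ioi 0) a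

namespace BddDeriv

variable {A B a b : ℝ → ℝ}

lemma essBdd (h : BddDeriv A a) : EssBdd (Set.Ioi 0) A := by
  obtain ⟨C, hC⟩ := h.bdd
  refine ⟨(h.continuousOn.mono fun t (ht : 0 < t) => ht.le).aestronglyMeasurable measurableSet_Ioi,
    C, ?_⟩
  exact (ae_restrict_iff' measurableSet_Ioi).2 (Eventually.of_forall fun t ht => hC t (le_of_lt ht))

lemma const (c : ℝ) : BddDeriv (fun _ => c) (fun _ => 0) :=
  ⟨LipDeriv.const c, ⟨|c|, fun _ _ => le_rfl⟩, EssBdd.const 0⟩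

lemma add (ha : BddDeriv A a) (hb : BddDeriv B b) :
    BddDeriv (fun t => A t + B t) (fun t => a t + b t) := by
  refine ⟨ha.toLipDeriv.add hb.toLipDeriv, ?_, ha.bdd_deriv.add hb.bdd_deriv⟩
  obtain ⟨C, hC⟩ := ha.bdd
  obtain ⟨D, hD⟩ := hb.bdd
  exact ⟨C + D, fun t ht => (abs_add_le _ _).trans (add_le_add (hC t ht) (hD t ht))⟩

lemma mul (ha : BddDeriv A a) (hb : BddDeriv B b) :
    BddDeriv (fun t => A t * B t) (fun t => a t * B t + A t * b t) := by
  refine ⟨ha.toLipDeriv.mul hb.toLipDeriv, ?_,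
    (ha.bdd_deriv.mul hb.essBdd).add (ha.essBdd.mul hb.bdd_deriv)⟩
  obtain ⟨C, hC⟩ := ha.bdd
  obtain ⟨D, hD⟩ := hb.bdd
  refine ⟨C * D, fun t ht => ?_⟩
  rw [abs_mul]
  exact mul_le_mul (hC t ht) (hD t ht) (abs_nonneg _) ((abs_nonneg _).trans (hC t ht))

lemma const_mul (c : ℝ) (ha : BddDeriv A a) : BddDeriv (fun t => c * A t) (fun t => c * a t) := by
  simpa using (const c).mul ha

lemma neg (ha : BddDeriv A a) : BddDeriv (fun t => -A t) (fun t => -a t) := by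
  simpa using ha.const_mul (-1)

lemma sub (ha : BddDeriv A a) (hb : BddDeriv B b) :
    BddDeriv (fun t => A t - B t) (fun t => a t - b t) := by
  simpa [sub_eq_add_neg] using ha.add hb.neg

lemma inv (ha : BddDeriv A a) {c : ℝ} (hc : 0 < c) (hA : ∀ t, 0 ≤ t → c ≤ A t) :
    BddDeriv (fun t => (A t)⁻¹) (fun t => -((A t)⁻¹ ^ 2) * a t) := by
  have hb : ∀ t, 0 ≤ t → |(A t)⁻¹| ≤ c⁻¹ := fun t ht => by
    rw [abs_inv, abs_of_pos (hc.trans_le (hA t ht))]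
    exact inv_anti₀ hc (hA t ht)
  have hl := ha.toLipDeriv.inv hc hA
  refine ⟨hl, ⟨c⁻¹, hb⟩, EssBdd.mul ?_ ha.bdd_deriv⟩
  refine EssBdd.neg (EssBdd.sq ⟨?_, c⁻¹, ?_⟩)
  · exact (hl.continuousOn.mono fun t (ht : 0 < t) => ht.le).aestronglyMeasurable measurableSet_Ioi
  · exact (ae_restrict_iff' measurableSet_Ioi).2 (Eventually.of_forall fun t ht => hb t
        (le_of_lt ht))

lemma meanZero_deriv (ha : BddDeriv A a) : MeanZero a := by
  refine ⟨ha.bdd_deriv, ?_⟩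
  obtain ⟨C, hC⟩ := ha.bdd
  have h1 : Tendsto (fun T : ℝ => T⁻¹ * (2 * C)) atTop (𝓝 0) := by
    simpa using tendsto_inv_atTop_zero.mul_const (2 * C)
  refine squeeze_zero_norm' ?_ h1
  filter_upwards [eventually_ge_atTop 0] with T hT
  rw [ha.integral_eq le_rfl hT, norm_mul, Real.norm_eq_abs, abs_of_nonneg (inv_nonneg.2 hT)]
  gcongr
  rw [Real.norm_eq_abs]
  have := abs_sub (A T) (A 0)
  linarith [hC T hT, hC 0 le_rfl]

/-- Averaging an exact derivative against a slowly varying weight gives zero. -/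
lemma meanZero_slow_mul (ha : BddDeriv A a) (hb : BddDeriv B b) (hs : Negligible b) :
    MeanZero (fun t => B t * a t) :=
  ((ha.mul hb).meanZero_deriv.sub (hs.mul ha.essBdd).meanZero).congr' fun t _ => by ring

/-- Averaging the derivative of a negligible function against a Lipschitz weight gives zero. -/
lemma meanZero_deriv_mul (ha : BddDeriv A a) (hs : Negligible A) (hb : BddDeriv B b) :
    MeanZero (fun t => a t * B t) :=
  ((ha.mul hb).meanZero_deriv.sub (hs.mul hb.bdd_deriv).meanZero).congr' fun t _ => by ring

/-- If the derivative `a` of a negligible function splits into a Lipschitz part `c` and a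
negligible part, then `c` is negligible: average `a * c`. Without such a splitting the derivative
of a negligible function need not be negligible. -/
lemma negligible_deriv {c c' d : ℝ → ℝ} (ha : BddDeriv A a) (hs : Negligible A) (hc : BddDeriv c c')
    (hd : Negligible d) (h : ∀ᵐ t, 0 < t → a t = c t + d t) : Negligible c := by
  refine Negligible.of_sq hc.essBdd ?_
  refine ((ha.meanZero_deriv_mul hs hc).sub (hd.mul hc.essBdd).meanZero).congr ?_
  filter_upwards [h] with t ht h0
  rw [ht h0]; ring

end BddDeriv

/-! ### Averaging along a node and along a line -/

/-- Averages at a node. If the droop residual `y` is negligible, then so are its multiplier `ε` and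
the velocity of the reference `h`, because `ε' = y` while `h' = k (ε + y)`: average `(ε h)'`. -/
lemma droop_negligible {k : ℝ} (hk : 0 < k) {y ε ε' h h' : ℝ → ℝ} (hε : BddDeriv ε ε')
    (hh : BddDeriv h h') (hyn : Negligible y)
    (dε : ∀ᵐ t, 0 < t → ε' t = y t) (dh : ∀ᵐ t, 0 < t → h' t = k * ε t + k * y t) :
    Negligible ε ∧ Negligible h' := by
  have h1 : Negligible ε := by
    refine Negligible.of_sq hε.essBdd ?_
    refine ((((hε.mul hh).meanZero_deriv.sub (hyn.mul hh.essBdd).meanZero).sub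
      ((hyn.mul hε.essBdd).const_mul k).meanZero).const_mul k⁻¹).congr ?_
    filter_upwards [dε, dh] with t e1 e2 h0
    rw [e1 h0, e2 h0]; field_simp; ring
  refine ⟨h1, ((h1.const_mul k).add (hyn.const_mul k)).congr ?_⟩
  filter_upwards [dh] with t e h0 using (e h0).symm

/-- Averages along a line. The functions `P`, `Q` are the flows leaving the two ends, with squared
voltages `v`, `w`; `l` is the squared current, `lam`, `γ`, `ρ`, `σ` are the multipliers of the
line. If `P` is proportional to `v` up to a negligible error and the nodal quantities vary slowly
(have negligible derivatives), then all quantities of the line vary slowly.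

The multiplier equations, averaged against slowly varying weights, show that in the mean `Q` agrees
with the value `q` prescribed by the voltage drop, and `l` with `P² / v`; since `σ' ≥ Q² / w - l`,
this forces `Q - q` to be negligible. Differentiating the force equations of `P` and `Q` then
yields two damping equations for `l - P² / v`, with damping factors whose weighted sum is positive.
-/
lemma line_negligible {r c κ : ℝ} (hr : 0 < r) (hc : 0 < c)
    {v v' w w' P P' Q Q' l l' lam lam' γ γ' ρ ρ' σ σ' m m' n n' η θ : ℝ → ℝ}
    (hv : BddDeriv v v') (hw : BddDeriv w w') (hP : BddDeriv P P') (hQ : BddDeriv Q Q')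
    (hl : BddDeriv l l') (hlam : BddDeriv lam lam') (hγ : BddDeriv γ γ') (hρ : BddDeriv ρ ρ')
    (hσ : BddDeriv σ σ') (hm : BddDeriv m m') (hn : BddDeriv n n')
    (hvc : ∀ t, 0 ≤ t → c ≤ v t) (hwc : ∀ t, 0 ≤ t → c ≤ w t)
    (nv : Negligible v') (nw : Negligible w') (nm : Negligible m') (nn : Negligible n')
    (nP : Negligible fun t => P t - κ * v t)
    (dP : ∀ᵐ t, 0 < t → P' t = -(m t + lam t - γ t * r + 2 * ρ t * (P t * (v t)⁻¹)))
    (dQ : ∀ᵐ t, 0 < t → Q' t = -(n t + lam t + γ t * r + 2 * σ t * (Q t * (w t)⁻¹)))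
    (dl : ∀ᵐ t, 0 < t → l' t = lam t * r + ρ t + σ t)
    (dlam : ∀ᵐ t, 0 < t → lam' t = P t + Q t - r * l t)
    (dγ : ∀ᵐ t, 0 < t → γ' t = v t - w t - r * (P t - Q t))
    (dρ : ∀ᵐ t, 0 < t → ρ' t = P t ^ 2 * (v t)⁻¹ - l t + η t) (nη : Negligible η)
    (dσ : ∀ᵐ t, 0 < t → σ' t = Q t ^ 2 * (w t)⁻¹ - l t + θ t)
    (hθ0 : ∀ᵐ t, 0 < t → 0 ≤ θ t) :
    Negligible P' ∧ Negligible Q' ∧ Negligible l' ∧ Negligible lam' ∧ Negligible γ' ∧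
      Negligible ρ' ∧ Negligible σ' := by
  have hr0 := hr.ne'
  have v0 : ∀ t, 0 ≤ t → v t ≠ 0 := fun t ht => (hc.trans_le (hvc t ht)).ne'
  have w0 : ∀ t, 0 ≤ t → w t ≠ 0 := fun t ht => (hc.trans_le (hwc t ht)).ne'
  have hvi := hv.inv hc hvc
  have hwi := hw.inv hc hwc
  have hPv := hP.mul hvi
  have hQw := hQ.mul hwi
  -- the force on `P` is negligible, hence `P` varies slowly
  have hFP := ((hm.add hlam).sub (hγ.const_mul r)).add ((hρ.mul hPv).const_mul 2)
  have nFP : Negligible _ := (hP.sub (hv.const_mul κ)).neg.negligible_deriv nP.neg hFP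
    (nv.const_mul κ) (by
      filter_upwards [dP] with t e h0
      rw [e h0]; ring)
  have nP' : Negligible P' := nFP.neg.congr (by
    filter_upwards [dP] with t e h0
    rw [e h0]; ring)
  -- the value `q` of `Q` prescribed by the voltage drop
  set q : ℝ → ℝ := fun t => P t - r⁻¹ * (v t - w t) with hq
  set q' : ℝ → ℝ := fun t => P' t - r⁻¹ * (v' t - w' t) with hq'
  have bq : BddDeriv q q' := hP.sub ((hv.sub hw).const_mul r⁻¹)
  have nq' : Negligible q' := nP'.sub ((nv.sub nw).const_mul r⁻¹)
  have aQ : ∀ {B b : ℝ → ℝ}, BddDeriv B b → Negligible b → MeanZero fun t => B t * (Q t - q t) := by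
    intro B b hB nb
    refine ((hγ.meanZero_slow_mul hB nb).const_mul r⁻¹).congr ?_
    filter_upwards [dγ] with t e h0
    rw [e h0]; simp only [hq]; field_simp; ring
  have al : ∀ {B b : ℝ → ℝ}, BddDeriv B b → Negligible b →
      MeanZero fun t => B t * (l t - P t ^ 2 * (v t)⁻¹) := by
    intro B b hB nb
    refine ((nη.mul hB.essBdd).meanZero.sub (hρ.meanZero_slow_mul hB nb)).congr ?_
    filter_upwards [dρ] with t e h0
    rw [e h0]; ring
  have alam : ∀ {B b : ℝ → ℝ}, BddDeriv B b → Negligible b →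
      MeanZero fun t => B t * (P t + Q t - r * l t) := by
    intro B b hB nb
    refine (hlam.meanZero_slow_mul hB nb).congr ?_
    filter_upwards [dlam] with t e h0
    rw [e h0]
  -- the averages satisfy the loss equation and the cone constraint with equality
  have slow_Pv : Negligible fun t => P' t * (v t)⁻¹ + P t * (-((v t)⁻¹ ^ 2) * v' t) :=
    (nP'.mul hvi.essBdd).add (((nv.mul hvi.essBdd.sq).mul hP.essBdd).neg.congr' fun t _ => by ring)
  have hPPv := hP.mul hPv
  have slow_PPv : Negligible _ := (nP'.mul hPv.essBdd).add ((slow_Pv.mul hP.essBdd).congr'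
    (b := fun t => P t * (P' t * (v t)⁻¹ + P t * (-((v t)⁻¹ ^ 2) * v' t))) fun t _ => by ring)
  have bδ := (hP.add bq).sub (hPPv.const_mul r)
  have slow_δ := (nP'.add nq').sub (slow_PPv.const_mul r)
  have nδ : Negligible fun t => P t + q t - r * (P t * (P t * (v t)⁻¹)) := by
    refine Negligible.of_sq bδ.essBdd ?_
    refine (((alam bδ slow_δ).sub (aQ bδ slow_δ)).add ((al bδ slow_δ).const_mul r)).congr' ?_
    intro t _; ring
  -- times `v - w`: in the mean, `(P, q)` satisfies the conic equation of the other end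
  have nwP : Negligible fun t => w t * (P t * (P t * (v t)⁻¹)) - q t ^ 2 := by
    refine ((nδ.mul (hv.sub hw).essBdd).const_mul r⁻¹).congr' fun t ht => ?_
    have := v0 t ht
    simp only [hq]; field_simp; ring
  -- weigh the equation for `σ'` with `w`
  have key : MeanZero fun t => (Q t - q t) ^ 2 + w t * θ t := by
    refine ((((hσ.meanZero_slow_mul hw nw).add (al hw nw)).add nwP.meanZero).sub
      ((aQ bq nq').const_mul 2)).congr ?_
    filter_upwards [dσ] with t e h0
    have := w0 t h0.le
    rw [e h0]; field_simp; ring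
  have key0 : ∀ᵐ t, 0 < t → 0 ≤ (Q t - q t) ^ 2 + w t * θ t := by
    filter_upwards [hθ0] with t h h0
    have := hc.trans_le (hwc t h0.le)
    have := h h0
    positivity
  have nkey := key.negligible key0
  have hθe : EssBdd (Set.Ioi 0) θ := by
    refine (hσ.bdd_deriv.sub ((hQ.mul hQw).essBdd.sub hl.essBdd)).congr
      ((ae_restrict_iff' measurableSet_Ioi).2 ?_)
    filter_upwards [dσ] with t e h0
    rw [e h0]; ring
  have nθ : Negligible θ := by
    refine Negligible.of_abs_le hθe nkey c⁻¹ ?_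
    filter_upwards [hθ0, key0] with t h hk h0
    rw [abs_of_nonneg (hk h0), abs_of_nonneg (h h0), le_inv_mul_iff₀ hc]
    nlinarith [sq_nonneg (Q t - q t), mul_le_mul_of_nonneg_right (hwc t h0.le) (h h0)]
  have nQ : Negligible fun t => Q t - q t := by
    refine Negligible.of_sq (hQ.sub bq).essBdd
      (Negligible.of_abs_le (hQ.sub bq).essBdd.sq nkey 1 ?_).meanZero
    filter_upwards [hθ0, key0] with t h hk h0
    rw [abs_of_nonneg (hk h0), abs_of_nonneg (sq_nonneg _)]
    nlinarith [mul_nonneg (hc.le.trans (hwc t h0.le)) (h h0)]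
  have hFQ := ((hn.add hlam).add (hγ.const_mul r)).add ((hσ.mul hQw).const_mul 2)
  have nFQ : Negligible _ := (hQ.sub bq).neg.negligible_deriv nQ.neg hFQ nq' (by
      filter_upwards [dQ] with t e h0
      rw [e h0]; ring)
  have nQ' : Negligible Q' := nFQ.neg.congr (by
    filter_upwards [dQ] with t e h0
    rw [e h0]; ring)
  have nγ' : Negligible γ' := (nQ.const_mul r).congr (by
    filter_upwards [dγ] with t e h0
    rw [e h0]; simp only [hq]; field_simp; ring)
  -- the defect `d` of the cone constraint; both force equations damp it
  set d : ℝ → ℝ := fun t => l t - P t * (P t * (v t)⁻¹) with hd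
  have bd : BddDeriv d _ := hl.sub hPPv
  have nQd : Negligible fun t => Q t * (Q t * (w t)⁻¹) - P t * (P t * (v t)⁻¹) := by
    refine (((nQ.mul (hQ.add bq).essBdd).sub nwP).mul hwi.essBdd).congr' fun t ht => ?_
    have := w0 t ht
    field_simp; ring
  have slow_Qw : Negligible fun t => Q' t * (w t)⁻¹ + Q t * (-((w t)⁻¹ ^ 2) * w' t) :=
    (nQ'.mul hwi.essBdd).add (((nw.mul hwi.essBdd.sq).mul hQ.essBdd).neg.congr' fun t _ => by ring)
  have nlam0 : Negligible fun t => (Q t - q t) + (P t + q t - r * (P t * (P t * (v t)⁻¹))) :=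
    nQ.add nδ
  have damp : ∀ {A a : ℝ → ℝ} {B b e : ℝ → ℝ}, BddDeriv A a → Negligible A → BddDeriv B b →
      Negligible e → (∀ᵐ t, 0 < t → a t = -B t + e t) → Negligible B := by
    intro A a B b e hA nA hB ne h
    refine hA.neg.negligible_deriv nA.neg hB ne.neg ?_
    filter_upwards [h] with t ht h0
    rw [ht h0]; ring
  have nd1 := damp hFP nFP (bd.mul (((BddDeriv.const r).add (hPv.const_mul 2))))
    (e := fun t => m' t + ((Q t - q t) + (P t + q t - r * (P t * (P t * (v t)⁻¹)))) - r * γ' t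
      + 2 * (η t * (P t * (v t)⁻¹))
      + 2 * ((P' t * (v t)⁻¹ + P t * (-((v t)⁻¹ ^ 2) * v' t)) * ρ t))
    ((((nm.add nlam0).sub (nγ'.const_mul r)).add ((nη.mul hPv.essBdd).const_mul 2)).add
      ((slow_Pv.mul hρ.essBdd).const_mul 2)) (by
      filter_upwards [dlam, dρ] with t e1 e2 h0
      rw [e1 h0, e2 h0]; simp only [hd]; ring)
  have nd2 := damp hFQ nFQ (bd.mul (((BddDeriv.const r).add (hQw.const_mul 2))))
    (e := fun t => n' t + ((Q t - q t) + (P t + q t - r * (P t * (P t * (v t)⁻¹)))) + r * γ' t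
      + 2 * (θ t * (Q t * (w t)⁻¹))
      + 2 * ((Q' t * (w t)⁻¹ + Q t * (-((w t)⁻¹ ^ 2) * w' t)) * σ t)
      + 2 * ((Q t * (Q t * (w t)⁻¹) - P t * (P t * (v t)⁻¹)) * (Q t * (w t)⁻¹)))
    (((((nn.add nlam0).add (nγ'.const_mul r)).add ((nθ.mul hQw.essBdd).const_mul 2)).add
      ((slow_Qw.mul hσ.essBdd).const_mul 2)).add ((nQd.mul hQw.essBdd).const_mul 2)) (by
      filter_upwards [dlam, dσ] with t e1 e2 h0
      rw [e1 h0, e2 h0]; simp only [hd]; ring)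
  -- in the sum of the two damping factors the flows add up to the losses, which are nonnegative
  have nd : Negligible d := by
    have h1 := ((nd1.mul hv.essBdd).add (nd2.mul hw.essBdd)).sub
      ((nlam0.mul bd.essBdd).const_mul 2)
    refine Negligible.of_abs_le bd.essBdd h1 (r * c)⁻¹ (Eventually.of_forall fun t h0 => ?_)
    have hv0 := v0 t h0.le
    have hw0 := w0 t h0.le
    have e : d t * (r + 2 * (P t * (v t)⁻¹)) * v t + d t * (r + 2 * (Q t * (w t)⁻¹)) * w t
        - 2 * ((Q t - q t + (P t + q t - r * (P t * (P t * (v t)⁻¹)))) * d t)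
        = (r * (v t + w t) + 2 * r * (P t * (P t * (v t)⁻¹))) * d t := by
      field_simp; ring
    rw [e, abs_mul, le_inv_mul_iff₀ (mul_pos hr hc)]
    refine mul_le_mul_of_nonneg_right ?_ (abs_nonneg _)
    have h3 : 0 ≤ P t * (P t * (v t)⁻¹) := by
      rw [← mul_assoc]
      exact mul_nonneg (mul_self_nonneg _) (inv_nonneg.2 (hc.le.trans (hvc t h0.le)))
    refine le_trans ?_ (le_abs_self _)
    nlinarith [hvc t h0.le, hwc t h0.le, mul_nonneg hr.le h3]
  have nl' : Negligible l' := by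
    have := bd.negligible_deriv nd (((hlam.const_mul r).add hρ).add hσ) slow_PPv.neg (by
      filter_upwards [dl] with t e h0
      rw [e h0]; ring)
    refine this.congr ?_
    filter_upwards [dl] with t e h0
    rw [e h0]; ring
  refine ⟨nP', nQ', nl', (nlam0.sub (nd.const_mul r)).congr ?_, nγ', (nη.sub nd).congr ?_,
    ((nQd.sub nd).add nθ).congr ?_⟩
  · filter_upwards [dlam] with t e h0
    rw [e h0]; simp only [hd]; ring
  · filter_upwards [dρ] with t e h0
    rw [e h0]; simp only [hd]; ring
  · filter_upwards [dσ] with t e h0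
    rw [e h0]; simp only [hd]; ring

/-! ### Sums over the network and the pairing identity -/

namespace DCNetwork

variable {n : ℕ} {N : DCNetwork n}

@[simp] lemma lineOf_line (e : N.Line) : lineOf e.1 = e := by
  simp [lineOf, e.2]

@[simp] lemma lineOf_line_symm (e : N.Line) : lineOf e.1.symm = e := by
  have : ¬ e.1.symm.fst < e.1.symm.snd := not_lt.2 e.2.le
  rw [lineOf, dif_neg this]
  exact Subtype.ext e.1.symm_symm

@[simp] lemma sgn_line (e : N.Line) : sgn e.1 = 1 := by simp [sgn, e.2]

@[simp] lemma sgn_line_symm (e : N.Line) : sgn e.1.symm = -1 := by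
  have : ¬ e.1.symm.fst < e.1.symm.snd := not_lt.2 e.2.le
  simp only [sgn, if_neg this]

@[simp] lemma res_symm (a : N.Arc) : N.res a.symm = N.res a := by
  simp [res]

lemma res_pos (a : N.Arc) : 0 < N.res a := N.r_pos _ a.edge_mem

lemma arc_eq (a : N.Arc) : a = (lineOf a).1 ∨ a = (lineOf a).1.symm := by
  unfold lineOf
  split_ifs with h
  · exact Or.inl rfl
  · exact Or.inr (a.symm_symm).symm

lemma arc_cases {p : N.Arc → Prop} (h : ∀ e : N.Line, p e.1 ∧ p e.1.symm) (a : N.Arc) : p a := by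
  rcases arc_eq a with h' | h' <;> rw [h']
  exacts [(h _).1, (h _).2]

@[simp] lemma lineOf_symm (a : N.Arc) : lineOf a.symm = lineOf a := by
  revert a; refine arc_cases fun e => ⟨by simp, by simp⟩

@[simp] lemma sgn_symm (a : N.Arc) : sgn a.symm = -sgn a := by
  revert a; refine arc_cases fun e => ⟨by simp, by simp⟩

lemma sum_arc (h : N.Arc → ℝ) : ∑ a, h a = ∑ e : N.Line, (h e.1 + h e.1.symm) := by
  rw [Finset.sum_add_distrib, ← Finset.sum_filter_add_sum_filter_not Finset.univ
    (fun a : N.Arc => a.fst < a.snd)]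
  congr 1
  · exact (Finset.sum_subtype _ (by simp) _)
  · symm
    refine Finset.sum_bij' (fun e _ => e.1.symm) (fun a _ => lineOf a) ?_ ?_ ?_ ?_ ?_
    · intro e _; simp [e.2.le]
    · intro a _; simp
    · intro e _; simp
    · intro a ha
      have : ¬ a.fst < a.snd := by simpa using ha
      simp [lineOf, this]
    · intro e _; rfl

lemma sum_node_arc (h : N.Arc → ℝ) (d : Fin n → ℝ) :
    ∑ i, (∑ a : N.Arc with a.fst = i, h a) * d i = ∑ a, h a * d a.fst := by
  rw [← Finset.sum_fiberwise Finset.univ (fun a : N.Arc => a.fst) (fun a => h a * d a.fst)]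
  refine Finset.sum_congr rfl fun i _ => ?_
  rw [Finset.sum_mul]
  refine Finset.sum_congr rfl fun a ha => ?_
  rw [(Finset.mem_filter.1 ha).2]

lemma sum_node_arc' (h : N.Arc → ℝ) : ∑ i, ∑ a : N.Arc with a.fst = i, h a = ∑ a, h a :=
  Finset.sum_fiberwise Finset.univ (fun a : N.Arc => a.fst) h

lemma sum_idx (h : N.Idx → ℝ) : ∑ j, h j
    = ∑ i, h (.pg i) + ∑ i, h (.v i) + ∑ i, h (.phat i) + ∑ i, h (.mu i) + ∑ i, h (.eps i)
      + (∑ e, h (.l e) + ∑ e, h (.lam e) + ∑ e, h (.gam e)) +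
      (∑ a, h (.P a) + ∑ a, h (.rho a)) := by
  rw [Fintype.sum_equiv (Idx.equiv N) h (fun c => h ((Idx.equiv N).symm c)) (by simp)]
  simp only [Fintype.sum_sum_type, Fintype.sum_prod_type, Fin.sum_univ_succ, Fin.sum_univ_zero]
  simp only [Idx.equiv, Equiv.coe_fn_symm_mk]
  simp only [Fin.isValue, Fin.succ_zero_eq_one, add_zero]
  simp only [add_assoc]
  rfl

variable (N)

/-- The linear part of the droop residual `y`. -/
def yLin (d : N.Idx → ℝ) (i : Fin n) : ℝ := d (.v i) + N.k i * d (.pg i) - N.k i * d (.phat i)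

/-- The linear part of the balance residual `z`. -/
noncomputable def zLin (d : N.Idx → ℝ) (i : Fin n) : ℝ :=
  d (.pg i) - ∑ a : N.Arc with a.fst = i, d (.P a)

/-- The residual of the loss equation of a line. -/
def lossLin (d : N.Idx → ℝ) (e : N.Line) : ℝ :=
  d (.P e.1) + d (.P e.1.symm) - N.res e.1 * d (.l e)

/-- The residual of the voltage drop equation of a line. -/
def dropLin (d : N.Idx → ℝ) (e : N.Line) : ℝ :=
  d (.v e.1.fst) - d (.v e.1.snd) - N.res e.1 * (d (.P e.1) - d (.P e.1.symm))

/-- The common shape of the vector field `F` (with the derivative `-g` of the Lagrangian in place of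
the projected `ρ`-component), of its derivative along a trajectory, and of the differences of its
values: `s`, `m` stand for `y + ε`, `z - μ`, and `c`, `e`, `g` for the nonlinear terms `ρ P² / v²`,
`2 ρ P / v`, `P² / v - l`. -/
noncomputable def field (G s m z y : Fin n → ℝ) (lam gam loss drop : N.Line → ℝ)
    (rho c e g : N.Arc → ℝ) : N.Idx → ℝ
  | .pg i => G i + N.k i * s i + m i
  | .v i => s i + (∑ a : N.Arc with a.fst = i, sgn a * gam (lineOf a))
      - ∑ a : N.Arc with a.fst = i, c a
  | .P a => lam (lineOf a) - sgn a * gam (lineOf a) * N.res a + e a - m a.fst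
  | .l e => -lam e * N.res e.1 - rho e.1 - rho e.1.symm
  | .phat i => -N.k i * s i
  | .mu i => z i
  | .eps i => -y i
  | .lam e => -loss e
  | .gam e => -drop e
  | .rho a => -g a

/-- The pairing of `field` with a direction `d`. Apart from the conic constraints, the primal
components of `d` enter only through the linear parts of the residuals: the field is the gradient of
the Lagrangian in the primal variables. -/
lemma sum_field_mul (G s m z y : Fin n → ℝ) (lam gam loss drop : N.Line → ℝ)
    (rho c e g : N.Arc → ℝ) (d : N.Idx → ℝ) :
    ∑ j, N.field G s m z y lam gam loss drop rho c e g j * d j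
      = ∑ i, G i * d (.pg i) + ∑ i, s i * N.yLin d i + ∑ i, m i * N.zLin d i
        + ∑ e, lam e * N.lossLin d e + ∑ e, gam e * N.dropLin d e
        + ∑ a : N.Arc, (-(c a * d (.v a.fst)) + e a * d (.P a) - rho a * d (.l (lineOf a)))
        + ∑ i, z i * d (.mu i) - ∑ i, y i * d (.eps i) - ∑ e, loss e * d (.lam e)
        - ∑ e, drop e * d (.gam e) - ∑ a, g a * d (.rho a) := by
  have hv : ∑ i, N.field G s m z y lam gam loss drop rho c e g (.v i) * d (.v i)
      = ∑ i, s i * d (.v i) + ∑ e : N.Line, gam e * (d (.v e.1.fst) - d (.v e.1.snd))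
        - ∑ a : N.Arc, c a * d (.v a.fst) := by
    have h1 := sum_node_arc (fun a : N.Arc => sgn a * gam (lineOf a)) (fun i => d (.v i))
    have h2 := sum_node_arc c (fun i => d (.v i))
    rw [sum_arc] at h1
    simp only [field, sub_mul, add_mul, Finset.sum_sub_distrib, Finset.sum_add_distrib]
    rw [h1, h2]
    congr 2
    refine Finset.sum_congr rfl fun e _ => ?_
    simp only [sgn_line, sgn_line_symm, lineOf_line, lineOf_line_symm]
    simp only [SimpleGraph.Dart.symm_toProd, Prod.fst_swap]
    ring
  have hP : ∑ a, N.field G s m z y lam gam loss drop rho c e g (.P a) * d (.P a)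
      = ∑ e : N.Line, lam e * (d (.P e.1) + d (.P e.1.symm))
        - ∑ e : N.Line, gam e * (N.res e.1 * (d (.P e.1) - d (.P e.1.symm)))
        + ∑ a : N.Arc, e a * d (.P a) - ∑ i, m i * ∑ a : N.Arc with a.fst = i, d (.P a) := by
    have h1 := sum_node_arc (fun a : N.Arc => d (.P a)) m
    have h2 : ∑ i, m i * ∑ a : N.Arc with a.fst = i, d (.P a)
        = ∑ a : N.Arc, m a.fst * d (.P a) := by
      simp only [mul_comm (m _)]; exact h1
    rw [h2, ← Finset.sum_sub_distrib]
    have h3 : ∑ e : N.Line, (lam e * (d (.P e.1) + d (.P e.1.symm))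
        - gam e * (N.res e.1 * (d (.P e.1) - d (.P e.1.symm))))
        = ∑ a : N.Arc, (lam (lineOf a) - sgn a * gam (lineOf a) * N.res a) * d (.P a) := by
      rw [sum_arc]
      refine Finset.sum_congr rfl fun e _ => ?_
      simp only [sgn_line, sgn_line_symm, lineOf_line, lineOf_line_symm, res_symm]
      ring
    rw [h3, ← Finset.sum_add_distrib, ← Finset.sum_sub_distrib]
    refine Finset.sum_congr rfl fun a _ => ?_
    simp only [field]; ring
  have hl : ∑ e', N.field G s m z y lam gam loss drop rho c e g (.l e') * d (.l e')
      = -∑ e : N.Line, lam e * (N.res e.1 * d (.l e)) - ∑ a : N.Arc, rho a * d (.l (lineOf a)) := by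
    rw [sum_arc, ← Finset.sum_neg_distrib, ← Finset.sum_sub_distrib]
    refine Finset.sum_congr rfl fun e _ => ?_
    simp only [field, lineOf_line, lineOf_line_symm]; ring
  rw [sum_idx, hv, hP, hl]
  simp only [field, yLin, zLin, lossLin, dropLin, mul_add, mul_sub, add_mul,
    Finset.sum_add_distrib, Finset.sum_sub_distrib, Finset.sum_neg_distrib, neg_mul, mul_assoc,
    mul_left_comm (N.k _)]
  ring

end DCNetwork

/-! ### Farkas' lemma and a theorem of the alternative -/

/-- **Farkas' lemma**: a linear form that is nonnegative on a polyhedral cone is a nonnegative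
combination of the linear forms that define the cone. The induction follows Bartl. -/
theorem farkas_fin {V : Type*} [AddCommGroup V] [Module ℝ V] (m : ℕ) :
    ∀ (a : Fin m → V →ₗ[ℝ] ℝ) (ℓ : V →ₗ[ℝ] ℝ), (∀ x, (∀ j, 0 ≤ a j x) → 0 ≤ ℓ x) →
      ∃ c : Fin m → ℝ, (∀ j, 0 ≤ c j) ∧ ∀ x, ℓ x = ∑ j, c j * a j x := by
  induction m with
  | zero =>
    intro a ℓ h
    refine ⟨fun _ => 0, fun _ => le_rfl, fun x => ?_⟩
    have h1 := h x (fun j => j.elim0)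
    have h2 := h (-x) (fun j => j.elim0)
    rw [map_neg] at h2
    simp; linarith
  | succ m ih =>
    intro a ℓ h
    by_cases h0 : ∀ x, (∀ j : Fin m, 0 ≤ a j.succ x) → 0 ≤ ℓ x
    · obtain ⟨c, hc, hx⟩ := ih (fun j => a j.succ) ℓ h0
      refine ⟨Fin.cons 0 c, fun j => ?_, fun x => ?_⟩
      · refine Fin.cases ?_ (fun j => ?_) j <;> simp [hc]
      · simp [Fin.sum_univ_succ, hx x]
    · push Not at h0
      obtain ⟨x₀, hx₀, hl⟩ := h0
      have ha : a 0 x₀ < 0 := by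
        by_contra hcon
        push Not at hcon
        exact absurd (h x₀ fun j => Fin.cases hcon hx₀ j) (not_le.2 hl)
      set t : ℝ := -(a 0 x₀)⁻¹ with ht
      have ht0 : 0 < t := by rw [ht, neg_pos]; exact inv_lt_zero.2 ha
      have hta : t * a 0 x₀ = -1 := by rw [ht, neg_mul, inv_mul_cancel₀ ha.ne]
      let T : V →ₗ[ℝ] V := LinearMap.id + (a 0).smulRight (t • x₀)
      have hT : ∀ x, T x = x + a 0 x • t • x₀ := fun x => rfl
      have hT0 : ∀ x, a 0 (T x) = 0 := fun x => by
        rw [hT]; simp only [map_add, map_smul, smul_eq_mul]; linear_combination (a 0 x) * hta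
      obtain ⟨c, hc, hx⟩ := ih (fun j => a j.succ ∘ₗ T) (ℓ ∘ₗ T) fun x hxj =>
        h (T x) fun j => Fin.cases (hT0 x).ge hxj j
      refine ⟨Fin.cons (t * (∑ j, c j * a j.succ x₀ - ℓ x₀)) c, fun j => ?_, fun x => ?_⟩
      · refine Fin.cases ?_ (fun j => by simpa using hc j) j
        simp only [Fin.cons_zero]
        have : 0 ≤ ∑ j, c j * a j.succ x₀ := Finset.sum_nonneg fun j _ => mul_nonneg (hc j) (hx₀ j)
        exact mul_nonneg ht0.le (by linarith)
      · have := hx x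
        simp only [LinearMap.comp_apply, hT, map_add, map_smul, smul_eq_mul, mul_add,
          Finset.sum_add_distrib] at this
        rw [Fin.sum_univ_succ]
        simp only [Fin.cons_zero, Fin.cons_succ]
        have e : ∑ j, c j * (a 0 x * (t * a j.succ x₀)) = a 0 x * t * ∑ j, c j * a j.succ x₀ := by
          rw [Finset.mul_sum]; exact Finset.sum_congr rfl fun j _ => by ring
        rw [e] at this
        linear_combination this

/-- Farkas' lemma for a polyhedral cone given by inequalities and equations. -/
theorem farkas {V ι κ : Type*} [AddCommGroup V] [Module ℝ V] [Fintype ι] [Fintype κ]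
    (a : ι → V →ₗ[ℝ] ℝ) (b : κ → V →ₗ[ℝ] ℝ) (ℓ : V →ₗ[ℝ] ℝ)
    (h : ∀ x, (∀ j, 0 ≤ a j x) → (∀ j, b j x = 0) → 0 ≤ ℓ x) :
    ∃ (c : ι → ℝ) (d : κ → ℝ), (∀ j, 0 ≤ c j) ∧
      ∀ x, ℓ x = ∑ j, c j * a j x + ∑ j, d j * b j x := by
  classical
  let f : ι ⊕ (κ ⊕ κ) → V →ₗ[ℝ] ℝ := Sum.elim a (Sum.elim b fun j => -b j)
  let E := Fintype.equivFin (ι ⊕ (κ ⊕ κ))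
  obtain ⟨c, hc, hx⟩ := farkas_fin _ (fun j => f (E.symm j)) ℓ fun x hxj => by
    have h' : ∀ j, 0 ≤ f j x := fun j => by simpa using hxj (E j)
    exact h x (fun j => h' (.inl j)) fun j =>
      le_antisymm (by simpa [f] using h' (.inr (.inr j))) (h' (.inr (.inl j)))
  refine ⟨fun j => c (E (.inl j)), fun j => c (E (.inr (.inl j))) - c (E (.inr (.inr j))),
    fun j => hc _, fun x => ?_⟩
  rw [hx x, Fintype.sum_equiv E.symm _ (fun j => c (E j) * f j x) (by simp)]
  simp only [Fintype.sum_sum_type, f, Sum.elim_inl, Sum.elim_inr, LinearMap.neg_apply, sub_mul,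
    Finset.sum_sub_distrib, mul_neg, Finset.sum_neg_distrib]
  ring

/-- If finitely many convex functions are nowhere simultaneously negative on a convex set, then some
nontrivial nonnegative combination of them is nonnegative there. -/
theorem exists_nonneg_combination {E ι : Type*} [AddCommGroup E] [Module ℝ E] [Fintype ι]
    {C : Set E} {ψ : ι → E → ℝ} (hψ : ∀ j, ConvexOn ℝ C (ψ j)) (hC : Convex ℝ C)
    (hne : C.Nonempty) (h : ∀ u ∈ C, ∃ j, 0 ≤ ψ j u) :
    ∃ c : ι → ℝ, (∀ j, 0 ≤ c j) ∧ (∃ j, 0 < c j) ∧ ∀ u ∈ C, 0 ≤ ∑ j, c j * ψ j u := by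
  classical
  -- separate the origin from the open convex set of strict upper bounds of the values of `ψ`
  let A : Set (ι → ℝ) := {s | ∃ u ∈ C, ∀ j, ψ j u < s j}
  have hA : Convex ℝ A := by
    rintro s ⟨u, hu, hus⟩ s' ⟨u', hu', hus'⟩ p q hp hq hpq
    refine ⟨p • u + q • u', hC hu hu' hp hq hpq, fun j => ?_⟩
    have h1 := (hψ j).2 hu hu' hp hq hpq
    simp only [smul_eq_mul, Pi.add_apply, Pi.smul_apply] at h1 ⊢
    refine h1.trans_lt ?_
    rcases hp.eq_or_lt with rfl | hp'
    · have : q = 1 := by linarith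
      subst this; simpa using hus' j
    · have := mul_lt_mul_of_pos_left (hus j) hp'
      have := mul_le_mul_of_nonneg_left (hus' j).le hq
      linarith
  have hAo : IsOpen A := by
    have : A = ⋃ u ∈ C, ⋂ j, {s : ι → ℝ | ψ j u < s j} := by
      ext s; simp [A]
    rw [this]
    exact isOpen_biUnion fun u _ => isOpen_iInter_of_finite fun j =>
      isOpen_lt continuous_const (continuous_apply j)
  have h0 : (0 : ι → ℝ) ∉ A := by
    rintro ⟨u, hu, hlt⟩
    obtain ⟨j, hj⟩ := h u hu
    exact absurd (hlt j) (not_lt.2 (by simpa using hj))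
  obtain ⟨f, hf⟩ := geometric_hahn_banach_point_open hA hAo h0
  rw [map_zero] at hf
  have hfs : ∀ s, f s = ∑ j, f (Pi.single j 1) * s j := fun s => by
    conv_lhs => rw [← Finset.univ_sum_single s]
    rw [map_sum]
    refine Finset.sum_congr rfl fun j _ => ?_
    have : Pi.single j (s j) = s j • (Pi.single j (1 : ℝ) : ι → ℝ) := by
      rw [← Pi.single_smul]; simp
    rw [this, map_smul, smul_eq_mul, mul_comm]
  have hclos : ∀ u ∈ C, ∀ s : ι → ℝ, (∀ j, ψ j u ≤ s j) → 0 ≤ f s := by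
    intro u hu s hs
    have ht : Tendsto (fun ε : ℝ => f (fun j => s j + ε)) (𝓝[>] 0) (𝓝 (f s)) := by
      have : Continuous fun ε : ℝ => f (fun j => s j + ε) := by fun_prop
      have := this.tendsto 0
      simp only [add_zero] at this
      exact this.mono_left nhdsWithin_le_nhds
    refine ge_of_tendsto ht ?_
    filter_upwards [self_mem_nhdsWithin] with ε (hε : 0 < ε)
    exact (hf _ ⟨u, hu, fun j => by linarith [hs j]⟩).le
  obtain ⟨u₀, hu₀⟩ := hne
  have hc : ∀ j, 0 ≤ f (Pi.single j 1) := by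
    intro j
    by_contra hneg
    push Not at hneg
    have h1 : ∀ t : ℝ, 0 ≤ t → 0 ≤ f (fun i => ψ i u₀) + t * f (Pi.single j 1) := fun t ht => by
      have h2 := hclos u₀ hu₀ ((fun i => ψ i u₀) + t • (Pi.single j (1 : ℝ) : ι → ℝ)) fun i => by
        simp only [Pi.add_apply, Pi.smul_apply, smul_eq_mul]
        have : 0 ≤ (Pi.single j (1 : ℝ) : ι → ℝ) i := by
          by_cases hij : i = j
          · subst hij; simp
          · simp [hij]
        linarith [mul_nonneg ht this]
      rwa [map_add, map_smul, smul_eq_mul] at h2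
    have h2 := h1 (|f (fun i => ψ i u₀)| / (-f (Pi.single j 1)) + 1) (by
      have := div_nonneg (abs_nonneg (f (fun i => ψ i u₀))) (neg_pos.2 hneg).le
      linarith)
    have h3 : (|f (fun i => ψ i u₀)| / (-f (Pi.single j 1)) + 1) * f (Pi.single j 1)
        = -|f (fun i => ψ i u₀)| + f (Pi.single j 1) := by
      field_simp [hneg.ne]
    rw [h3] at h2
    linarith [le_abs_self (f (fun i => ψ i u₀))]
  refine ⟨fun j => f (Pi.single j 1), hc, ?_, fun u hu => ?_⟩
  · by_contra hall
    push Not at hall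
    have h1 := hf (fun j => ψ j u₀ + 1) ⟨u₀, hu₀, fun j => by linarith⟩
    rw [hfs] at h1
    have : ∑ j, f (Pi.single j 1) * (ψ j u₀ + 1) = 0 :=
      Finset.sum_eq_zero fun j _ => by rw [le_antisymm (hall j) (hc j), zero_mul]
    linarith
  · have := hclos u hu (fun j => ψ j u) fun j => le_rfl
    rwa [hfs] at this

namespace DCNetwork

variable {n : ℕ} {N : DCNetwork n}

/-! ### The projected vector field in coordinates -/

variable (N) in
/-- The vector field `F` with its `ρ`-component replaced by the smooth `l - P² / v`. -/
noncomputable def force (x : N.State) : N.Idx → ℝ :=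
  N.field (fun i => deriv (N.f i) (x (.pg i)))
    (fun i => N.yLin x i - N.vref i + x (.eps i)) (fun i => N.zLin x i - N.pd i - x (.mu i))
    (fun i => N.zLin x i - N.pd i) (fun i => N.yLin x i - N.vref i)
    (fun e => x (.lam e)) (fun e => x (.gam e)) (N.lossLin x) (N.dropLin x)
    (fun a => x (.rho a))
    (fun a => x (.rho a) * ((x (.P a) * (x (.v a.fst))⁻¹) * (x (.P a) * (x (.v a.fst))⁻¹)))
    (fun a => 2 * (x (.rho a) * (x (.P a) * (x (.v a.fst))⁻¹)))
    (fun a => x (.P a) * (x (.P a) * (x (.v a.fst))⁻¹) - x (.l (lineOf a)))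

variable (N) in
/-- The unconstrained coordinates. -/
def IsFree : N.Idx → Prop
  | .pg _ => False
  | .v _ => False
  | .rho _ => False
  | _ => True

lemma idx_cases {p : N.Idx → Prop} (hpg : ∀ i, p (.pg i)) (hv : ∀ i, p (.v i))
    (hrho : ∀ a, p (.rho a)) (hfree : ∀ j, N.IsFree j → p j) (j : N.Idx) : p j := by
  cases j with
  | pg i => exact hpg i
  | v i => exact hv i
  | rho a => exact hrho a
  | _ => exact hfree _ trivial

lemma y_eq (x : N.State) (i : Fin n) : (State.primal x).y i = N.yLin x i - N.vref i := by
  simp only [Primal.y, State.primal, yLin]; ring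

lemma z_eq (x : N.State) (i : Fin n) : (State.primal x).z i = N.zLin x i - N.pd i := by
  simp only [Primal.z, State.primal, zLin]; ring

lemma F_rho (x : N.State) (a : N.Arc) : N.F x (.rho a)
    = -posProj (x (.rho a)) (-N.force x (.rho a)) := by
  simp only [F, force, field, State.primal, neg_neg]
  congr 2
  ring

lemma F_eq_force (x : N.State) (j : N.Idx) (hj : ∀ a, j ≠ .rho a) : N.F x j = N.force x j := by
  cases j with
  | rho a => exact absurd rfl (hj a)
  | P a => simp only [F, y_eq, z_eq, force, field]; simp only [State.primal]; ring
  | v i =>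
    have e : ∑ a : N.Arc with a.fst = i, x (.rho a) * (x (.P a) ^ 2 / x (.v i) ^ 2)
        = ∑ a : N.Arc with a.fst = i,
          x (.rho a) * ((x (.P a) * (x (.v a.fst))⁻¹) * (x (.P a) * (x (.v a.fst))⁻¹)) := by
      refine Finset.sum_congr rfl fun a ha => ?_
      rw [(Finset.mem_filter.1 ha).2]; ring
    simp only [F, y_eq, force, field]
    simp only [State.primal, e]; ring
  | _ =>
    simp only [F, Primal.y, Primal.z, State.primal, force, field, yLin, zLin, lossLin, dropLin]
      <;> ring

variable (N) in
/-- The nearest point of `S`, in coordinates. -/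
noncomputable def clipS (w : N.State) : N.State := WithLp.toLp 2 fun
  | .pg i => clip 0 (N.pmax i) (w (.pg i))
  | .v i => clip (N.Vmin i ^ 2) (N.Vmax i ^ 2) (w (.v i))
  | j => w j

lemma clipS_free (w : N.State) {j : N.Idx} (hj : N.IsFree j ∨ ∃ a, j = .rho a) :
    N.clipS w j = w j := by
  cases j with
  | pg i => rcases hj with h | ⟨a, h⟩ <;> cases h
  | v i => rcases hj with h | ⟨a, h⟩ <;> cases h
  | _ => rfl

lemma clipS_mem (hS : N.S.Nonempty) (w : N.State) : N.clipS w ∈ N.S := by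
  obtain ⟨x, hx⟩ := hS
  exact ⟨fun i => clip_mem ((hx.1 i).1.trans (hx.1 i).2) _,
    fun i => clip_mem ((hx.2 i).1.trans (hx.2 i).2) _⟩

lemma clipS_variational (w : N.State) {y : N.State} (hy : y ∈ N.S) (j : N.Idx) :
    0 ≤ (w j - N.clipS w j) * (N.clipS w j - y j) := by
  revert j
  refine idx_cases (fun i => clip_variational _ (hy.1 i)) (fun i => clip_variational _ (hy.2 i))
    (fun a => ?_) (fun j hj => ?_)
  · rw [clipS_free w (.inr ⟨a, rfl⟩)]; simp
  · rw [clipS_free w (.inl hj)]; simp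

/-- The projection is given by a choice; the nearest point is unique, so that it is `clipS`. -/
lemma proj_eq (hS : N.S.Nonempty) (w : N.State) : N.proj w = N.clipS w := by
  have hle : ∀ y ∈ N.S, ∀ j, (N.clipS w j - w j) ^ 2 + (y j - N.clipS w j) ^ 2 ≤ (y j - w j) ^ 2 :=
    fun y hy j => by nlinarith [clipS_variational w hy j]
  have hnear : N.IsNearest w (N.clipS w) := by
    refine ⟨clipS_mem hS w, fun y hy => ?_⟩
    rw [EuclideanSpace.norm_eq, EuclideanSpace.norm_eq]
    refine Real.sqrt_le_sqrt (Finset.sum_le_sum fun j _ => ?_)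
    simp only [PiLp.sub_apply, Real.norm_eq_abs, sq_abs]
    nlinarith [hle y hy j, sq_nonneg (y j - N.clipS w j)]
  have hspec : N.IsNearest w (N.proj w) := Classical.epsilon_spec ⟨_, hnear⟩
  have h1 := hspec.2 _ (clipS_mem hS w)
  rw [EuclideanSpace.norm_eq, EuclideanSpace.norm_eq] at h1
  have h2 := (Real.sqrt_le_sqrt_iff (Finset.sum_nonneg fun j _ => sq_nonneg _)).1 h1
  simp only [PiLp.sub_apply, Real.norm_eq_abs, sq_abs] at h2
  have h3 := Finset.sum_le_sum fun j (_ : j ∈ Finset.univ) => hle _ hspec.1 j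
  rw [Finset.sum_add_distrib] at h3
  have h4 : ∑ j, (N.proj w j - N.clipS w j) ^ 2 = 0 :=
    le_antisymm (by linarith) (Finset.sum_nonneg fun j _ => sq_nonneg _)
  ext j
  have := (Finset.sum_eq_zero_iff_of_nonneg fun j _ => sq_nonneg _).1 h4 j (Finset.mem_univ j)
  exact sub_eq_zero.1 (pow_eq_zero_iff two_ne_zero |>.1 this)

variable (N) in
/-- The velocity prescribed by the dynamics. -/
noncomputable def vel (x : N.State) (j : N.Idx) : ℝ := (N.H x - x) j

lemma vel_pg (hS : N.S.Nonempty) (x : N.State) (i : Fin n) :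
    N.vel x (.pg i) = clip 0 (N.pmax i) (x (.pg i) - N.force x (.pg i)) - x (.pg i) := by
  rw [vel, H, proj_eq hS, PiLp.sub_apply, ← F_eq_force x _ (by simp)]; rfl

lemma vel_v (hS : N.S.Nonempty) (x : N.State) (i : Fin n) :
    N.vel x (.v i)
      = clip (N.Vmin i ^ 2) (N.Vmax i ^ 2) (x (.v i) - N.force x (.v i)) - x (.v i) := by
  rw [vel, H, proj_eq hS, PiLp.sub_apply, ← F_eq_force x _ (by simp)]; rfl

lemma vel_free (hS : N.S.Nonempty) (x : N.State) {j : N.Idx} (hj : N.IsFree j) :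
    N.vel x j = -N.force x j := by
  rw [vel, H, proj_eq hS, PiLp.sub_apply, clipS_free _ (.inl hj), PiLp.sub_apply,
    F_eq_force x _ (by rintro a rfl; exact hj)]
  ring

lemma vel_rho (hS : N.S.Nonempty) (x : N.State) (a : N.Arc) :
    N.vel x (.rho a) = posProj (x (.rho a)) (-N.force x (.rho a)) := by
  rw [vel, H, proj_eq hS, PiLp.sub_apply, clipS_free _ (.inr ⟨a, rfl⟩), PiLp.sub_apply, F_rho]
  ring

lemma equilibrium_iff (x : N.State) : x ∈ N.equilibria ↔ x ∈ N.S ∧ ∀ j, N.vel x j = 0 := by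
  refine and_congr_right fun _ => ⟨fun h j => by rw [vel, h]; rfl, fun h => ?_⟩
  ext j; exact h j

/-- The variational inequality of an equilibrium, coordinate by coordinate. -/
lemma equilibrium_variational {x y : N.State} (hx : x ∈ N.equilibria) (hy : y ∈ N.S)
    (hyr : ∀ a, 0 ≤ y (.rho a)) (hxr : ∀ a, 0 ≤ x (.rho a)) (j : N.Idx) :
    0 ≤ N.force x j * (y j - x j) := by
  have hS : N.S.Nonempty := ⟨x, hx.1⟩
  have hvel := ((equilibrium_iff x).1 hx).2
  revert j
  refine idx_cases (fun i => ?_) (fun i => ?_) (fun a => ?_) fun j hj => ?_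
  · have h := hvel (.pg i)
    rw [vel_pg hS] at h
    have := clip_variational (x (.pg i) - N.force x (.pg i)) (hy.1 i)
    rw [sub_eq_zero.1 h] at this
    linarith
  · have h := hvel (.v i)
    rw [vel_v hS] at h
    have := clip_variational (x (.v i) - N.force x (.v i)) (hy.2 i)
    rw [sub_eq_zero.1 h] at this
    linarith
  · have h := hvel (.rho a)
    rw [vel_rho hS, posProj] at h
    split_ifs at h with hc
    · rw [neg_eq_zero.1 h, zero_mul]
    · push Not at hc
      have : x (.rho a) = 0 := le_antisymm hc.1 (hxr a)
      rw [this, sub_zero]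
      exact mul_nonneg (by linarith [hc.2]) (hyr a)
  · have h := hvel j
    rw [vel_free hS x hj, neg_eq_zero] at h
    rw [h, zero_mul]

lemma equilibrium_force_free {x : N.State} (hx : x ∈ N.equilibria) {j : N.Idx} (hj : N.IsFree j) :
    N.force x j = 0 := by
  have h := ((equilibrium_iff x).1 hx).2 j
  rwa [vel_free ⟨x, hx.1⟩ x hj, neg_eq_zero] at h

/-! ### Monotonicity of the force -/

/-- The pairing of a field with its own direction: the saddle structure cancels all terms that
couple primal variables and multipliers. -/
lemma sum_field_self (G : Fin n → ℝ) (c e g : N.Arc → ℝ) (d : N.Idx → ℝ) :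
    ∑ j, N.field G (fun i => N.yLin d i + d (.eps i)) (fun i => N.zLin d i - d (.mu i))
        (N.zLin d) (N.yLin d) (fun e => d (.lam e)) (fun e => d (.gam e)) (N.lossLin d)
        (N.dropLin d) (fun a => d (.rho a)) c e g j * d j
      = ∑ i, G i * d (.pg i) + ∑ i, N.yLin d i ^ 2 + ∑ i, N.zLin d i ^ 2
        + ∑ a : N.Arc, (-(c a * d (.v a.fst)) + e a * d (.P a)
          - (g a + d (.l (lineOf a))) * d (.rho a)) := by
  rw [sum_field_mul]
  have hc : ∀ {ι : Type} [Fintype ι] (p q : ι → ℝ), ∑ i, p i * q i = ∑ i, q i * p i :=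
    fun p q => Finset.sum_congr rfl fun i _ => mul_comm _ _
  simp only [add_mul, sub_mul, Finset.sum_add_distrib, Finset.sum_sub_distrib, sq]
  rw [hc (fun i => d (.eps i)), hc (fun i => d (.mu i)), hc (fun e => d (.lam e)),
    hc (fun e => d (.gam e)), hc (fun a => d (.rho a)) (fun a => d (.l (lineOf a)))]
  ring

lemma field_sub (G s m z y : Fin n → ℝ) (lam gam loss drop : N.Line → ℝ) (rho c e g : N.Arc → ℝ)
    (G' s' m' z' y' : Fin n → ℝ) (lam' gam' loss' drop' : N.Line → ℝ) (rho' c' e' g' : N.Arc → ℝ)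
    (j : N.Idx) :
    N.field G s m z y lam gam loss drop rho c e g j
      - N.field G' s' m' z' y' lam' gam' loss' drop' rho' c' e' g' j
      = N.field (fun i => G i - G' i) (fun i => s i - s' i) (fun i => m i - m' i)
        (fun i => z i - z' i) (fun i => y i - y' i) (fun i => lam i - lam' i)
        (fun i => gam i - gam' i) (fun i => loss i - loss' i) (fun i => drop i - drop' i)
        (fun i => rho i - rho' i) (fun i => c i - c' i) (fun i => e i - e' i)
        (fun i => g i - g' i) j := by
  cases j <;> simp only [field, mul_sub, Finset.sum_sub_distrib] <;> ring

lemma yLin_sub (x y : N.Idx → ℝ) (i : Fin n) :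
    N.yLin (fun j => x j - y j) i = N.yLin x i - N.yLin y i := by
  simp only [yLin]; ring

lemma zLin_sub (x y : N.Idx → ℝ) (i : Fin n) :
    N.zLin (fun j => x j - y j) i = N.zLin x i - N.zLin y i := by
  simp only [zLin, Finset.sum_sub_distrib]; ring

lemma lossLin_sub (x y : N.Idx → ℝ) (e : N.Line) :
    N.lossLin (fun j => x j - y j) e = N.lossLin x e - N.lossLin y e := by
  simp only [lossLin]; ring

lemma dropLin_sub (x y : N.Idx → ℝ) (e : N.Line) :
    N.dropLin (fun j => x j - y j) e = N.dropLin x e - N.dropLin y e := by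
  simp only [dropLin]; ring

lemma v_pos {x : N.State} (hx : x ∈ N.S) (i : Fin n) : 0 < x (.v i) :=
  (pow_pos (N.Vmin_pos i) 2).trans_le (hx.2 i).1

/-- The marginal costs are monotone. -/
lemma A1.deriv_monotone (h : N.A1) (i : Fin n) : Monotone (deriv (N.f i)) := by
  obtain ⟨-, h2, α, hα, hf⟩ := h
  have hd : Differentiable ℝ (deriv (N.f i)) :=
    ((contDiff_succ_iff_deriv (n := 1)).1 (h2 i)).2.2.differentiable one_ne_zero
  exact monotone_of_deriv_nonneg hd fun p => hα.le.trans (hf i p)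

/-- Monotonicity of the force, with the part of the lower bound that is needed later: the conic
terms contribute the gap in the convexity of `P² / v`, weighted by the multipliers. -/
lemma force_monotone (hf : N.A1) {x y : N.State} (hx : x ∈ N.S) (hy : y ∈ N.S)
    (hxr : ∀ a, 0 ≤ x (.rho a)) :
    ∑ i, (N.yLin x i - N.yLin y i) ^ 2 + ∑ i, (N.zLin x i - N.zLin y i) ^ 2
      + ∑ a : N.Arc, y (.rho a) * ((x (.v a.fst))⁻¹
        * (x (.P a) - y (.P a) * (y (.v a.fst))⁻¹ * x (.v a.fst)) ^ 2)
      ≤ ∑ j, (N.force x j - N.force y j) * (x j - y j) := by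
  have h := sum_field_self (N := N) (fun i => deriv (N.f i) (x (.pg i)) - deriv (N.f i) (y (.pg i)))
    (fun a => x (.rho a) * ((x (.P a) * (x (.v a.fst))⁻¹) * (x (.P a) * (x (.v a.fst))⁻¹))
      - y (.rho a) * ((y (.P a) * (y (.v a.fst))⁻¹) * (y (.P a) * (y (.v a.fst))⁻¹)))
    (fun a => 2 * (x (.rho a) * (x (.P a) * (x (.v a.fst))⁻¹))
      - 2 * (y (.rho a) * (y (.P a) * (y (.v a.fst))⁻¹)))
    (fun a => (x (.P a) * (x (.P a) * (x (.v a.fst))⁻¹) - x (.l (lineOf a)))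
      - (y (.P a) * (y (.P a) * (y (.v a.fst))⁻¹) - y (.l (lineOf a))))
    (fun j => x j - y j)
  refine le_of_le_of_eq ?_ ((Finset.sum_congr rfl fun j _ => ?_).trans h).symm
  swap
  · rw [force, force, field_sub]
    congr 2
    · funext i; rw [yLin_sub]; ring
    · funext i; rw [zLin_sub]; ring
    · funext i; rw [zLin_sub]; ring
    · funext i; rw [yLin_sub]; ring
    · funext i; rw [lossLin_sub]
    · funext i; rw [dropLin_sub]
  have h1 : 0 ≤ ∑ i, (deriv (N.f i) (x (.pg i)) - deriv (N.f i) (y (.pg i)))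
      * (x (.pg i) - y (.pg i)) := Finset.sum_nonneg fun i _ => by
    rcases le_total (x (.pg i)) (y (.pg i)) with h | h
    · exact mul_nonneg_of_nonpos_of_nonpos (by linarith [hf.deriv_monotone i h]) (by linarith)
    · exact mul_nonneg (by linarith [hf.deriv_monotone i h]) (by linarith)
  simp only [yLin_sub, zLin_sub]
  refine add_le_add (by linarith) (Finset.sum_le_sum fun a _ => ?_)
  have hv := v_pos hx a.fst
  have hw := v_pos hy a.fst
  have hr := hxr a
  generalize x (.v a.fst) = v at *
  generalize y (.v a.fst) = w at *
  generalize x (.rho a) = ρ at *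
  have h2 : 0 ≤ ρ * (w⁻¹ * (y (.P a) - x (.P a) * v⁻¹ * w) ^ 2) := by positivity
  refine le_of_eq_of_le (add_zero _).symm ((add_le_add_right h2 _).trans (le_of_eq ?_))
  field_simp
  ring

end DCNetwork

namespace DCNetwork

variable {n : ℕ} {N : DCNetwork n}

/-! ### Existence of an equilibrium: optimal points of ESOCP have multipliers -/

/-- A choice of primal variables, completed by zero multipliers. -/
noncomputable def Primal.toState (q : N.Primal) : N.State := WithLp.toLp 2 fun
  | .pg i => q.p i
  | .v i => q.v i
  | .P a => q.P a
  | .l e => q.l e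
  | .phat i => q.phat i
  | _ => 0

/-- The residual of the conic constraint of an ordered pair; the constraint is `cone x a ≤ 0`. -/
noncomputable def cone (x : N.State) (a : N.Arc) : ℝ :=
  x (.P a) * (x (.P a) * (x (.v a.fst))⁻¹) - x (.l (lineOf a))

/-- The generation cost. -/
noncomputable def cost (x : N.State) : ℝ := ∑ i, N.f i (x (.pg i))

variable (N) in
/-- The states that satisfy all constraints of ESOCP apart from the conic ones. -/
def polyhedron : Set N.State :=
  {x | x ∈ N.S ∧ (∀ i, N.yLin x i = N.vref i) ∧ (∀ i, N.zLin x i = N.pd i) ∧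
    (∀ e, N.lossLin x e = 0) ∧ ∀ e, N.dropLin x e = 0}

lemma feasible_iff (x : N.State) :
    (State.primal x).Feasible ↔ x ∈ N.polyhedron ∧ ∀ a, cone x a ≤ 0 := by
  constructor
  · intro h
    refine ⟨⟨⟨h.gen, h.volt⟩, fun i => ?_, fun i => ?_, fun e => ?_, fun e => ?_⟩, fun a => ?_⟩
    · have := h.droop i
      simp only [State.primal] at this
      simp only [yLin]; linear_combination this
    · have := h.balance i
      simp only [State.primal] at this
      simp only [zLin]; linear_combination this
    · have := h.loss e.1
      simp only [State.primal, lineOf_line] at this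
      simp only [lossLin]; linear_combination this
    · have := h.drop e.1
      simp only [State.primal] at this
      simp only [dropLin]; linear_combination this
    · have := h.cone a
      simp only [State.primal] at this
      rw [cone, ← mul_assoc, ← sq, ← div_eq_mul_inv]; linarith
  · rintro ⟨⟨hS, hy, hz, hl, hd⟩, hc⟩
    refine ⟨fun i => ?_, fun i => ?_, hS.1, ?_, ?_, fun a => ?_, hS.2⟩
    · have := hy i
      simp only [yLin] at this
      simp only [State.primal]; linear_combination this
    · have := hz i
      simp only [zLin] at this
      simp only [State.primal]; linear_combination this
    · refine arc_cases fun e => ?_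
      have := hl e
      simp only [lossLin] at this
      simp only [State.primal, lineOf_line, lineOf_line_symm, res_symm, SimpleGraph.Dart.symm_symm]
      constructor <;> linear_combination this
    · refine arc_cases fun e => ?_
      have := hd e
      simp only [dropLin] at this
      simp only [State.primal, res_symm, SimpleGraph.Dart.symm_symm]
      simp only [SimpleGraph.Dart.symm_toProd, Prod.fst_swap, Prod.snd_swap]
      exact ⟨by linear_combination this, by linear_combination -this⟩
    · have := hc a
      rw [cone, ← mul_assoc, ← sq, ← div_eq_mul_inv] at this
      simp only [State.primal]; linarith

lemma polyhedron_toState {x : N.State} (hx : x ∈ N.polyhedron) :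
    (State.primal x).toState ∈ N.polyhedron := hx

/-- The penalty terms of the objective vanish at points that satisfy the linear equations. -/
lemma objective_eq_cost {x : N.State} (hx : x ∈ N.polyhedron) :
    (State.primal x).objective = cost x := by
  obtain ⟨-, hy, hz, -, -⟩ := hx
  simp only [Primal.objective, y_eq, z_eq, hy, hz, sub_self]
  simp [cost, State.primal]

/-- The generation exceeds the load by the losses. -/
lemma sum_flow {x : N.State} (hl : ∀ e, N.lossLin x e = 0) (hz : ∀ i, N.zLin x i = N.pd i) :
    ∑ i, (x (.pg i) - N.pd i) = ∑ e : N.Line, N.res e.1 * x (.l e) := by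
  have h1 : ∀ i, x (.pg i) - N.pd i = ∑ a : N.Arc with a.fst = i, x (.P a) := fun i => by
    have := hz i
    simp only [zLin] at this
    linarith
  simp only [h1]
  rw [sum_node_arc', sum_arc]
  refine Finset.sum_congr rfl fun e _ => ?_
  have := hl e
  simp only [lossLin] at this
  linarith

lemma current_nonneg {x : N.State} (hS : x ∈ N.S) (hc : ∀ a, cone x a ≤ 0) (e : N.Line) :
    0 ≤ x (.l e) := by
  have h := hc e.1
  rw [cone, lineOf_line, ← mul_assoc] at h
  have := mul_nonneg (mul_self_nonneg (x (.P e.1))) (inv_nonneg.2 (v_pos hS e.1.fst).le)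
  linarith

lemma cone_nonpos_iff {x : N.State} (hS : x ∈ N.S) (a : N.Arc) :
    cone x a ≤ 0 ↔ x (.P a) ^ 2 ≤ x (.l (lineOf a)) * x (.v a.fst) := by
  have hv := v_pos hS a.fst
  rw [cone, sub_nonpos, ← mul_assoc, ← sq, ← div_eq_mul_inv, div_le_iff₀ hv]

/-- The feasible set is bounded, since the losses are bounded by the total generation. The
multipliers play no role here and are reset to zero. -/
lemma feasible_bounded (hpd : ∀ i, 0 < N.pd i) (j : N.Idx) :
    ∃ R, ∀ x : N.State, x ∈ N.polyhedron → (∀ a, cone x a ≤ 0) →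
      |(State.primal x).toState j| ≤ R := by
  have hl : ∀ e : N.Line, ∃ R, 0 ≤ R ∧ ∀ x : N.State, x ∈ N.polyhedron → (∀ a, cone x a ≤ 0) →
      0 ≤ x (.l e) ∧ x (.l e) ≤ R := by
    intro e
    refine ⟨|(∑ i, N.pmax i) / N.res e.1|, abs_nonneg _, fun x hx hc => ?_⟩
    have h0 := current_nonneg hx.1 hc
    refine ⟨h0 e, le_trans ?_ (le_abs_self _)⟩
    rw [le_div_iff₀ (res_pos _), mul_comm]
    have h1 := sum_flow hx.2.2.2.1 hx.2.2.1
    have h2 : N.res e.1 * x (.l e) ≤ ∑ e : N.Line, N.res e.1 * x (.l e) :=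
      Finset.single_le_sum (f := fun e : N.Line => N.res e.1 * x (.l e))
        (fun e _ => mul_nonneg (res_pos _).le (h0 e)) (Finset.mem_univ e)
    have h3 : ∑ i, (x (.pg i) - N.pd i) ≤ ∑ i, N.pmax i :=
      Finset.sum_le_sum fun i _ => by linarith [(hx.1.1 i).2, hpd i]
    linarith
  cases j with
  | pg i =>
    refine ⟨N.pmax i, fun x hx _ => ?_⟩
    change |x (.pg i)| ≤ _
    rw [abs_of_nonneg (hx.1.1 i).1]; exact (hx.1.1 i).2
  | v i =>
    refine ⟨N.Vmax i ^ 2, fun x hx _ => ?_⟩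
    change |x (.v i)| ≤ _
    rw [abs_of_pos (v_pos hx.1 i)]; exact (hx.1.2 i).2
  | l e =>
    obtain ⟨R, -, hR⟩ := hl e
    refine ⟨R, fun x hx hc => ?_⟩
    change |x (.l e)| ≤ _
    rw [abs_of_nonneg (hR x hx hc).1]; exact (hR x hx hc).2
  | P a =>
    obtain ⟨R, hR0, hR⟩ := hl (lineOf a)
    refine ⟨1 + R * N.Vmax a.fst ^ 2, fun x hx hc => ?_⟩
    change |x (.P a)| ≤ _
    have h1 := (cone_nonpos_iff hx.1 a).1 (hc a)
    have h2 : x (.l (lineOf a)) * x (.v a.fst) ≤ R * N.Vmax a.fst ^ 2 :=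
      mul_le_mul (hR x hx hc).2 (hx.1.2 _).2 (v_pos hx.1 _).le hR0
    have h3 : |x (.P a)| ≤ 1 + x (.P a) ^ 2 := by
      rw [← sq_abs]; nlinarith [sq_nonneg (|x (.P a)| - 1)]
    linarith
  | phat i =>
    refine ⟨(N.Vmax i ^ 2 + N.k i * N.pmax i + |N.vref i|) / N.k i, fun x hx _ => ?_⟩
    change |x (.phat i)| ≤ _
    have h1 := hx.2.1 i
    simp only [yLin] at h1
    have hk := N.k_pos i
    rw [le_div_iff₀ hk, ← abs_of_pos hk, ← abs_mul, abs_of_pos hk]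
    have h2 : x (.phat i) * N.k i = x (.v i) + N.k i * x (.pg i) + (-N.vref i) := by linarith
    rw [h2]
    refine (abs_add_le _ _).trans ?_
    rw [abs_neg, abs_of_nonneg (add_nonneg (v_pos hx.1 i).le (mul_nonneg hk.le (hx.1.1 i).1))]
    gcongr
    exacts [(hx.1.2 i).2, (hx.1.1 i).2]
  | _ => exact ⟨0, fun x _ _ => by change |(0 : ℝ)| ≤ 0; simp⟩

/-- ESOCP has an optimal solution. -/
lemma exists_optimal (hpd : ∀ i, 0 < N.pd i) (hf : N.A1)
    (hne : ∃ x ∈ N.polyhedron, ∀ a, cone x a ≤ 0) :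
    ∃ x ∈ N.polyhedron, (∀ a, cone x a ≤ 0) ∧
      ∀ y ∈ N.polyhedron, (∀ a, cone y a ≤ 0) → cost x ≤ cost y := by
  choose R hR using feasible_bounded (N := N) hpd
  let K : Set N.State := {x | x ∈ N.polyhedron ∧
    (∀ a : N.Arc, x (.P a) ^ 2 ≤ x (.l (lineOf a)) * x (.v a.fst)) ∧ ∀ j, |x j| ≤ R j}
  have hclosed : IsClosed K := by
    have e : K = {x : N.State | ((∀ i, 0 ≤ x (.pg i) ∧ x (.pg i) ≤ N.pmax i) ∧
        ∀ i, N.Vmin i ^ 2 ≤ x (.v i) ∧ x (.v i) ≤ N.Vmax i ^ 2) ∧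
        ((∀ i, N.yLin x i = N.vref i) ∧ (∀ i, N.zLin x i = N.pd i) ∧
        (∀ e, N.lossLin x e = 0) ∧ ∀ e, N.dropLin x e = 0) ∧
        (∀ a : N.Arc, x (.P a) ^ 2 ≤ x (.l (lineOf a)) * x (.v a.fst)) ∧ ∀ j, |x j| ≤ R j} := by
      ext x; simp only [K, polyhedron, S, Set.mem_ofPred_eq, and_assoc]
    rw [e]
    simp only [Set.ofPred_and, Set.ofPred_forall, yLin, zLin, lossLin, dropLin]
    refine IsClosed.inter (IsClosed.inter ?_ ?_) (IsClosed.inter ?_ (IsClosed.inter ?_ ?_))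
    · exact isClosed_iInter fun i => (isClosed_le (by fun_prop) (by fun_prop)).inter
        (isClosed_le (by fun_prop) (by fun_prop))
    · exact isClosed_iInter fun i => (isClosed_le (by fun_prop) (by fun_prop)).inter
        (isClosed_le (by fun_prop) (by fun_prop))
    · refine IsClosed.inter ?_ (IsClosed.inter ?_ (IsClosed.inter ?_ ?_)) <;>
        exact isClosed_iInter fun i => isClosed_eq (by fun_prop) (by fun_prop)
    · exact isClosed_iInter fun i => isClosed_le (by fun_prop) (by fun_prop)
    · exact isClosed_iInter fun i => isClosed_le (by fun_prop) (by fun_prop)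
  have hcompact : IsCompact K := by
    have h1 : IsCompact (Set.univ.pi fun j : N.Idx => Set.Icc (-R j) (R j)) :=
      isCompact_univ_pi fun j => isCompact_Icc
    have h2 : IsCompact ((WithLp.toLp 2 : (N.Idx → ℝ) → N.State) ''
        Set.univ.pi fun j : N.Idx => Set.Icc (-R j) (R j)) :=
      h1.image (PiLp.continuous_toLp 2 _)
    refine h2.of_isClosed_subset hclosed fun x hx => ⟨x.ofLp, fun j _ => ?_, rfl⟩
    exact abs_le.1 (hx.2.2 j)
  have hto : ∀ x : N.State, x ∈ N.polyhedron → (∀ a, cone x a ≤ 0) →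
      (State.primal x).toState ∈ K := fun x hx hc =>
    ⟨polyhedron_toState hx, fun a => (cone_nonpos_iff hx.1 a).1 (hc a), fun j => hR j x hx hc⟩
  obtain ⟨x₀, h1, h2⟩ := hne
  have hcont : Continuous (cost (N := N)) := by
    have : ∀ i, Continuous (N.f i) := fun i => (hf.2.1 i).continuous
    unfold cost; fun_prop
  obtain ⟨x, hx, hmin⟩ := hcompact.exists_isMinOn ⟨_, hto x₀ h1 h2⟩ hcont.continuousOn
  refine ⟨x, hx.1, fun a => (cone_nonpos_iff hx.1.1 a).2 (hx.2.1 a), fun y hy hc => ?_⟩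
  have h : cost x ≤ cost (State.primal y).toState := isMinOn_iff.1 hmin _ (hto y hy hc)
  exact h

lemma A1.convexOn (h : N.A1) (i : Fin n) : ConvexOn ℝ Set.univ (N.f i) := by
  obtain ⟨-, h2, α, hα, hf⟩ := h
  have hd := (contDiff_succ_iff_deriv (n := 1)).1 (h2 i)
  exact convexOn_univ_of_deriv2_nonneg hd.1 (hd.2.2.differentiable one_ne_zero)
    fun p => hα.le.trans (hf i p)

lemma yLin_comb (x y : N.State) (p q : ℝ) (i : Fin n) :
    N.yLin (p • x + q • y : N.State) i = p * N.yLin x i + q * N.yLin y i := by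
  simp only [yLin, PiLp.add_apply, PiLp.smul_apply, smul_eq_mul]; ring

lemma zLin_comb (x y : N.State) (p q : ℝ) (i : Fin n) :
    N.zLin (p • x + q • y : N.State) i = p * N.zLin x i + q * N.zLin y i := by
  simp only [zLin, PiLp.add_apply, PiLp.smul_apply, smul_eq_mul, Finset.sum_add_distrib,
    ← Finset.mul_sum]; ring

lemma lossLin_comb (x y : N.State) (p q : ℝ) (e : N.Line) :
    N.lossLin (p • x + q • y : N.State) e = p * N.lossLin x e + q * N.lossLin y e := by
  simp only [lossLin, PiLp.add_apply, PiLp.smul_apply, smul_eq_mul]; ring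

lemma dropLin_comb (x y : N.State) (p q : ℝ) (e : N.Line) :
    N.dropLin (p • x + q • y : N.State) e = p * N.dropLin x e + q * N.dropLin y e := by
  simp only [dropLin, PiLp.add_apply, PiLp.smul_apply, smul_eq_mul]; ring

lemma convex_polyhedron : Convex ℝ N.polyhedron := by
  rintro x ⟨hx, hx1, hx2, hx3, hx4⟩ y ⟨hy, hy1, hy2, hy3, hy4⟩ p q hp hq hpq
  have box : ∀ {a b s t : ℝ}, a ≤ s ∧ s ≤ b → a ≤ t ∧ t ≤ b →
      a ≤ p * s + q * t ∧ p * s + q * t ≤ b := by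
    intro a b s t hs ht
    have hq' : q = 1 - p := by linarith
    subst hq'
    constructor <;> nlinarith [mul_le_mul_of_nonneg_left hs.1 hp, mul_le_mul_of_nonneg_left hs.2 hp,
      mul_le_mul_of_nonneg_left ht.1 hq, mul_le_mul_of_nonneg_left ht.2 hq]
  refine ⟨⟨fun i => ?_, fun i => ?_⟩, fun i => ?_, fun i => ?_, fun e => ?_, fun e => ?_⟩
  · simpa using box (hx.1 i) (hy.1 i)
  · simpa using box (hx.2 i) (hy.2 i)
  · rw [yLin_comb, hx1, hy1, ← add_mul, hpq, one_mul]
  · rw [zLin_comb, hx2, hy2, ← add_mul, hpq, one_mul]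
  · rw [lossLin_comb, hx3, hy3]; ring
  · rw [dropLin_comb, hx4, hy4]; ring

lemma convexOn_cost (hf : N.A1) : ConvexOn ℝ N.polyhedron (cost (N := N)) := by
  refine ⟨convex_polyhedron, fun x _ y _ p q hp hq hpq => ?_⟩
  simp only [cost, smul_eq_mul, Finset.mul_sum, ← Finset.sum_add_distrib]
  refine Finset.sum_le_sum fun i _ => ?_
  simpa using (hf.convexOn i).2 (Set.mem_univ (x (.pg i))) (Set.mem_univ (y (.pg i))) hp hq hpq

/-- The convexity of `P² / v`, the perspective of the square. -/
lemma convexOn_cone (a : N.Arc) : ConvexOn ℝ N.polyhedron (fun x => cone x a) := by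
  refine ⟨convex_polyhedron, fun x hx y hy p q hp hq hpq => ?_⟩
  have hv := v_pos hx.1 a.fst
  have hw := v_pos hy.1 a.fst
  have hc := v_pos (convex_polyhedron hx hy hp hq hpq).1 a.fst
  simp only [cone, PiLp.add_apply, PiLp.smul_apply, smul_eq_mul] at hc ⊢
  generalize x (.v a.fst) = v at *
  generalize y (.v a.fst) = w at *
  generalize x (.P a) = P at *
  generalize y (.P a) = Q at *
  have key : (p * P + q * Q) * ((p * P + q * Q) * (p * v + q * w)⁻¹)
      ≤ p * (P * (P * v⁻¹)) + q * (Q * (Q * w⁻¹)) := by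
    rw [← mul_assoc, ← div_eq_mul_inv, div_le_iff₀ hc]
    have e : (p * (P * (P * v⁻¹)) + q * (Q * (Q * w⁻¹))) * (p * v + q * w)
        - (p * P + q * Q) * (p * P + q * Q) = p * q * (v * w * (P * v⁻¹ - Q * w⁻¹) ^ 2) := by
      field_simp; ring
    have : 0 ≤ p * q * (v * w * (P * v⁻¹ - Q * w⁻¹) ^ 2) := by positivity
    linarith
  linarith

/-- The multipliers of the conic constraints, from Slater's condition. -/
lemma exists_cone_multipliers (hf : N.A1) {x₀ : N.State} (hx₀ : x₀ ∈ N.polyhedron)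
    (hc₀ : ∀ a, cone x₀ a ≤ 0)
    (hmin : ∀ y ∈ N.polyhedron, (∀ a, cone y a ≤ 0) → cost x₀ ≤ cost y)
    (hslater : ∃ y ∈ N.polyhedron, ∀ a, cone y a < 0) :
    ∃ ρ : N.Arc → ℝ, (∀ a, 0 ≤ ρ a) ∧ (∀ a, ρ a * cone x₀ a = 0) ∧
      ∀ y ∈ N.polyhedron, cost x₀ ≤ cost y + ∑ a, ρ a * cone y a := by
  obtain ⟨c, hc, ⟨j, hj⟩, hsum⟩ := exists_nonneg_combination (ι := Option N.Arc) (C := N.polyhedron)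
    (ψ := fun j => j.elim (fun y => cost y - cost x₀) (fun a y => cone y a))
    (fun j => by
      cases j with
      | none => exact (convexOn_cost hf).add_const (-cost x₀)
      | some a => exact convexOn_cone a)
    convex_polyhedron ⟨x₀, hx₀⟩ (fun u hu => by
      by_contra! hcon
      exact absurd (hcon none) (not_lt.2 (sub_nonneg.2 (hmin u hu fun a => (hcon (some a)).le))))
  simp only [Fintype.sum_option, Option.elim_none, Option.elim_some] at hsum
  have h0 : 0 < c none := by
    refine (hc none).lt_of_ne' fun h => ?_
    obtain ⟨y, hy, hlt⟩ := hslater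
    have h1 := hsum y hy
    rw [h, zero_mul, zero_add] at h1
    cases j with
    | none => exact hj.ne' h
    | some b =>
      have : ∑ a, c (some a) * cone y a < ∑ a : N.Arc, 0 :=
        Finset.sum_lt_sum (fun a _ => mul_nonpos_of_nonneg_of_nonpos (hc _) (hlt a).le)
          ⟨b, Finset.mem_univ _, mul_neg_of_pos_of_neg hj (hlt b)⟩
      simp at this
      linarith
  have hmain : ∀ y ∈ N.polyhedron, cost x₀ ≤ cost y + ∑ a, c (some a) / c none * cone y a := by
    intro y hy
    have h1 := hsum y hy
    have h2 : ∑ a, c (some a) / c none * cone y a = (c none)⁻¹ * ∑ a, c (some a) * cone y a := by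
      rw [Finset.mul_sum]; exact Finset.sum_congr rfl fun a _ => by ring
    have h3 : 0 ≤ (c none)⁻¹ * (c none * (cost y - cost x₀) + ∑ a, c (some a) * cone y a) :=
      mul_nonneg (inv_nonneg.2 h0.le) h1
    rw [mul_add, inv_mul_cancel_left₀ h0.ne'] at h3
    linarith
  refine ⟨fun a => c (some a) / c none, fun a => div_nonneg (hc _) h0.le, fun a => ?_, hmain⟩
  have h1 := hmain x₀ hx₀
  have h2 : ∀ b : N.Arc, b ∈ Finset.univ → c (some b) / c none * cone x₀ b ≤ 0 := fun b _ =>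
    mul_nonpos_of_nonneg_of_nonpos (div_nonneg (hc _) h0.le) (hc₀ b)
  exact (Finset.sum_eq_zero_iff_of_nonpos h2).1
    (le_antisymm (Finset.sum_nonpos h2) (by linarith)) a (Finset.mem_univ a)

end DCNetwork

namespace DCNetwork

variable {n : ℕ} {N : DCNetwork n}

/-- A coordinate at rest under the projection, from the signs of a normal vector. -/
lemma clip_sub_eq {a b x β : ℝ} (hx : a ≤ x ∧ x ≤ b) (ha : x ≠ a → β ≤ 0) (hb : x ≠ b → 0 ≤ β) :
    clip a b (x - β) = x := by
  unfold clip
  by_cases h1 : x = a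
  · by_cases h2 : x = b
    · rw [← h1, ← h2]; rcases le_total x (x - β) with h | h <;> simp [h]
    · rw [min_eq_right (by linarith [hb h2, hx.2]), ← h1, max_eq_left (by linarith [hb h2])]
  · by_cases h2 : x = b
    · rw [min_eq_left (by linarith [ha h1]), max_eq_right (hx.1.trans hx.2), h2]
    · have : β = 0 := le_antisymm (ha h1) (hb h2)
      rw [this, sub_zero, min_eq_right hx.2, max_eq_right hx.1]

variable (N) in
/-- The partial derivatives of `cost + ∑ ρ cone` at `x`, as a field. -/
noncomputable def lagrangianGrad (x : N.State) (ρ : N.Arc → ℝ) : N.Idx → ℝ :=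
  N.field (fun i => deriv (N.f i) (x (.pg i))) 0 0 0 0 0 0 0 0 ρ
    (fun a => ρ a * ((x (.P a) * (x (.v a.fst))⁻¹) * (x (.P a) * (x (.v a.fst))⁻¹)))
    (fun a => 2 * (ρ a * (x (.P a) * (x (.v a.fst))⁻¹))) 0

lemma sum_lagrangianGrad (x : N.State) (ρ : N.Arc → ℝ) (d : N.Idx → ℝ) :
    ∑ j, N.lagrangianGrad x ρ j * d j = ∑ i, deriv (N.f i) (x (.pg i)) * d (.pg i)
      + ∑ a : N.Arc,
        (-(ρ a * ((x (.P a) * (x (.v a.fst))⁻¹) * (x (.P a) * (x (.v a.fst))⁻¹)) * d (.v a.fst))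
        + 2 * (ρ a * (x (.P a) * (x (.v a.fst))⁻¹)) * d (.P a) - ρ a * d (.l (lineOf a))) := by
  rw [lagrangianGrad, sum_field_mul]
  simp

lemma hasDerivAt_lagrangian (hf : N.A1) {x : N.State} (hx : x ∈ N.S) (ρ : N.Arc → ℝ) (d : N.State) :
    HasDerivAt (fun t : ℝ => cost (x + t • d) + ∑ a, ρ a * cone (x + t • d) a)
      (∑ j, N.lagrangianGrad x ρ j * d j) 0 := by
  have hlin : ∀ j, HasDerivAt (fun t : ℝ => (x + t • d) j) (d j) 0 := fun j => by
    simpa using ((hasDerivAt_id (0 : ℝ)).mul_const (d j)).const_add (x j)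
  rw [sum_lagrangianGrad]
  refine HasDerivAt.add (HasDerivAt.fun_sum fun i _ => ?_) (HasDerivAt.fun_sum fun a _ => ?_)
  · have h1 : HasDerivAt (N.f i) (deriv (N.f i) (x (.pg i)))
        ((fun t : ℝ => (x + t • d) (.pg i)) 0) := by
      simpa using ((hf.2.1 i).differentiable two_ne_zero _).hasDerivAt
    exact h1.comp 0 (hlin (.pg i))
  · have hv := v_pos hx a.fst
    have h1 := (hlin (.v a.fst)).inv (by simpa using hv.ne')
    have h2 := (((hlin (.P a)).mul ((hlin (.P a)).mul h1)).sub (hlin (.l (lineOf a)))).const_mul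
        (ρ a)
    refine h2.congr_deriv ?_
    simp
    field_simp
    ring

variable (N) in
/-- The coordinate is at its lower limit. -/
def LowerActive (x : N.State) : N.Idx → Prop
  | .pg i => x (.pg i) = 0
  | .v i => x (.v i) = N.Vmin i ^ 2
  | _ => False

variable (N) in
/-- The coordinate is at its upper limit. -/
def UpperActive (x : N.State) : N.Idx → Prop
  | .pg i => x (.pg i) = N.pmax i
  | .v i => x (.v i) = N.Vmax i ^ 2
  | _ => False

/-- Directions that satisfy the linear equations and point into the active limits are feasible for a
short time. -/
lemma eventually_mem_polyhedron {x d : N.State} (hx : x ∈ N.polyhedron)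
    (hlo : ∀ j, N.LowerActive x j → 0 ≤ d j) (hup : ∀ j, N.UpperActive x j → d j ≤ 0)
    (hy : ∀ i, N.yLin d i = 0) (hz : ∀ i, N.zLin d i = 0) (hl : ∀ e, N.lossLin d e = 0)
    (hd : ∀ e, N.dropLin d e = 0) : ∀ᶠ t in 𝓝[>] (0 : ℝ), x + t • d ∈ N.polyhedron := by
  have low : ∀ (j : N.Idx) (c : ℝ), c ≤ x j → (x j = c → 0 ≤ d j) →
      ∀ᶠ t in 𝓝[>] (0 : ℝ), c ≤ (x + t • d) j := by
    intro j c hc h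
    rcases hc.eq_or_lt with e | e
    · filter_upwards [self_mem_nhdsWithin] with t (ht : 0 < t)
      simp only [PiLp.add_apply, PiLp.smul_apply, smul_eq_mul]
      linarith [mul_nonneg ht.le (h e.symm)]
    · have hc : Continuous fun t : ℝ => (x + t • d) j := by
        simp only [PiLp.add_apply, PiLp.smul_apply, smul_eq_mul]; fun_prop
      have := hc.tendsto 0
      simp only [zero_smul, add_zero] at this
      filter_upwards [nhdsWithin_le_nhds (this.eventually (lt_mem_nhds e))] with t ht using ht.le
  have up : ∀ (j : N.Idx) (c : ℝ), x j ≤ c → (x j = c → d j ≤ 0) →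
      ∀ᶠ t in 𝓝[>] (0 : ℝ), (x + t • d) j ≤ c := by
    intro j c hc h
    rcases hc.eq_or_lt with e | e
    · filter_upwards [self_mem_nhdsWithin] with t (ht : 0 < t)
      simp only [PiLp.add_apply, PiLp.smul_apply, smul_eq_mul]
      linarith [mul_nonpos_of_nonneg_of_nonpos ht.le (h e)]
    · have hc : Continuous fun t : ℝ => (x + t • d) j := by
        simp only [PiLp.add_apply, PiLp.smul_apply, smul_eq_mul]; fun_prop
      have := hc.tendsto 0
      simp only [zero_smul, add_zero] at this
      filter_upwards [nhdsWithin_le_nhds (this.eventually (gt_mem_nhds e))] with t ht using ht.le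
  obtain ⟨hS, hx1, hx2, hx3, hx4⟩ := hx
  filter_upwards [eventually_all.2 fun i => low (.pg i) _ (hS.1 i).1 (hlo (.pg i)),
    eventually_all.2 fun i => up (.pg i) _ (hS.1 i).2 (hup (.pg i)),
    eventually_all.2 fun i => low (.v i) _ (hS.2 i).1 (hlo (.v i)),
    eventually_all.2 fun i => up (.v i) _ (hS.2 i).2 (hup (.v i))] with t h1 h2 h3 h4
  refine ⟨⟨fun i => ⟨h1 i, h2 i⟩, fun i => ⟨h3 i, h4 i⟩⟩, fun i => ?_, fun i => ?_, fun e => ?_,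
    fun e => ?_⟩
  · have := yLin_comb x d 1 t i
    rwa [one_smul, hx1, hy, mul_zero, add_zero, one_mul] at this
  · have := zLin_comb x d 1 t i
    rwa [one_smul, hx2, hz, mul_zero, add_zero, one_mul] at this
  · have := lossLin_comb x d 1 t e
    rwa [one_smul, hx3, hl, mul_zero, mul_zero, add_zero] at this
  · have := dropLin_comb x d 1 t e
    rwa [one_smul, hx4, hd, mul_zero, mul_zero, add_zero] at this

lemma nonneg_of_hasDerivAt {φ : ℝ → ℝ} {c : ℝ} (h : HasDerivAt φ c 0)
    (hφ : ∀ᶠ t in 𝓝[>] (0 : ℝ), φ 0 ≤ φ t) : 0 ≤ c := by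
  have h1 := h.tendsto_slope.mono_left (nhdsGT_le_nhdsNE (0 : ℝ))
  refine ge_of_tendsto h1 ?_
  filter_upwards [hφ, self_mem_nhdsWithin] with t ht (ht0 : 0 < t)
  rw [slope_def_field]
  exact div_nonneg (by linarith) (by linarith)

/-- The remaining multipliers, from Farkas' lemma: no qualification is needed for the linear
constraints. -/
lemma exists_linear_multipliers (hf : N.A1) {x : N.State} (hx : x ∈ N.polyhedron) {ρ : N.Arc → ℝ}
    (hρ : ∀ a, ρ a * cone x a = 0)
    (hmin : ∀ y ∈ N.polyhedron, cost x ≤ cost y + ∑ a, ρ a * cone y a) :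
    ∃ (β : N.Idx → ℝ) (s m : Fin n → ℝ) (lam gam : N.Line → ℝ),
      (∀ j, ¬ N.LowerActive x j → β j ≤ 0) ∧ (∀ j, ¬ N.UpperActive x j → 0 ≤ β j) ∧
      ∀ d : N.State, ∑ j, N.lagrangianGrad x ρ j * d j = ∑ j, β j * d j + ∑ i, s i * N.yLin d i
        + ∑ i, m i * N.zLin d i + ∑ e, lam e * N.lossLin d e + ∑ e, gam e * N.dropLin d e := by
  classical
  let p : N.Idx → N.State →ₗ[ℝ] ℝ := fun j => (EuclideanSpace.proj j : N.State →L[ℝ] ℝ).toLinearMap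
  have hp : ∀ j d, p j d = d j := fun j d => rfl
  let ℓ : N.State →ₗ[ℝ] ℝ := ∑ j, N.lagrangianGrad x ρ j • p j
  have hℓ : ∀ d, ℓ d = ∑ j, N.lagrangianGrad x ρ j * d j := fun d => by simp [ℓ, hp]
  let a : N.Idx ⊕ N.Idx → N.State →ₗ[ℝ] ℝ :=
    Sum.elim (fun j => if N.LowerActive x j then p j else 0)
      (fun j => if N.UpperActive x j then -p j else 0)
  let Y : Fin n → N.State →ₗ[ℝ] ℝ := fun i =>
    ⟨⟨fun d => N.yLin d i, fun u v => by simpa using yLin_comb u v 1 1 i⟩,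
      fun r u => by simpa using yLin_comb u 0 r 0 i⟩
  let Z : Fin n → N.State →ₗ[ℝ] ℝ := fun i =>
    ⟨⟨fun d => N.zLin d i, fun u v => by simpa using zLin_comb u v 1 1 i⟩,
      fun r u => by simpa using zLin_comb u 0 r 0 i⟩
  let L : N.Line → N.State →ₗ[ℝ] ℝ := fun e =>
    ⟨⟨fun d => N.lossLin d e, fun u v => by simpa using lossLin_comb u v 1 1 e⟩,
      fun r u => by simpa using lossLin_comb u 0 r 0 e⟩
  let D : N.Line → N.State →ₗ[ℝ] ℝ := fun e =>
    ⟨⟨fun d => N.dropLin d e, fun u v => by simpa using dropLin_comb u v 1 1 e⟩,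
      fun r u => by simpa using dropLin_comb u 0 r 0 e⟩
  let b : Fin n ⊕ (Fin n ⊕ (N.Line ⊕ N.Line)) → N.State →ₗ[ℝ] ℝ :=
    Sum.elim Y (Sum.elim Z (Sum.elim L D))
  obtain ⟨c, c', hc, h⟩ := farkas a b ℓ fun d ha hb => by
    rw [hℓ]
    refine nonneg_of_hasDerivAt (hasDerivAt_lagrangian hf hx.1 ρ d) ?_
    have hev := eventually_mem_polyhedron (d := d) hx
      (fun j hj => by simpa [a, hj, hp] using ha (.inl j))
      (fun j hj => by simpa [a, hj, hp] using ha (.inr j))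
      (fun i => hb (.inl i)) (fun i => hb (.inr (.inl i))) (fun e => hb (.inr (.inr (.inl e))))
      (fun e => hb (.inr (.inr (.inr e))))
    filter_upwards [hev] with t ht
    simp only [zero_smul, add_zero, hρ, Finset.sum_const_zero]
    exact hmin _ ht
  refine ⟨fun j => (if N.LowerActive x j then c (.inl j) else 0)
      - (if N.UpperActive x j then c (.inr j) else 0), fun i => c' (.inl i),
      fun i => c' (.inr (.inl i)),
      fun e => c' (.inr (.inr (.inl e))), fun e => c' (.inr (.inr (.inr e))), fun j hj => ?_,
      fun j hj => ?_, fun d => ?_⟩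
  · simp only [if_neg hj]
    split_ifs
    · linarith [hc (.inr j)]
    · simp
  · simp only [if_neg hj]
    split_ifs
    · linarith [hc (.inl j)]
    · simp
  · rw [← hℓ, h d]
    simp only [Fintype.sum_sum_type, a, b, Sum.elim_inl, Sum.elim_inr]
    have e1 : ∑ j, c (.inl j) * (if N.LowerActive x j then p j else 0) d
        + ∑ j, c (.inr j) * (if N.UpperActive x j then -p j else 0) d
        = ∑ j, ((if N.LowerActive x j then c (.inl j) else 0)
          - (if N.UpperActive x j then c (.inr j) else 0)) * d j := by
      rw [← Finset.sum_add_distrib]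
      refine Finset.sum_congr rfl fun j _ => ?_
      split_ifs <;> simp [hp]
      ring
    rw [e1]
    simp only [Y, Z, L, D, LinearMap.coe_mk, AddHom.coe_mk]
    ring

/-- Under Slater's condition there is an equilibrium with nonnegative multipliers. -/
lemma exists_equilibrium (hpd : ∀ i, 0 < N.pd i) (hf : N.A1) (h4 : N.A4) :
    ∃ x ∈ N.equilibria, ∀ a, 0 ≤ x (.rho a) := by
  classical
  have hslater : ∃ y ∈ N.polyhedron, ∀ a, cone y a < 0 := by
    obtain ⟨q, hq, hlt⟩ := h4
    have h := ((feasible_iff q.toState).1 hq)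
    refine ⟨q.toState, h.1, fun a => ?_⟩
    have h1 := hlt a
    have e : cone q.toState a = q.P a ^ 2 / q.v a.fst - q.l (lineOf a) := by
      have : cone q.toState a = q.P a * (q.P a * (q.v a.fst)⁻¹) - q.l (lineOf a) := rfl
      rw [this]; ring
    rw [e]; linarith
  obtain ⟨x, hx, hcx, hmin⟩ := exists_optimal hpd hf
    (hslater.imp fun y hy => ⟨hy.1, fun a => (hy.2 a).le⟩)
  obtain ⟨ρ, hρ0, hρ, hmin'⟩ := exists_cone_multipliers hf hx hcx hmin hslater
  obtain ⟨β, s, m, lam, gam, hβ1, hβ2, hβ⟩ := exists_linear_multipliers hf hx hρ hmin'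
  -- in `force` the balance equation carries a minus sign: only `μ` keeps the sign of its multiplier
  let w : N.State := WithLp.toLp 2 fun
    | .eps i => -s i
    | .mu i => m i
    | .lam e => -lam e
    | .gam e => -gam e
    | .rho a => ρ a
    | j => x j
  have hS : w ∈ N.S := hx.1
  have hy : ∀ i, N.yLin w i - N.vref i = 0 := fun i => sub_eq_zero.2 (hx.2.1 i)
  have hz : ∀ i, N.zLin w i - N.pd i = 0 := fun i => sub_eq_zero.2 (hx.2.2.1 i)
  have hl : ∀ e, N.lossLin w e = 0 := hx.2.2.2.1
  have hd : ∀ e, N.dropLin w e = 0 := hx.2.2.2.2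
  have hpair : ∀ d : N.State, (∀ a, d (.rho a) = 0) → ∑ j, N.force w j * d j = ∑ j, β j * d j := by
    intro d hdr
    rw [force, sum_field_mul]
    have h1 := hβ d
    rw [sum_lagrangianGrad] at h1
    simp only [hy, hz, hl, hd, hdr, mul_zero, zero_mul, Finset.sum_const_zero, add_zero, sub_zero,
      zero_add, zero_sub]
    have e1 : ∀ i, w (.pg i) = x (.pg i) := fun _ => rfl
    have e2 : ∀ i, w (.v i) = x (.v i) := fun _ => rfl
    have e3 : ∀ i, w (.P i) = x (.P i) := fun _ => rfl
    have e4 : ∀ i, w (.eps i) = -s i := fun _ => rfl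
    have e5 : ∀ i, w (.mu i) = m i := fun _ => rfl
    have e6 : ∀ i, w (.lam i) = -lam i := fun _ => rfl
    have e7 : ∀ i, w (.gam i) = -gam i := fun _ => rfl
    have e8 : ∀ i, w (.rho i) = ρ i := fun _ => rfl
    simp only [e1, e2, e3, e4, e5, e6, e7, e8, neg_mul, Finset.sum_neg_distrib]
    linarith
  have hforce : ∀ j, (∀ a, j ≠ .rho a) → N.force w j = β j := by
    intro j hj
    have := hpair (EuclideanSpace.single j 1) fun a => by
      simp [(hj a).symm]
    simpa using this
  refine ⟨w, (equilibrium_iff w).2 ⟨hS, idx_cases (fun i => ?_) (fun i => ?_) (fun a => ?_)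
    fun j hj => ?_⟩, hρ0⟩
  · rw [vel_pg ⟨w, hS⟩, hforce _ (by simp), sub_eq_zero]
    exact clip_sub_eq (hS.1 i) (hβ1 (.pg i)) (hβ2 (.pg i))
  · rw [vel_v ⟨w, hS⟩, hforce _ (by simp), sub_eq_zero]
    exact clip_sub_eq (hS.2 i) (hβ1 (.v i)) (hβ2 (.v i))
  · have e : -N.force w (.rho a) = cone x a := neg_neg _
    rw [vel_rho ⟨w, hS⟩, e, posProj]
    split_ifs with h
    · rcases h with h | h
      · exact (mul_eq_zero.1 (hρ a)).resolve_left (ne_of_gt h)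
      · exact absurd h (not_lt.2 (hcx a))
    · rfl
  · rw [vel_free ⟨w, hS⟩ _ hj, hforce j (by rintro a rfl; exact hj), neg_eq_zero]
    have n1 : ¬ N.LowerActive x j := by cases j <;> simp [LowerActive, IsFree] at hj ⊢
    have n2 : ¬ N.UpperActive x j := by cases j <;> simp [UpperActive, IsFree] at hj ⊢
    exact le_antisymm (hβ1 j n1) (hβ2 j n2)

end DCNetwork

namespace DCNetwork

variable {n : ℕ} {N : DCNetwork n}

/-! ### Equilibria are optimal, and their conic constraints are active -/

lemma equilibrium_polyhedron {x : N.State} (hx : x ∈ N.equilibria) : x ∈ N.polyhedron := by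
  refine ⟨hx.1, fun i => ?_, fun i => ?_, fun e => ?_, fun e => ?_⟩
  · have h : N.force x (.eps i) = 0 := equilibrium_force_free hx trivial
    simp only [force, field] at h; linarith
  · have h : N.force x (.mu i) = 0 := equilibrium_force_free hx trivial
    simp only [force, field] at h; linarith
  · have h : N.force x (.lam e) = 0 := equilibrium_force_free hx trivial
    simp only [force, field] at h; linarith
  · have h : N.force x (.gam e) = 0 := equilibrium_force_free hx trivial
    simp only [force, field] at h; linarith

lemma force_rho (x : N.State) (a : N.Arc) : N.force x (.rho a) = -cone x a := rfl

lemma equilibrium_cone {x : N.State} (hx : x ∈ N.equilibria) (hr : ∀ a, 0 ≤ x (.rho a))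
    (a : N.Arc) :
    cone x a ≤ 0 ∧ x (.rho a) * cone x a = 0 := by
  have h := ((equilibrium_iff x).1 hx).2 (.rho a)
  rw [vel_rho ⟨x, hx.1⟩, force_rho, neg_neg, posProj] at h
  split_ifs at h with hc
  · rw [h]; simp
  · push Not at hc
    rw [le_antisymm hc.1 (hr a)]
    exact ⟨hc.2, zero_mul _⟩

lemma tangent_le (hf : N.A1) (i : Fin n) (p q : ℝ) :
    deriv (N.f i) p * (q - p) ≤ N.f i q - N.f i p := by
  have hd : DifferentiableAt ℝ (N.f i) p := (hf.2.1 i).differentiable two_ne_zero _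
  rcases lt_trichotomy p q with h | h | h
  · have := (hf.convexOn i).le_slope_of_hasDerivAt (Set.mem_univ p) (Set.mem_univ q) h hd.hasDerivAt
    rw [slope_def_field, le_div_iff₀ (by linarith)] at this
    exact this
  · simp [h]
  · have := (hf.convexOn i).slope_le_of_hasDerivAt (Set.mem_univ q) (Set.mem_univ p) h hd.hasDerivAt
    rw [slope_def_field, div_le_iff₀ (by linarith)] at this
    linarith

/-- The primal part of an equilibrium with nonnegative multipliers is optimal: these are the
Karush-Kuhn-Tucker conditions of a convex problem. -/
lemma isOptimal_of_equilibrium (hf : N.A1) {x : N.State} (hx : x ∈ N.equilibria)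
    (hr : ∀ a, 0 ≤ x (.rho a)) : (State.primal x).IsOptimal := by
  have hpoly := equilibrium_polyhedron hx
  refine ⟨(feasible_iff x).2 ⟨hpoly, fun a => (equilibrium_cone hx hr a).1⟩, fun q hq => ?_⟩
  -- the competitor, with the multipliers of the equilibrium
  let w : N.State := WithLp.toLp 2 fun
    | .pg i => q.p i
    | .v i => q.v i
    | .P a => q.P a
    | .l e => q.l e
    | .phat i => q.phat i
    | j => x j
  have hw := (feasible_iff w).1 hq
  obtain ⟨⟨hS, hy, hz, hl, hd⟩, hc⟩ := hw
  have e0 : q.objective = cost w := objective_eq_cost (x := w) ⟨hS, hy, hz, hl, hd⟩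
  rw [objective_eq_cost hpoly, e0]
  have hvi : 0 ≤ ∑ j, N.force x j * (w j - x j) := Finset.sum_nonneg fun j _ =>
    equilibrium_variational hx hS hr hr j
  have e1 : ∀ i, w (.mu i) - x (.mu i) = 0 := fun _ => sub_self _
  have e2 : ∀ i, w (.eps i) - x (.eps i) = 0 := fun _ => sub_self _
  have e3 : ∀ i, w (.lam i) - x (.lam i) = 0 := fun _ => sub_self _
  have e4 : ∀ i, w (.gam i) - x (.gam i) = 0 := fun _ => sub_self _
  have e5 : ∀ i, w (.rho i) - x (.rho i) = 0 := fun _ => sub_self _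
  rw [force, sum_field_mul (d := fun j => w j - x j)] at hvi
  simp only [yLin_sub, zLin_sub, lossLin_sub, dropLin_sub, hy, hz, hl, hd, hpoly.2.1, hpoly.2.2.1,
    hpoly.2.2.2.1, hpoly.2.2.2.2, e1, e2, e3, e4, e5, sub_self, mul_zero, Finset.sum_const_zero,
    add_zero, sub_zero] at hvi
  have h1 : ∑ i, deriv (N.f i) (x (.pg i)) * (w (.pg i) - x (.pg i)) ≤ cost w - cost x := by
    rw [cost, cost, ← Finset.sum_sub_distrib]
    exact Finset.sum_le_sum fun i _ => tangent_le hf i _ _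
  have h2 : ∑ a : N.Arc, (-(x (.rho a) * ((x (.P a) * (x (.v a.fst))⁻¹)
        * (x (.P a) * (x (.v a.fst))⁻¹)) * (w (.v a.fst) - x (.v a.fst)))
      + 2 * (x (.rho a) * (x (.P a) * (x (.v a.fst))⁻¹)) * (w (.P a) - x (.P a))
      - x (.rho a) * (w (.l (lineOf a)) - x (.l (lineOf a)))) ≤ 0 := by
    refine Finset.sum_nonpos fun a _ => ?_
    have hv := v_pos hx.1 a.fst
    have hw := v_pos hS a.fst
    have hra := hr a
    have hca := hc a
    have hxa := (equilibrium_cone hx hr a).2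
    unfold cone at hca hxa
    generalize x (.v a.fst) = v at *
    generalize w (.v a.fst) = v' at *
    generalize w (.P a) = P' at *
    generalize x (.P a) = P at *
    generalize x (.rho a) = ρ at *
    -- convexity of `P² / v`, as a perfect square
    have h3 : P' * (P' * v'⁻¹) - P * (P * v⁻¹)
        - (2 * (P * v⁻¹) * (P' - P) - (P * v⁻¹) * (P * v⁻¹) * (v' - v))
        = v'⁻¹ * (P' - P * v⁻¹ * v') ^ 2 := by field_simp; ring
    have h4 : 0 ≤ v'⁻¹ * (P' - P * v⁻¹ * v') ^ 2 := by positivity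
    have h5 := mul_nonneg hra h4
    have h6 := mul_nonpos_of_nonneg_of_nonpos hra hca
    rw [← h3] at h5
    linarith
  linarith

/-- Marginal costs are positive: the cost increases to the left of `0`, and is strictly convex. -/
lemma A1.deriv_pos (hf : N.A1) (hpd : ∀ i, 0 < N.pd i) (i : Fin n) {p : ℝ} (hp : 0 ≤ p) :
    0 < deriv (N.f i) p := by
  have hmono : StrictMono (deriv (N.f i)) := by
    obtain ⟨-, h2, α, hα, hff⟩ := hf
    exact strictMono_of_deriv_pos fun p => hα.trans_le (hff i p)
  refine lt_of_le_of_lt ?_ (hmono (show -(N.pd i / 2) < p by linarith [hpd i]))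
  have hd : DifferentiableAt ℝ (N.f i) (-(N.pd i / 2)) := (hf.2.1 i).differentiable two_ne_zero _
  have hm := (hf.1 i).monotoneOn
  have hnhds : Set.Ici (-N.pd i) ∈ 𝓝 (-(N.pd i / 2)) := Ici_mem_nhds (by linarith [hpd i])
  rw [← hd.hasDerivAt.hasDerivWithinAt.derivWithin (uniqueDiffWithinAt_of_mem_nhds hnhds)]
  exact hm.derivWithin_nonneg

section Exactness

variable {x : N.State}

lemma drop_arc (hx : x ∈ N.polyhedron) (a : N.Arc) :
    x (.v a.fst) - x (.v a.snd) = N.res a * (x (.P a) - x (.P a.symm)) := by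
  revert a
  refine arc_cases fun e => ?_
  have h := hx.2.2.2.2 e
  simp only [dropLin] at h
  refine ⟨by linarith, ?_⟩
  rw [res_symm, SimpleGraph.Dart.symm_symm]
  simp only [SimpleGraph.Dart.symm_toProd, Prod.fst_swap, Prod.snd_swap]
  linarith

lemma loss_arc (hx : x ∈ N.polyhedron) (a : N.Arc) :
    x (.P a) + x (.P a.symm) = N.res a * x (.l (lineOf a)) := by
  revert a
  refine arc_cases fun e => ?_
  have h := hx.2.2.2.1 e
  simp only [lossLin] at h
  rw [res_symm, SimpleGraph.Dart.symm_symm, lineOf_line, lineOf_line_symm]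
  exact ⟨by linarith, by linarith⟩

/-- In terms of `W = v - r P`, the conic constraint of a line reads `W² ≤ v w`. -/
lemma sq_prod_le (hx : x ∈ N.polyhedron) (hc : ∀ a, cone x a ≤ 0) (a : N.Arc) :
    (x (.v a.fst) - N.res a * x (.P a)) ^ 2 ≤ x (.v a.fst) * x (.v a.snd) := by
  have h1 := drop_arc hx a
  have h2 := loss_arc hx a
  have h3 := (cone_nonpos_iff hx.1 a).1 (hc a)
  have h4 := mul_le_mul_of_nonneg_left h3 (sq_nonneg (N.res a))
  have e1 : x (.v a.snd) = x (.v a.fst) - N.res a * (x (.P a) - x (.P a.symm)) := by linarith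
  have e2 : N.res a ^ 2 * (x (.l (lineOf a)) * x (.v a.fst))
      = N.res a * (x (.P a) + x (.P a.symm)) * x (.v a.fst) := by rw [h2]; ring
  rw [e1]
  nlinarith

/-- A node that does not generate is not at the common upper voltage limit, since power has to flow
into it. -/
lemma volt_lt_of_gen_eq_zero (hVmax : ∀ i j, N.Vmax i = N.Vmax j) (hpd : ∀ i, 0 < N.pd i)
    (hx : x ∈ N.polyhedron) (hc : ∀ a, cone x a ≤ 0) {i : Fin n} (hp : x (.pg i) = 0) :
    x (.v i) < N.Vmax i ^ 2 := by
  refine (hx.1.2 i).2.lt_of_ne fun hv => ?_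
  have h1 := hx.2.2.1 i
  have h2 : 0 ≤ ∑ a : N.Arc with a.fst = i, x (.P a) := by
    refine Finset.sum_nonneg fun a ha => ?_
    have hai : a.fst = i := (Finset.mem_filter.1 ha).2
    have h3 := sq_prod_le hx hc a
    have h4 : x (.v a.snd) ≤ x (.v a.fst) := by
      rw [hai, hv, hVmax i a.snd]; exact (hx.1.2 _).2
    have h5 := v_pos hx.1 a.fst
    have h6 : x (.v a.fst) - N.res a * x (.P a) ≤ x (.v a.fst) := by
      refine abs_le_of_sq_le_sq' (h3.trans ?_) h5.le |>.2
      rw [sq]; exact mul_le_mul_of_nonneg_left h4 h5.le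
    have h7 : 0 ≤ N.res a * x (.P a) := by linarith
    exact nonneg_of_mul_nonneg_right h7 (res_pos a)
  simp only [zLin, hp] at h1
  linarith [hpd i]

lemma equilibrium_eps (hx : x ∈ N.equilibria) (i : Fin n) :
    N.yLin x i - N.vref i + x (.eps i) = 0 := by
  have h : N.force x (.phat i) = 0 := equilibrium_force_free hx trivial
  simp only [force, field] at h
  exact (mul_eq_zero.1 h).resolve_left (neg_ne_zero.2 (N.k_pos i).ne')

/-- A node that generates has a positive price `μ`. -/
lemma gen_pos_imp (hf : N.A1) (hpd : ∀ i, 0 < N.pd i) (hx : x ∈ N.equilibria) {i : Fin n}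
    (hp : x (.pg i) ≠ 0) : 0 < x (.mu i) := by
  have hp0 : 0 < x (.pg i) := (hx.1.1 i).1.lt_of_ne' hp
  have h := ((equilibrium_iff x).1 hx).2 (.pg i)
  rw [vel_pg ⟨x, hx.1⟩] at h
  have hv := clip_variational (x (.pg i) - N.force x (.pg i))
    (⟨le_rfl, (hx.1.1 i).1.trans (hx.1.1 i).2⟩ : (0 : ℝ) ≤ 0 ∧ 0 ≤ N.pmax i)
  rw [sub_eq_zero.1 h, sub_zero] at hv
  have hF : N.force x (.pg i) ≤ 0 := by
    by_contra hcon
    push Not at hcon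
    nlinarith [mul_pos hcon hp0]
  have hz := (equilibrium_polyhedron hx).2.2.1 i
  simp only [force, field, equilibrium_eps hx, hz] at hF
  linarith [hf.deriv_pos hpd i (hx.1.1 i).1]

lemma equilibrium_P (hx : x ∈ N.equilibria) (a : N.Arc) :
    x (.mu a.fst) + x (.lam (lineOf a)) - sgn a * x (.gam (lineOf a)) * N.res a
      + 2 * (x (.rho a) * (x (.P a) * (x (.v a.fst))⁻¹)) = 0 := by
  have h : N.force x (.P a) = 0 := equilibrium_force_free hx trivial
  simp only [force, field, (equilibrium_polyhedron hx).2.2.1] at h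
  linarith

lemma equilibrium_l (hx : x ∈ N.equilibria) (a : N.Arc) :
    x (.lam (lineOf a)) * N.res a = -(x (.rho a) + x (.rho a.symm)) := by
  revert a
  refine arc_cases fun e => ?_
  have h : N.force x (.l e) = 0 := equilibrium_force_free hx trivial
  simp only [force, field] at h
  rw [res_symm, SimpleGraph.Dart.symm_symm, lineOf_line, lineOf_line_symm]
  exact ⟨by linarith, by linarith⟩

/-- A node with a nonpositive price `μ` has price `0` and carries no conic multipliers. -/
lemma price_nonpos (hVmax : ∀ i j, N.Vmax i = N.Vmax j) (hpd : ∀ i, 0 < N.pd i) (hf : N.A1)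
    (hx : x ∈ N.equilibria) (hr : ∀ a, 0 ≤ x (.rho a)) {i : Fin n} (hi : x (.mu i) ≤ 0)
    {a : N.Arc} (ha : a.fst = i) :
    x (.mu i) = 0 ∧ x (.rho a) * ((N.res a)⁻¹ - x (.P a) * (x (.v a.fst))⁻¹) = 0 ∧
      x (.rho a.symm) = 0 := by
  have hpoly := equilibrium_polyhedron hx
  have hp : x (.pg i) = 0 := by
    by_contra hcon
    exact absurd (gen_pos_imp hf hpd hx hcon) (not_lt.2 hi)
  have hv := volt_lt_of_gen_eq_zero hVmax hpd hpoly (fun a => (equilibrium_cone hx hr a).1) hp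
  have hF : 0 ≤ N.force x (.v i) := by
    have h := ((equilibrium_iff x).1 hx).2 (.v i)
    rw [vel_v ⟨x, hx.1⟩] at h
    have hc := clip_variational (x (.v i) - N.force x (.v i))
      (⟨(hx.1.2 i).1.trans (hx.1.2 i).2, le_rfl⟩ :
        N.Vmin i ^ 2 ≤ N.Vmax i ^ 2 ∧ N.Vmax i ^ 2 ≤ N.Vmax i ^ 2)
    rw [sub_eq_zero.1 h] at hc
    by_contra hcon
    push Not at hcon
    nlinarith [mul_pos (neg_pos.2 hcon) (sub_pos.2 hv)]
  -- the voltage equation at `i`, with `γ` and `λ` eliminated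
  have hterm : ∀ b : N.Arc, b.fst = i → sgn b * x (.gam (lineOf b))
      - x (.rho b) * ((x (.P b) * (x (.v b.fst))⁻¹) * (x (.P b) * (x (.v b.fst))⁻¹))
      = x (.mu i) * (N.res b)⁻¹
        - (x (.rho b) * ((N.res b)⁻¹ - x (.P b) * (x (.v b.fst))⁻¹) ^ 2
          + x (.rho b.symm) * (N.res b)⁻¹ ^ 2) := by
    intro b hb
    have h1 := equilibrium_P hx b
    have h2 := equilibrium_l hx b
    rw [hb] at h1 ⊢
    have hrb := (res_pos b).ne'
    generalize x (.P b) * (x (.v i))⁻¹ = u at *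
    have h3 : x (.lam (lineOf b)) = -(x (.rho b) + x (.rho b.symm)) * (N.res b)⁻¹ := by
      rw [← h2]; field_simp
    have h4 : sgn b * x (.gam (lineOf b)) = (x (.mu i) + x (.lam (lineOf b))
        + 2 * (x (.rho b) * u)) * (N.res b)⁻¹ := by
      field_simp; linarith
    rw [h4, h3]; ring
  have hnonpos : ∀ b : N.Arc, b.fst = i → sgn b * x (.gam (lineOf b))
      - x (.rho b) * ((x (.P b) * (x (.v b.fst))⁻¹) * (x (.P b) * (x (.v b.fst))⁻¹)) ≤ 0 := by
    intro b hb
    rw [hterm b hb]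
    have h1 := mul_nonpos_of_nonpos_of_nonneg hi (inv_nonneg.2 (res_pos b).le)
    have h2 := mul_nonneg (hr b) (sq_nonneg ((N.res b)⁻¹ - x (.P b) * (x (.v b.fst))⁻¹))
    have h3 := mul_nonneg (hr b.symm) (sq_nonneg (N.res b)⁻¹)
    linarith
  have hsum : 0 ≤ ∑ b : N.Arc with b.fst = i, (sgn b * x (.gam (lineOf b))
      - x (.rho b) * ((x (.P b) * (x (.v b.fst))⁻¹) * (x (.P b) * (x (.v b.fst))⁻¹))) := by
    simp only [force, field, equilibrium_eps hx, zero_add] at hF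
    rwa [Finset.sum_sub_distrib]
  have hz := (Finset.sum_eq_zero_iff_of_nonpos fun b hb =>
    hnonpos b (Finset.mem_filter.1 hb).2).1 (le_antisymm (Finset.sum_nonpos fun b hb =>
    hnonpos b (Finset.mem_filter.1 hb).2) hsum) a (by simp [ha])
  rw [hterm a ha] at hz
  have hri := inv_pos.2 (res_pos a)
  have h1 := mul_nonpos_of_nonpos_of_nonneg hi hri.le
  have h2 := mul_nonneg (hr a) (sq_nonneg ((N.res a)⁻¹ - x (.P a) * (x (.v a.fst))⁻¹))
  have h3 := mul_nonneg (hr a.symm) (sq_nonneg (N.res a)⁻¹)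
  refine ⟨(mul_eq_zero.1 (by linarith : x (.mu i) * (N.res a)⁻¹ = 0)).resolve_right hri.ne', ?_,
    (mul_eq_zero.1 (by linarith : x (.rho a.symm) * (N.res a)⁻¹ ^ 2 = 0)).resolve_right
      (pow_pos hri 2).ne'⟩
  rcases mul_eq_zero.1 (by linarith : x (.rho a)
    * ((N.res a)⁻¹ - x (.P a) * (x (.v a.fst))⁻¹) ^ 2 = 0) with h | h
  · rw [h, zero_mul]
  · rw [pow_eq_zero_iff two_ne_zero |>.1 h, mul_zero]

/-- The sum of the stationarity conditions for the two flows of a line. -/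
lemma price_add (hx : x ∈ N.equilibria) (a : N.Arc) : x (.mu a.fst) + x (.mu a.snd)
    = 2 * (x (.rho a) * ((N.res a)⁻¹ - x (.P a) * (x (.v a.fst))⁻¹))
      + 2 * (x (.rho a.symm) * ((N.res a)⁻¹ - x (.P a.symm) * (x (.v a.snd))⁻¹)) := by
  have h1 := equilibrium_P hx a
  have h2 := equilibrium_P hx a.symm
  have h3 := equilibrium_l hx a
  rw [lineOf_symm, res_symm, sgn_symm] at h2
  simp only [SimpleGraph.Dart.symm_toProd, Prod.fst_swap] at h2
  have hr := (res_pos a).ne'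
  have h4 : x (.lam (lineOf a)) = -(x (.rho a) + x (.rho a.symm)) * (N.res a)⁻¹ := by
    rw [← h3]; field_simp
  rw [h4] at h1 h2
  linarith

/-- All prices are positive: a nonpositive price at one node would spread to all nodes, none of
which would then generate, but the loads have to be served. -/
lemma price_pos (hVmax : ∀ i j, N.Vmax i = N.Vmax j) (hpd : ∀ i, 0 < N.pd i) (hf : N.A1)
    (hx : x ∈ N.equilibria) (hr : ∀ a, 0 ≤ x (.rho a)) (i : Fin n) : 0 < x (.mu i) := by
  by_contra hcon
  push Not at hcon
  have hpoly := equilibrium_polyhedron hx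
  -- a nonpositive price spreads along the lines
  have hwalk : ∀ {j k : Fin n}, N.G.Walk j k → x (.mu j) ≤ 0 → x (.mu k) ≤ 0 := by
    intro j k w
    induction w with
    | nil => exact id
    | @cons j j' k hadj w ih =>
      intro hj
      refine ih ?_
      let a : N.Arc := ⟨(j, j'), hadj⟩
      obtain ⟨h1, h2, h3⟩ := price_nonpos hVmax hpd hf hx hr hj (a := a) rfl
      have h4 : x (.mu j) + x (.mu j') = _ := price_add hx a
      rw [h2, h3] at h4
      linarith
  have hall : ∀ j, x (.pg j) = 0 := by
    intro j
    by_contra hj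
    obtain ⟨w⟩ := N.connected.preconnected i j
    exact absurd (gen_pos_imp hf hpd hx hj) (not_lt.2 (hwalk w hcon))
  have h1 := sum_flow hpoly.2.2.2.1 hpoly.2.2.1
  have h2 : 0 ≤ ∑ e : N.Line, N.res e.1 * x (.l e) := Finset.sum_nonneg fun e _ =>
    mul_nonneg (res_pos _).le
      (current_nonneg hpoly.1 (fun a => (equilibrium_cone hx hr a).1) e)
  have h3 : ∑ j, (x (.pg j) - N.pd j) < 0 := by
    refine Finset.sum_neg (fun j _ => ?_) ⟨i, Finset.mem_univ i⟩
    rw [hall j]; linarith [hpd j]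
  linarith

/-- Each line carries a positive conic multiplier. This is the dual form of the exactness of the
conic relaxation, and it makes one of the two flows of the line settle. -/
lemma exists_rho_pos (hVmax : ∀ i j, N.Vmax i = N.Vmax j) (hpd : ∀ i, 0 < N.pd i) (hf : N.A1)
    (hx : x ∈ N.equilibria) (hr : ∀ a, 0 ≤ x (.rho a)) (a : N.Arc) :
    0 < x (.rho a) ∨ 0 < x (.rho a.symm) := by
  by_contra! hcon
  have h := price_add hx a
  rw [le_antisymm hcon.1 (hr a), le_antisymm hcon.2 (hr _)] at h
  linarith [price_pos hVmax hpd hf hx hr a.fst, price_pos hVmax hpd hf hx hr a.snd]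

end Exactness

end DCNetwork

/-! ### Regularity of trajectories -/

/-- A relation between functions of time and their derivatives that respects constants, sums and
products. -/
structure DerivClosed (R : (ℝ → ℝ) → (ℝ → ℝ) → Prop) : Prop where
  const : ∀ c : ℝ, R (fun _ => c) (fun _ => 0)
  add : ∀ {A a B b : ℝ → ℝ}, R A a → R B b → R (fun t => A t + B t) (fun t => a t + b t)
  mul : ∀ {A a B b : ℝ → ℝ}, R A a → R B b → R (fun t => A t * B t) (fun t => a t * B t + A t * b t)

namespace DerivClosed

variable {R : (ℝ → ℝ) → (ℝ → ℝ) → Prop} {A a B b : ℝ → ℝ}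

lemma const_mul (hR : DerivClosed R) (c : ℝ) (h : R A a) :
    R (fun t => c * A t) (fun t => c * a t) := by
  simpa using hR.mul (hR.const c) h

lemma neg (hR : DerivClosed R) (h : R A a) : R (fun t => -A t) (fun t => -a t) := by
  simpa using hR.const_mul (-1) h

lemma sub (hR : DerivClosed R) (h : R A a) (h' : R B b) :
    R (fun t => A t - B t) (fun t => a t - b t) := by
  simpa [sub_eq_add_neg] using hR.add h (hR.neg h')

lemma sum (hR : DerivClosed R) {ι : Type*} (s : Finset ι) {A a : ι → ℝ → ℝ}
    (h : ∀ i ∈ s, R (A i) (a i)) : R (fun t => ∑ i ∈ s, A i t) (fun t => ∑ i ∈ s, a i t) := by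
  classical
  induction s using Finset.induction_on with
  | empty => simpa using hR.const 0
  | insert i s hi ih =>
    simp only [Finset.sum_insert hi]
    exact hR.add (h i (by simp)) (ih fun j hj => h j (by simp [hj]))

lemma congr (h : R A a) (hA : ∀ t, A t = B t) (ha : ∀ t, a t = b t) : R B b := by
  rwa [← funext hA, ← funext ha]

lemma lipDeriv : DerivClosed LipDeriv := ⟨LipDeriv.const, LipDeriv.add, LipDeriv.mul⟩

lemma bddDeriv : DerivClosed BddDeriv := ⟨BddDeriv.const, BddDeriv.add, BddDeriv.mul⟩

lemma continuousOn (I : Set ℝ) : DerivClosed fun A _ => ContinuousOn A I :=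
  ⟨fun _ => continuousOn_const, ContinuousOn.add, ContinuousOn.mul⟩

lemma bounded (I : Set ℝ) : DerivClosed fun A _ => ∃ C, ∀ t ∈ I, |A t| ≤ C := by
  refine ⟨fun c => ⟨|c|, fun _ _ => le_rfl⟩, ?_, ?_⟩
  · rintro A a B b ⟨C, hC⟩ ⟨D, hD⟩
    exact ⟨C + D, fun t ht => (abs_add_le _ _).trans (add_le_add (hC t ht) (hD t ht))⟩
  · rintro A a B b ⟨C, hC⟩ ⟨D, hD⟩
    refine ⟨C * D, fun t ht => ?_⟩
    rw [abs_mul]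
    exact mul_le_mul (hC t ht) (hD t ht) (abs_nonneg _) ((abs_nonneg _).trans (hC t ht))

end DerivClosed

/-- An upper bound that the velocity never pushes through is preserved. -/
lemma le_of_velocity_nonpos {u w : ℝ → ℝ} {b : ℝ}
    (hw : ∀ t, 0 ≤ t → IntervalIntegrable w volume 0 t ∧ u t = u 0 + ∫ s in (0 : ℝ)..t, w s)
    (h0 : u 0 ≤ b) (hb : ∀ t, 0 ≤ t → b < u t → w t ≤ 0) {T : ℝ} (hT : 0 ≤ T) : u T ≤ b := by
  by_contra! hcon
  have hcont : ContinuousOn u (Set.Icc 0 T) := by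
    have h1 := intervalIntegral.continuousOn_primitive_interval' (hw T hT).1 (Set.left_mem_uIcc)
    rw [Set.uIcc_of_le hT] at h1
    exact (continuousOn_const.add h1).congr fun t ht => (hw t ht.1).2
  have hcomp : IsCompact (Set.Icc 0 T ∩ u ⁻¹' Set.Iic b) :=
    isCompact_Icc.of_isClosed_subset (hcont.preimage_isClosed_of_isClosed isClosed_Icc isClosed_Iic)
      Set.inter_subset_left
  obtain ⟨s, ⟨hs1, hs2⟩, hmax⟩ := hcomp.exists_isGreatest ⟨0, ⟨le_rfl, hT⟩, h0⟩
  have hs2' : u s ≤ b := hs2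
  have e : u T - u s = ∫ t in s..T, w t := by
    rw [(hw T hT).2, (hw s hs1.1).2, ← intervalIntegral.integral_interval_sub_left (hw T hT).1
        (hw s hs1.1).1]
    ring
  have hle : ∫ t in s..T, w t ≤ 0 := by
    rw [intervalIntegral.integral_of_le hs1.2]
    refine setIntegral_nonpos measurableSet_Ioc fun t ht => ?_
    refine hb t (hs1.1.trans ht.1.le) ?_
    by_contra! hc
    exact absurd (hmax ⟨⟨hs1.1.trans ht.1.le, ht.2⟩, hc⟩) (not_le.2 ht.1)
  linarith

namespace DCNetwork

variable {n : ℕ} {N : DCNetwork n}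

variable (N) in
/-- The derivative of `force` along a motion through `x` with velocity `κ`. -/
noncomputable def forceDeriv (x : N.State) (κ : N.Idx → ℝ) : N.Idx → ℝ :=
  let u := fun a : N.Arc => x (.P a) * (x (.v a.fst))⁻¹
  let u' := fun a : N.Arc =>
    κ (.P a) * (x (.v a.fst))⁻¹ + x (.P a) * (-((x (.v a.fst))⁻¹ ^ 2) * κ (.v a.fst))
  N.field (fun i => deriv (deriv (N.f i)) (x (.pg i)) * κ (.pg i))
    (fun i => N.yLin κ i + κ (.eps i)) (fun i => N.zLin κ i - κ (.mu i)) (N.zLin κ) (N.yLin κ)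
    (fun e => κ (.lam e)) (fun e => κ (.gam e)) (N.lossLin κ) (N.dropLin κ) (fun a => κ (.rho a))
    (fun a => κ (.rho a) * (u a * u a) + x (.rho a) * (u' a * u a + u a * u' a))
    (fun a => 2 * (κ (.rho a) * u a + x (.rho a) * u' a))
    (fun a => κ (.P a) * u a + x (.P a) * u' a - κ (.l (lineOf a)))

section Closed

variable {R : (ℝ → ℝ) → (ℝ → ℝ) → Prop}

lemma field_closed (hR : DerivClosed R) {G G' s s' m m' z z' y y' : ℝ → Fin n → ℝ}
    {lam lam' gam gam' loss loss' drop drop' : ℝ → N.Line → ℝ}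
        {rho rho' c c' e e' g g' : ℝ → N.Arc → ℝ}
    (hG : ∀ i, R (fun t => G t i) (fun t => G' t i))
    (hs : ∀ i, R (fun t => s t i) (fun t => s' t i))
    (hm : ∀ i, R (fun t => m t i) (fun t => m' t i))
    (hz : ∀ i, R (fun t => z t i) (fun t => z' t i))
    (hy : ∀ i, R (fun t => y t i) (fun t => y' t i))
    (hlam : ∀ i, R (fun t => lam t i) (fun t => lam' t i))
    (hgam : ∀ i, R (fun t => gam t i) (fun t => gam' t i))
    (hloss : ∀ i, R (fun t => loss t i) (fun t => loss' t i))
    (hdrop : ∀ i, R (fun t => drop t i) (fun t => drop' t i))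
    (hrho : ∀ i, R (fun t => rho t i) (fun t => rho' t i))
    (hc : ∀ i, R (fun t => c t i) (fun t => c' t i))
    (he : ∀ i, R (fun t => e t i) (fun t => e' t i))
    (hg : ∀ i, R (fun t => g t i) (fun t => g' t i)) (j : N.Idx) :
    R (fun t => N.field (G t) (s t) (m t) (z t) (y t) (lam t) (gam t) (loss t) (drop t) (rho t)
        (c t)
        (e t) (g t) j)
      (fun t => N.field (G' t) (s' t) (m' t) (z' t) (y' t) (lam' t) (gam' t) (loss' t) (drop' t)
        (rho' t) (c' t) (e' t) (g' t) j) := by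
  cases j with
  | pg i => exact hR.add (hR.add (hG i) (hR.const_mul _ (hs i))) (hm i)
  | v i =>
    exact hR.sub (hR.add (hs i) (hR.sum _ fun a _ => hR.const_mul _ (hgam _)))
        (hR.sum _ fun a _ => hc a)
  | P a =>
    refine DerivClosed.congr (hR.sub (hR.add (hR.sub (hlam (lineOf a))
      (hR.const_mul (sgn a * N.res a) (hgam (lineOf a)))) (he a)) (hm a.fst)) ?_ ?_ <;>
      (intro t; simp only [field]; ring)
  | l e =>
    refine DerivClosed.congr (hR.sub (hR.sub (hR.const_mul (-N.res e.1) (hlam e)) (hrho e.1))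
      (hrho e.1.symm)) ?_ ?_ <;> (intro t; simp only [field]; ring)
  | phat i => exact hR.const_mul _ (hs i)
  | mu i => exact hz i
  | eps i => exact hR.neg (hy i)
  | lam e => exact hR.neg (hloss e)
  | gam e => exact hR.neg (hdrop e)
  | rho a => exact hR.neg (hg a)

variable {x : ℝ → N.State} {κ : ℝ → N.Idx → ℝ}

lemma yLin_closed (hR : DerivClosed R) (hx : ∀ j, R (fun t => x t j) (fun t => κ t j)) (i : Fin n) :
    R (fun t => N.yLin (x t) i) (fun t => N.yLin (κ t) i) :=
  hR.sub (hR.add (hx _) (hR.const_mul _ (hx _))) (hR.const_mul _ (hx _))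

lemma zLin_closed (hR : DerivClosed R) (hx : ∀ j, R (fun t => x t j) (fun t => κ t j)) (i : Fin n) :
    R (fun t => N.zLin (x t) i) (fun t => N.zLin (κ t) i) :=
  hR.sub (hx _) (hR.sum _ fun _ _ => hx _)

lemma sub_const_closed {A a : ℝ → ℝ} (hR : DerivClosed R) (h : R A a) (c : ℝ) :
    R (fun t => A t - c) a := by
  simpa using hR.sub h (hR.const c)

/-- The dynamics of the force along any motion; the relation `R` is used for the chain rule as well
as for continuity and boundedness. -/
lemma force_closed (hR : DerivClosed R) (hx : ∀ j, R (fun t => x t j) (fun t => κ t j))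
    (hv : ∀ i, R (fun t => (x t (.v i))⁻¹) (fun t => -((x t (.v i))⁻¹ ^ 2) * κ t (.v i)))
    (hG : ∀ i, R (fun t => deriv (N.f i) (x t (.pg i)))
      (fun t => deriv (deriv (N.f i)) (x t (.pg i)) * κ t (.pg i))) (j : N.Idx) :
    R (fun t => N.force (x t) j) (fun t => N.forceDeriv (x t) (κ t) j) := by
  have hu : ∀ a : N.Arc, R (fun t => x t (.P a) * (x t (.v a.fst))⁻¹) _ := fun a =>
    hR.mul (hx (.P a)) (hv a.fst)
  refine field_closed hR hG
    (fun i => hR.add (sub_const_closed hR (yLin_closed hR hx i) _) (hx _))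
    (fun i => hR.sub (sub_const_closed hR (zLin_closed hR hx i) _) (hx _))
    (fun i => sub_const_closed hR (zLin_closed hR hx i) _)
    (fun i => sub_const_closed hR (yLin_closed hR hx i) _)
    (fun e => hx _) (fun e => hx _)
    (fun e => hR.sub (hR.add (hx _) (hx _)) (hR.const_mul _ (hx _)))
    (fun e => hR.sub (hR.sub (hx _) (hx _)) (hR.const_mul _ (hR.sub (hx _) (hx _))))
    (fun a => hx _) (fun a => hR.mul (hx _) (hR.mul (hu a) (hu a)))
    (fun a => hR.const_mul _ (hR.mul (hx _) (hu a)))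
    (fun a => hR.sub (hR.mul (hx _) (hu a)) (hx _)) j

end Closed

/-- The quadratic form of the derivative of the force: again the saddle structure cancels the
coupling of primal variables and multipliers. -/
lemma sum_forceDeriv (x : N.State) (hx : x ∈ N.S) (hr : ∀ a, 0 ≤ x (.rho a)) {α : ℝ}
    (hα : ∀ i p, α ≤ deriv (deriv (N.f i)) p) (κ : N.Idx → ℝ) :
    α * ∑ i, κ (.pg i) ^ 2 + ∑ i, N.yLin κ i ^ 2 + ∑ i, N.zLin κ i ^ 2
      ≤ ∑ j, N.forceDeriv x κ j * κ j := by
  rw [forceDeriv]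
  simp only
  rw [sum_field_self]
  have h1 : α * ∑ i, κ (.pg i) ^ 2
      ≤ ∑ i, deriv (deriv (N.f i)) (x (.pg i)) * κ (.pg i) * κ (.pg i) := by
    rw [Finset.mul_sum]
    refine Finset.sum_le_sum fun i _ => ?_
    rw [mul_assoc, ← sq]
    exact mul_le_mul_of_nonneg_right (hα i _) (sq_nonneg _)
  refine le_trans (le_of_eq (add_zero _).symm) (add_le_add (by linarith)
      (Finset.sum_nonneg fun a _ => ?_))
  have hv := v_pos hx a.fst
  have hra := hr a
  generalize x (.v a.fst) = v at *
  have h2 : 0 ≤ 2 * x (.rho a) * (v⁻¹ * (κ (.P a) - x (.P a) * v⁻¹ * κ (.v a.fst)) ^ 2) := by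
    positivity
  refine h2.trans (le_of_eq ?_)
  field_simp
  ring

section Trajectory

variable {x : ℝ → N.State}

lemma IsTrajectory.coord (hx : N.IsTrajectory x) (j : N.Idx) (t : ℝ) (ht : 0 ≤ t) :
    IntervalIntegrable (fun s => N.vel (x s) j) volume 0 t ∧
      x t j = x 0 j + ∫ s in (0 : ℝ)..t, N.vel (x s) j := by
  obtain ⟨h1, h2⟩ := hx t ht
  let p : N.State →L[ℝ] ℝ := EuclideanSpace.proj j
  have e : ∀ s, N.vel (x s) j = p (N.H (x s) - x s) := fun s => rfl
  simp only [e]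
  refine ⟨⟨p.integrable_comp h1.1, p.integrable_comp h1.2⟩, ?_⟩
  rw [p.intervalIntegral_comp_comm h1]
  conv_lhs => rw [h2]
  rfl

variable (hx : N.IsTrajectory x) (h0 : x 0 ∈ N.S) (hr : ∀ a : N.Arc, 0 ≤ x 0 (.rho a))

include hx h0 in
lemma IsTrajectory.mem_S {t : ℝ} (ht : 0 ≤ t) : x t ∈ N.S := by
  have hS : N.S.Nonempty := ⟨_, h0⟩
  have up : ∀ (j : N.Idx) (b : ℝ), x 0 j ≤ b → (∀ y, N.vel y j ≤ b - y j) → x t j ≤ b :=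
    fun j b hb hv => le_of_velocity_nonpos (u := fun t => x t j) (hx.coord j) hb
      (fun s _ hs => by linarith [hv (x s)]) ht
  have low : ∀ (j : N.Idx) (b : ℝ), b ≤ x 0 j → (∀ y, b - y j ≤ N.vel y j) → b ≤ x t j := by
    intro j b hb hv
    have := le_of_velocity_nonpos (u := fun t => -x t j) (w := fun t => -N.vel (x t) j) (b := -b)
      (fun s hs => ⟨(hx.coord j s hs).1.neg, by
        rw [(hx.coord j s hs).2, intervalIntegral.integral_neg]; ring⟩) (by linarith)
      (fun s _ hs => by linarith [hv (x s)]) ht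
    linarith
  refine ⟨fun i => ?_, fun i => ?_⟩
  · have hc := fun s => clip_mem ((h0.1 i).1.trans (h0.1 i).2) s
    exact ⟨low _ _ (h0.1 i).1 fun y => by rw [vel_pg hS]; linarith
        [(hc (y (.pg i) - N.force y (.pg i))).1],
      up _ _ (h0.1 i).2 fun y => by rw [vel_pg hS]; linarith
          [(hc (y (.pg i) - N.force y (.pg i))).2]⟩
  · have hc := fun s => clip_mem ((h0.2 i).1.trans (h0.2 i).2) s
    exact ⟨low _ _ (h0.2 i).1 fun y => by rw [vel_v hS]; linarith
        [(hc (y (.v i) - N.force y (.v i))).1],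
      up _ _ (h0.2 i).2 fun y => by rw [vel_v hS]; linarith [(hc (y (.v i) - N.force y (.v i))).2]⟩

include hx h0 hr in
lemma IsTrajectory.rho_nonneg (a : N.Arc) {t : ℝ} (ht : 0 ≤ t) : 0 ≤ x t (.rho a) := by
  have := le_of_velocity_nonpos (u := fun t => -x t (.rho a)) (w := fun t => -N.vel (x t) (.rho a))
    (b := 0) (fun s hs => ⟨(hx.coord _ s hs).1.neg, by
      rw [(hx.coord _ s hs).2, intervalIntegral.integral_neg]; ring⟩) (by linarith [hr a])
    (fun s _ hs => by
      rw [vel_rho ⟨_, h0⟩, posProj]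
      split_ifs with h
      · rcases h with h | h <;> linarith
      · simp) ht
  linarith

include hx h0 in
lemma IsTrajectory.force_continuousOn (hf : N.A1) (T : ℝ) (j : N.Idx) :
    ContinuousOn (fun t => N.force (x t) j) (Set.Icc 0 T) := by
  have hc : ∀ j, ContinuousOn (fun t => x t j) (Set.Icc 0 T) := by
    intro j
    rcases le_or_gt 0 T with hT | hT
    · have h1 := intervalIntegral.continuousOn_primitive_interval' (hx.coord j T hT).1
          Set.left_mem_uIcc
      rw [Set.uIcc_of_le hT] at h1
      exact (continuousOn_const.add h1).congr fun t ht => (hx.coord j t ht.1).2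
    · rw [Set.Icc_eq_empty (not_le.2 hT)]; exact continuousOn_empty _
  refine force_closed (κ := fun t => N.vel (x t)) (DerivClosed.continuousOn (Set.Icc 0 T)) hc
    (fun i => (hc _).inv₀ fun t ht => (v_pos (hx.mem_S h0 ht.1) i).ne') (fun i => ?_) j
  exact ((hf.2.1 i).continuous_deriv (by norm_num)).comp_continuousOn (hc _)

/-- The velocity makes an acute angle with the negative force. -/
lemma sq_vel_le (hS : N.S.Nonempty) {x : N.State} (hx : x ∈ N.S) (j : N.Idx) :
    N.vel x j ^ 2 ≤ -(N.force x j * N.vel x j) := by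
  revert j
  refine idx_cases (fun i => ?_) (fun i => ?_) (fun a => ?_) fun j hj => ?_
  · rw [vel_pg hS]
    have := clip_variational (x (.pg i) - N.force x (.pg i)) (hx.1 i)
    linarith
  · rw [vel_v hS]
    have := clip_variational (x (.v i) - N.force x (.v i)) (hx.2 i)
    linarith
  · rw [vel_rho hS, posProj]
    split_ifs <;> simp [sq]
  · rw [vel_free hS x hj]; exact le_of_eq (by ring)

lemma abs_vel_le (hS : N.S.Nonempty) {y : N.State} (hy : y ∈ N.S) (j : N.Idx) :
    |N.vel y j| ≤ |N.force y j| := by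
  have h := (sq_vel_le hS hy j).trans (neg_le_abs _)
  rw [← sq_abs, abs_mul] at h
  by_contra! hcon
  nlinarith [abs_nonneg (N.force y j)]

include hx h0 in
lemma IsTrajectory.lipDeriv (hf : N.A1) (j : N.Idx) :
    LipDeriv (fun t => x t j) (fun t => N.vel (x t) j) := by
  constructor
  · intro T
    obtain ⟨C, hC⟩ := isCompact_Icc.exists_bound_of_continuousOn (hx.force_continuousOn h0 hf T j)
    have key : ∀ s ∈ Set.Icc 0 T, ∀ t ∈ Set.Icc 0 T, |x s j - x t j| ≤ C * |s - t| := by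
      intro s hs t ht
      have e : x s j - x t j = ∫ u in t..s, N.vel (x u) j := by
        rw [(hx.coord j s hs.1).2, (hx.coord j t ht.1).2,
          ← intervalIntegral.integral_interval_sub_left (hx.coord j s hs.1).1 (hx.coord j t ht.1).1]
        ring
      rw [e, ← Real.norm_eq_abs]
      refine intervalIntegral.norm_integral_le_of_norm_le_const fun u hu => ?_
      have hu' : u ∈ Set.Icc 0 T := by
        have := Set.uIoc_subset_uIcc hu
        exact (Set.uIcc_subset_Icc ht hs) this
      exact (abs_vel_le ⟨_, h0⟩ (hx.mem_S h0 hu'.1) j).trans (hC u hu')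
    exact ⟨C, key⟩
  · have h1 : ∀ m : ℕ, ∀ᵐ t, t ∈ Set.Ioo 0 (m : ℝ) →
      HasDerivAt (fun t => x t j) (N.vel (x t) j) t := by
      intro m
      filter_upwards [(hx.coord j m m.cast_nonneg).1.ae_hasDerivAt_integral] with t ht hmem
      have h2 := ht (by rw [Set.uIcc_of_le m.cast_nonneg]; exact ⟨hmem.1.le, hmem.2.le⟩) 0
        Set.left_mem_uIcc
      refine (h2.const_add (x 0 j)).congr_of_eventuallyEq ?_
      filter_upwards [Ioo_mem_nhds hmem.1 hmem.2] with s hs using (hx.coord j s hs.1.le).2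
    filter_upwards [ae_all_iff.2 h1] with t ht h0
    obtain ⟨m, hm⟩ := exists_nat_gt t
    exact ht m ⟨h0, hm⟩

lemma A1.contDiff_deriv (hf : N.A1) (i : Fin n) : ContDiff ℝ 1 (deriv (N.f i)) :=
  ((contDiff_succ_iff_deriv (n := 1)).1 (hf.2.1 i)).2.2

include hx h0 in
lemma IsTrajectory.lipDeriv_force (hf : N.A1) (j : N.Idx) :
    LipDeriv (fun t => N.force (x t) j) (fun t => N.forceDeriv (x t) (N.vel (x t)) j) := by
  refine force_closed (κ := fun t => N.vel (x t)) DerivClosed.lipDeriv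
      (fun j => hx.lipDeriv h0 hf j)
    (fun i => ?_) (fun i => ?_) j
  · exact (hx.lipDeriv h0 hf (.v i)).inv (pow_pos (N.Vmin_pos i) 2)
      fun t ht => ((hx.mem_S h0 ht).2 i).1
  · exact (hx.lipDeriv h0 hf (.pg i)).comp_contDiff (hf.contDiff_deriv i)

end Trajectory

end DCNetwork

/-! ### The Lyapunov function -/

/-- An upper bound of a continuous function extends from almost all times to all times. -/
lemma le_of_ae_le {g : ℝ → ℝ} {s C : ℝ} (hg : ContinuousOn g (Set.Ici 0)) (hs : 0 ≤ s)
    (h : ∀ᵐ t, s < t → g t ≤ C) {t : ℝ} (ht : s < t) : g t ≤ C := by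
  have hd := (Measure.dense_of_ae h).open_subset_closure_inter isOpen_Ioi (Set.mem_Ioi.2 ht)
  refine ContinuousWithinAt.closure_le hd ?_ continuousWithinAt_const fun u hu => hu.2 hu.1
  exact (hg t (hs.trans ht.le)).mono fun u hu => hs.trans (le_of_lt hu.1)

namespace DCNetwork

variable {n : ℕ} {N : DCNetwork n}

variable (N) in
/-- The part of the velocity of a multiplier `ρ` that keeps it nonnegative. -/
noncomputable def slack (x : N.State) : N.Idx → ℝ
  | .rho a => N.vel x (.rho a) + N.force x (.rho a)
  | _ => 0

lemma slack_nonneg (hS : N.S.Nonempty) (x : N.State) (j : N.Idx) : 0 ≤ N.slack x j := by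
  cases j with
  | rho a =>
    rw [slack, vel_rho hS, posProj]
    split_ifs with h
    · simp
    · push Not at h; linarith [h.2]
  | _ => exact le_rfl

variable (N) in
/-- The Lyapunov function relative to `c`: the regularized gap of the variational inequality plus
half of the squared distance to `c`. -/
noncomputable def energy (c x : N.State) : ℝ :=
  ∑ j, (-(N.force x j * N.vel x j) - 1 / 2 * N.vel x j ^ 2 + 1 / 2 * (x j - c j) ^ 2)

lemma half_sq_le_energy {x : N.State} (hx : x ∈ N.S) (c : N.State) :
    ∑ j, 1 / 2 * (x j - c j) ^ 2 ≤ N.energy c x :=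
  Finset.sum_le_sum fun j _ => by
    have := sq_vel_le ⟨x, hx⟩ hx j
    have := sq_nonneg (N.vel x j)
    linarith

variable (N) in
/-- A lower bound for the rate of decrease of `energy c`, from the estimates for the single
coordinates. -/
noncomputable def dissipation (c x : N.State) : ℝ :=
  ∑ j, (N.vel x j * N.forceDeriv x (N.vel x) j + N.force x j * (x j - c j) + N.slack x j * c j)

/-- The dissipation relative to an equilibrium dominates each of the nonnegative terms that make it
up. The velocities contribute through the derivative of the force, the positions through its
monotonicity. -/
lemma le_dissipation (hf : N.A1) {α : ℝ} (hα0 : 0 < α) (hα : ∀ i p, α ≤ deriv (deriv (N.f i)) p)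
    {c x : N.State} (hc : c ∈ N.equilibria) (hcr : ∀ a, 0 ≤ c (.rho a)) (hx : x ∈ N.S)
    (hxr : ∀ a, 0 ≤ x (.rho a)) :
    0 ≤ N.dissipation c x ∧ (∀ i, α * N.vel x (.pg i) ^ 2 ≤ N.dissipation c x) ∧
      (∀ i, N.yLin (N.vel x) i ^ 2 ≤ N.dissipation c x) ∧
      (∀ i, N.zLin (N.vel x) i ^ 2 ≤ N.dissipation c x) ∧
      (∀ i, (N.yLin x i - N.vref i) ^ 2 ≤ N.dissipation c x) ∧
      (∀ i, (N.zLin x i - N.pd i) ^ 2 ≤ N.dissipation c x) ∧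
      (∀ a : N.Arc, c (.rho a) * ((x (.v a.fst))⁻¹
          * (x (.P a) - c (.P a) * (c (.v a.fst))⁻¹ * x (.v a.fst)) ^ 2) ≤ N.dissipation c x) ∧
      ∀ j, N.slack x j * c j ≤ N.dissipation c x := by
  have h1 := sum_forceDeriv x hx hxr hα (N.vel x)
  have h2 := force_monotone hf hx hc.1 hxr
  have h3 : 0 ≤ ∑ j, N.force c j * (x j - c j) :=
    Finset.sum_nonneg fun j _ => equilibrium_variational hc hx hxr hcr j
  have hp := equilibrium_polyhedron hc
  have hy : ∀ i, N.yLin c i = N.vref i := fun i => hp.2.1 i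
  have hz : ∀ i, N.zLin c i = N.pd i := fun i => hp.2.2.1 i
  simp only [hy, hz, sub_mul] at h2
  rw [Finset.sum_sub_distrib] at h2
  have hD : N.dissipation c x = ∑ j, N.forceDeriv x (N.vel x) j * N.vel x j
      + ∑ j, N.force x j * (x j - c j) + ∑ j, N.slack x j * c j := by
    rw [dissipation, Finset.sum_add_distrib, Finset.sum_add_distrib]
    simp only [mul_comm (N.vel x _) (N.forceDeriv x _ _)]
  have n1 : ∀ i, 0 ≤ α * N.vel x (.pg i) ^ 2 := fun i => by positivity
  have n2 : ∀ a : N.Arc, 0 ≤ c (.rho a) * ((x (.v a.fst))⁻¹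
      * (x (.P a) - c (.P a) * (c (.v a.fst))⁻¹ * x (.v a.fst)) ^ 2) := fun a =>
    mul_nonneg (hcr a) (mul_nonneg (inv_nonneg.2 (v_pos hx _).le) (sq_nonneg _))
  have n3 : ∀ j, 0 ≤ N.slack x j * c j := fun j => by
    cases j with
    | rho a => exact mul_nonneg (slack_nonneg ⟨x, hx⟩ x _) (hcr a)
    | _ => exact (zero_mul _).ge
  rw [Finset.mul_sum] at h1
  have s1 := Finset.sum_nonneg fun i (_ : i ∈ Finset.univ) => n1 i
  have s2 := Finset.sum_nonneg fun i (_ : i ∈ Finset.univ) => sq_nonneg (N.yLin (N.vel x) i)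
  have s3 := Finset.sum_nonneg fun i (_ : i ∈ Finset.univ) => sq_nonneg (N.zLin (N.vel x) i)
  have s4 := Finset.sum_nonneg fun i (_ : i ∈ Finset.univ) => sq_nonneg (N.yLin x i - N.vref i)
  have s5 := Finset.sum_nonneg fun i (_ : i ∈ Finset.univ) => sq_nonneg (N.zLin x i - N.pd i)
  have s6 := Finset.sum_nonneg fun a (_ : a ∈ Finset.univ) => n2 a
  have s7 := Finset.sum_nonneg fun j (_ : j ∈ Finset.univ) => n3 j
  refine ⟨by linarith, fun i => ?_, fun i => ?_, fun i => ?_, fun i => ?_, fun i => ?_, fun a => ?_,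
    fun j => ?_⟩
  · linarith [Finset.single_le_sum (fun i _ => n1 i) (Finset.mem_univ i)]
  · linarith [Finset.single_le_sum (fun i _ => sq_nonneg (N.yLin (N.vel x) i)) (Finset.mem_univ i)]
  · linarith [Finset.single_le_sum (fun i _ => sq_nonneg (N.zLin (N.vel x) i)) (Finset.mem_univ i)]
  · linarith [Finset.single_le_sum (fun i _ => sq_nonneg (N.yLin x i - N.vref i))
        (Finset.mem_univ i)]
  · linarith [Finset.single_le_sum (fun i _ => sq_nonneg (N.zLin x i - N.pd i)) (Finset.mem_univ i)]
  · linarith [Finset.single_le_sum (fun a _ => n2 a) (Finset.mem_univ a)]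
  · linarith [Finset.single_le_sum (fun j _ => n3 j) (Finset.mem_univ j)]

/-- A time at which all multipliers `ρ`, whose velocities may jump, follow the dynamics. -/
def IsRegularTime (x : ℝ → N.State) (t : ℝ) : Prop :=
  ∀ a, HasDerivAt (fun s => x s (.rho a)) (N.vel (x t) (.rho a)) t

section Trajectory

variable {x : ℝ → N.State} (hx : N.IsTrajectory x) (h0 : x 0 ∈ N.S)
  (hr : ∀ a : N.Arc, 0 ≤ x 0 (.rho a)) (hf : N.A1)

include hx h0 hf in
lemma IsTrajectory.ae_isRegularTime : ∀ᵐ t, 0 < t → IsRegularTime x t := by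
  filter_upwards [ae_all_iff.2 fun a => (hx.lipDeriv h0 hf (.rho a)).hasDeriv] with t ht h a
  exact ht a h

include hx h0 hf in
lemma IsTrajectory.essBdd_slack (t : ℝ) (j : N.Idx) :
    EssBdd (Set.Ioc 0 t) fun u => N.slack (x u) j := by
  cases j with
  | rho a =>
    exact ((hx.lipDeriv h0 hf _).essBdd_right t).add ((hx.lipDeriv_force h0 hf _).essBdd_left t)
  | _ => exact EssBdd.const 0

include hx h0 hf in
lemma IsTrajectory.intervalIntegrable_dissipation_term (c : N.State) {s t : ℝ} (hs : 0 ≤ s)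
    (hst : s ≤ t) (j : N.Idx) :
    IntervalIntegrable (fun u => N.vel (x u) j * N.forceDeriv (x u) (N.vel (x u)) j
      + N.force (x u) j * (x u j - c j) + N.slack (x u) j * c j) volume s t := by
  have hX := hx.lipDeriv h0 hf j
  have hΦ := hx.lipDeriv_force h0 hf j
  exact (((((hX.essBdd_right t).mul (hΦ.essBdd_right t)).add
    ((hΦ.essBdd_left t).mul ((hX.sub_const (c j)).essBdd_left t))).add
    ((hx.essBdd_slack h0 hf t j).mul (EssBdd.const (c j)))).mono
    (Set.Ioc_subset_Ioc_left hs)).intervalIntegrable hst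

include hx h0 hr hf in
/-- The energy inequality. It compares regular times only, as the energy may jump at others. -/
lemma IsTrajectory.energy_sub_le {c : N.State} (hc : c ∈ N.S) {s t : ℝ} (hs : 0 < s) (hst : s ≤ t)
    (gs : IsRegularTime x s) (gt : IsRegularTime x t) :
    N.energy c (x t) - N.energy c (x s) ≤ -∫ u in s..t, N.dissipation c (x u) := by
  have hS : N.S.Nonempty := ⟨_, hc⟩
  have key : ∀ j, coordEnergy (fun u => x u j) (fun u => N.vel (x u) j)
        (fun u => N.force (x u) j) (c j) t
      - coordEnergy (fun u => x u j) (fun u => N.vel (x u) j) (fun u => N.force (x u) j) (c j) s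
      ≤ ∫ u in s..t, -(N.vel (x u) j * N.forceDeriv (x u) (N.vel (x u)) j
        + N.force (x u) j * (x u j - c j) + N.slack (x u) j * c j) := by
    have hcongr : ∀ {p q : ℝ → ℝ} {E : ℝ}, E ≤ ∫ u in s..t, p u → (∀ u, p u = q u) →
        E ≤ ∫ u in s..t, q u := fun h hpq => by simpa only [hpq] using h
    refine idx_cases (fun i => ?_) (fun i => ?_) (fun a => ?_) fun j hj => ?_
    · refine hcongr (coordEnergy_box (hx.lipDeriv h0 hf _) (hx.lipDeriv_force h0 hf _)
        (fun u _ => vel_pg hS (x u) i) (hc.1 i) hs.le hst) fun u => ?_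
      simp only [slack]; ring
    · refine hcongr (coordEnergy_box (hx.lipDeriv h0 hf _) (hx.lipDeriv_force h0 hf _)
        (fun u _ => vel_v hS (x u) i) (hc.2 i) hs.le hst) fun u => ?_
      simp only [slack]; ring
    · have h := coordEnergy_nonneg (c := c (.rho a)) (hx.lipDeriv h0 hf (.rho a))
        (hx.lipDeriv_force h0 hf (.rho a)).neg (fun u _ => vel_rho hS (x u) a)
        (fun u hu => hx.rho_nonneg h0 hr a hu) hs hst (gs a) (gt a)
      simp only [neg_neg] at h
      refine hcongr h fun u => ?_
      simp only [slack]; ring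
    · refine hcongr (coordEnergy_free (hx.lipDeriv h0 hf _) (hx.lipDeriv_force h0 hf _)
        (fun u _ => vel_free hS (x u) hj) (c j) hs.le hst) fun u => ?_
      have : N.slack (x u) j = 0 := by cases j <;> first | rfl | exact hj.elim
      rw [this]; ring
  have hsum := Finset.sum_le_sum fun j (_ : j ∈ Finset.univ) => key j
  simp only [intervalIntegral.integral_neg] at hsum
  rw [Finset.sum_sub_distrib, Finset.sum_neg_distrib,
    ← intervalIntegral.integral_finsetSum fun j _ =>
      hx.intervalIntegrable_dissipation_term h0 hf c hs.le hst j] at hsum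
  exact hsum

include hx h0 hr hf in
/-- Along a trajectory, the energy relative to an equilibrium does not increase. -/
lemma IsTrajectory.energy_le {c : N.State} (hc : c ∈ N.equilibria) (hcr : ∀ a, 0 ≤ c (.rho a))
    {s t : ℝ} (hs : 0 < s) (hst : s ≤ t) (gs : IsRegularTime x s) (gt : IsRegularTime x t) :
    N.energy c (x t) ≤ N.energy c (x s) := by
  have h := hx.energy_sub_le h0 hr hf hc.1 hs hst gs gt
  have h1 : 0 ≤ ∫ u in s..t, N.dissipation c (x u) := by
    refine intervalIntegral.integral_nonneg hst fun u hu => ?_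
    have hu0 : 0 ≤ u := hs.le.trans hu.1
    obtain ⟨α, hα, hf2⟩ := hf.2.2
    exact (le_dissipation hf hα hf2 hc hcr (hx.mem_S h0 hu0) fun a => hx.rho_nonneg h0 hr a hu0).1
  linarith

include hx h0 hf in
lemma IsTrajectory.exists_isRegularTime {t : ℝ} (ht : 0 ≤ t) : ∃ s, t < s ∧ IsRegularTime x s := by
  obtain ⟨s, hs, h1, -⟩ := (Measure.dense_of_ae (hx.ae_isRegularTime h0 hf)).exists_between
    (lt_add_one t)
  exact ⟨s, h1, hs (ht.trans_lt h1)⟩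

include hx h0 hr hf in
/-- The distance to an equilibrium at later times is controlled by the energy at a regular time. -/
lemma IsTrajectory.sum_sq_le_energy {c : N.State} (hc : c ∈ N.equilibria)
    (hcr : ∀ a, 0 ≤ c (.rho a))
    {s t : ℝ} (hs : 0 < s) (hst : s < t) (gs : IsRegularTime x s) :
    ∑ j, 1 / 2 * (x t j - c j) ^ 2 ≤ N.energy c (x s) := by
  refine le_of_ae_le (g := fun t => ∑ j, 1 / 2 * (x t j - c j) ^ 2) ?_ hs.le ?_ hst
  · exact continuousOn_finsetSum _ fun j _ =>
      (((hx.lipDeriv h0 hf j).continuousOn.sub continuousOn_const).pow 2).const_mul _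
  · filter_upwards [hx.ae_isRegularTime h0 hf] with u hu hsu
    have hu0 := hs.trans hsu
    exact (half_sq_le_energy (hx.mem_S h0 hu0.le) c).trans
      (hx.energy_le h0 hr hf hc hcr hs hsu.le gs (hu hu0))

/-! ### Bounds for all times -/

include hx h0 hr hf in
lemma IsTrajectory.bounded {c : N.State} (hc : c ∈ N.equilibria) (hcr : ∀ a, 0 ≤ c (.rho a))
    (j : N.Idx) : ∃ C, ∀ t ∈ Set.Ici (0 : ℝ), |x t j| ≤ C := by
  obtain ⟨s, hs, gs⟩ := hx.exists_isRegularTime h0 hf le_rfl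
  obtain ⟨D, hD0, hD⟩ := (hx.lipDeriv h0 hf j).exists_bound s
  refine ⟨D + (2 * N.energy c (x s) + 1 + |c j|), fun t ht => ?_⟩
  have h1 := half_sq_le_energy (hx.mem_S h0 hs.le) c
  have h2 : 0 ≤ ∑ j, 1 / 2 * (x s j - c j) ^ 2 := Finset.sum_nonneg fun j _ => by positivity
  rcases le_or_gt t s with hts | hts
  · linarith [hD t ⟨ht, hts⟩, abs_nonneg (c j)]
  · have h3 := hx.sum_sq_le_energy h0 hr hf hc hcr hs hts gs
    have h4 := Finset.single_le_sum (f := fun j => 1 / 2 * (x t j - c j) ^ 2)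
      (fun j _ => by positivity) (Finset.mem_univ j)
    have h5 : |x t j - c j| ≤ 2 * N.energy c (x s) + 1 := by
      have h6 : |x t j - c j| ^ 2 ≤ 2 * N.energy c (x s) := by
        rw [sq_abs]; simp only at h4; linarith
      nlinarith [sq_nonneg (|x t j - c j| - 1 / 2), abs_nonneg (x t j - c j)]
    have h6 := abs_add_le (x t j - c j) (c j)
    rw [sub_add_cancel] at h6
    linarith

include hx h0 hr hf in
lemma IsTrajectory.bddDeriv {c : N.State} (hc : c ∈ N.equilibria) (hcr : ∀ a, 0 ≤ c (.rho a))
    (j : N.Idx) : BddDeriv (fun t => x t j) (fun t => N.vel (x t) j) := by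
  have hl := hx.lipDeriv h0 hf j
  refine ⟨hl, hx.bounded h0 hr hf hc hcr j, ⟨hl.aestronglyMeasurable_right, ?_⟩⟩
  have hb : ∃ C, ∀ t ∈ Set.Ici (0 : ℝ), |N.force (x t) j| ≤ C := by
    refine force_closed (κ := fun t => N.vel (x t)) (DerivClosed.bounded (Set.Ici (0 : ℝ)))
      (hx.bounded h0 hr hf hc hcr) (fun i => ⟨(N.Vmin i ^ 2)⁻¹, fun t ht => ?_⟩) (fun i => ?_) j
    · have hv := (hx.mem_S h0 ht).2 i
      have hm := pow_pos (N.Vmin_pos i) 2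
      rw [abs_inv, abs_of_pos (hm.trans_le hv.1)]
      exact inv_anti₀ hm hv.1
    · obtain ⟨C, hC⟩ := (isCompact_Icc (a := 0) (b := N.pmax i)).exists_bound_of_continuousOn
        (hf.contDiff_deriv i).continuous.continuousOn
      exact ⟨C, fun t ht => hC _ ((hx.mem_S h0 ht).1 i)⟩
  obtain ⟨C, hC⟩ := hb
  exact ⟨C, (ae_restrict_iff' measurableSet_Ioi).2 (Eventually.of_forall fun t ht =>
    (abs_vel_le ⟨_, h0⟩ (hx.mem_S h0 (le_of_lt ht)) j).trans (hC t (Set.mem_Ici.2 (le_of_lt ht))))⟩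

include hx h0 hr hf in
lemma IsTrajectory.essBdd_slack_Ioi {c : N.State} (hc : c ∈ N.equilibria)
    (hcr : ∀ a, 0 ≤ c (.rho a)) (a : N.Arc) :
    EssBdd (Set.Ioi 0) fun t => N.slack (x t) (.rho a) := by
  have hX := hx.bddDeriv h0 hr hf hc hcr
  have hi := (hX (.v a.fst)).inv (pow_pos (N.Vmin_pos a.fst) 2) fun t ht =>
      ((hx.mem_S h0 ht).2 a.fst).1
  have : EssBdd (Set.Ioi 0) fun t => N.vel (x t) (.rho a) + -(x t (.P a) * (x t (.P a)
      * (x t (.v a.fst))⁻¹) - x t (.l (lineOf a))) :=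
    (hX (.rho a)).bdd_deriv.add (((hX (.P a)).essBdd.mul ((hX (.P a)).essBdd.mul hi.essBdd)).sub
      (hX (.l (lineOf a))).essBdd).neg
  exact this

include hx h0 hr hf in
/-- What the dissipation controls is negligible. -/
lemma IsTrajectory.negligible_of_le_dissipation {c : N.State} (hc : c ∈ N.equilibria)
    {a : ℝ → ℝ} (ha : EssBdd (Set.Ioi 0) a) (ha0 : ∀ t, 0 ≤ t → 0 ≤ a t)
    (h : ∀ t, 0 ≤ t → a t ≤ N.dissipation c (x t)) : Negligible a := by
  obtain ⟨s, hs, gs⟩ := hx.exists_isRegularTime h0 hf le_rfl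
  refine Negligible.of_integral_le ha (Eventually.of_forall fun t ht => ha0 t ht.le) hs.le
    (C := N.energy c (x s)) fun T => ?_
  obtain ⟨t, ht, gt⟩ := hx.exists_isRegularTime h0 hf (hs.le.trans (le_max_left s T))
  have hst : s ≤ t := (le_max_left s T).trans ht.le
  refine ⟨t, (le_max_right s T).trans ht.le, ?_⟩
  have h1 := hx.energy_sub_le h0 hr hf hc.1 hs hst gs gt
  have h2 := half_sq_le_energy (hx.mem_S h0 (hs.le.trans hst)) c
  have h3 : 0 ≤ ∑ j, 1 / 2 * (x t j - c j) ^ 2 := Finset.sum_nonneg fun j _ => by positivity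
  have hi : IntervalIntegrable (fun u => N.dissipation c (x u)) volume s t := by
    have e := IntervalIntegrable.sum (μ := volume) Finset.univ fun j _ =>
      hx.intervalIntegrable_dissipation_term h0 hf c hs.le hst j
    rwa [Finset.sum_fn] at e
  have h4 : ∫ u in s..t, a u ≤ ∫ u in s..t, N.dissipation c (x u) :=
    intervalIntegral.integral_mono_on hst (ha.intervalIntegrable_Ioi hs.le hst) hi
      fun u hu => h u (hs.le.trans hu.1)
  linarith

end Trajectory

end DCNetwork

namespace DCNetwork

variable {n : ℕ} {N : DCNetwork n}

/-! ### All velocities are negligible -/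

lemma force_l (x : N.State) (a : N.Arc) : N.force x (.l (lineOf a))
    = -(x (.lam (lineOf a)) * N.res a + x (.rho a) + x (.rho a.symm)) := by
  revert a
  refine arc_cases fun e => ⟨?_, ?_⟩ <;> simp only [force, field, lineOf_line, lineOf_line_symm,
    res_symm, SimpleGraph.Dart.symm_symm] <;> ring

lemma force_lam (x : N.State) (a : N.Arc) : N.force x (.lam (lineOf a))
    = -(x (.P a) + x (.P a.symm) - N.res a * x (.l (lineOf a))) := by
  revert a
  refine arc_cases fun e => ⟨?_, ?_⟩ <;> simp only [force, field, lossLin, lineOf_line,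
    lineOf_line_symm, res_symm, SimpleGraph.Dart.symm_symm]
  ring

lemma force_gam (x : N.State) (a : N.Arc) : sgn a * N.force x (.gam (lineOf a))
    = -(x (.v a.fst) - x (.v a.snd) - N.res a * (x (.P a) - x (.P a.symm))) := by
  revert a
  refine arc_cases fun e => ⟨?_, ?_⟩ <;> simp only [force, field, dropLin, lineOf_line, sgn_line,
    lineOf_line_symm, sgn_line_symm, res_symm, SimpleGraph.Dart.symm_symm]
  · ring
  · simp only [SimpleGraph.Dart.symm_toProd, Prod.fst_swap, Prod.snd_swap]; ring

section Trajectory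

variable {x : ℝ → N.State} (hx : N.IsTrajectory x) (h0 : x 0 ∈ N.S)
  (hr : ∀ a : N.Arc, 0 ≤ x 0 (.rho a)) (hf : N.A1) {c : N.State} (hc : c ∈ N.equilibria)
  (hcr : ∀ a, 0 ≤ c (.rho a))

include hx h0 hr hf hc

lemma IsTrajectory.negligible_of_sq_le {p : ℝ → ℝ} (hp : EssBdd (Set.Ioi 0) p)
    (h : ∀ t, 0 ≤ t → p t ^ 2 ≤ N.dissipation c (x t)) : Negligible p :=
  Negligible.of_sq hp (hx.negligible_of_le_dissipation h0 hr hf hc hp.sq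
    (fun _ _ => sq_nonneg _) h).meanZero

include hcr

/-- At the nodes, the residuals and the velocities of the primal variables are negligible. -/
lemma IsTrajectory.negligible_node (i : Fin n) :
    Negligible (fun t => N.yLin (x t) i - N.vref i) ∧
      Negligible (fun t => N.zLin (x t) i - N.pd i) ∧
      Negligible (fun t => N.zLin (N.vel (x t)) i) ∧ Negligible (fun t => N.vel (x t) (.pg i)) ∧
      Negligible (fun t => N.vel (x t) (.v i)) ∧ Negligible (fun t => N.vel (x t) (.phat i)) := by
  have hX := hx.bddDeriv h0 hr hf hc hcr
  have hS : N.S.Nonempty := ⟨_, h0⟩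
  have hy := yLin_closed DerivClosed.bddDeriv hX i
  have hz := zLin_closed DerivClosed.bddDeriv hX i
  obtain ⟨α, hα, hf2⟩ := hf.2.2
  have hdis := fun (t : ℝ) (ht : 0 ≤ t) => le_dissipation hf hα hf2 hc hcr (hx.mem_S h0 ht)
    fun a => hx.rho_nonneg h0 hr a ht
  have ny := hx.negligible_of_sq_le h0 hr hf hc (hy.essBdd.sub (EssBdd.const (N.vref i)))
    fun t ht => (hdis t ht).2.2.2.2.1 i
  have nz := hx.negligible_of_sq_le h0 hr hf hc (hz.essBdd.sub (EssBdd.const (N.pd i)))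
    fun t ht => (hdis t ht).2.2.2.2.2.1 i
  have ny' := hx.negligible_of_sq_le h0 hr hf hc hy.bdd_deriv fun t ht => (hdis t ht).2.2.1 i
  have nz' := hx.negligible_of_sq_le h0 hr hf hc hz.bdd_deriv fun t ht => (hdis t ht).2.2.2.1 i
  have npg : Negligible (fun t => N.vel (x t) (.pg i)) := by
    refine Negligible.of_sq (hX _).bdd_deriv (MeanZero.congr'
      ((hx.negligible_of_le_dissipation h0 hr hf
      hc ((hX (.pg i)).bdd_deriv.sq.const_mul α) (fun t _ => by positivity)
      fun t ht => (hdis t ht).2.1 i).const_mul α⁻¹).meanZero fun t _ => ?_)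
    field_simp
  have nphat := (droop_negligible (N.k_pos i) (hX (.eps i)) (hX (.phat i)) ny
    (Eventually.of_forall fun t _ => by
      rw [vel_free hS (x t) (j := .eps i) trivial]; simp only [force, field]; ring)
    (Eventually.of_forall fun t _ => by
      rw [vel_free hS (x t) (j := .phat i) trivial]; simp only [force, field]; ring)).2
  refine ⟨ny, nz, nz', npg, ?_, nphat⟩
  refine ((ny'.sub (npg.const_mul (N.k i))).add (nphat.const_mul (N.k i))).congr' fun t _ => ?_
  simp only [yLin]; ring

/-- On a line with a positive equilibrium multiplier, all velocities are negligible. -/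
lemma IsTrajectory.negligible_line {a : N.Arc} (ha : 0 < c (.rho a)) :
    Negligible (fun t => N.vel (x t) (.P a)) ∧ Negligible (fun t => N.vel (x t) (.P a.symm)) ∧
      Negligible (fun t => N.vel (x t) (.l (lineOf a))) ∧
      Negligible (fun t => N.vel (x t) (.lam (lineOf a))) ∧
      Negligible (fun t => N.vel (x t) (.gam (lineOf a))) ∧
      Negligible (fun t => N.vel (x t) (.rho a)) ∧
      Negligible (fun t => N.vel (x t) (.rho a.symm)) := by
  have hX := hx.bddDeriv h0 hr hf hc hcr
  have hS : N.S.Nonempty := ⟨_, h0⟩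
  have hz := fun i : Fin n => zLin_closed DerivClosed.bddDeriv hX i
  obtain ⟨α, hα, hf2⟩ := hf.2.2
  have hdis := fun (t : ℝ) (ht : 0 ≤ t) => le_dissipation hf hα hf2 hc hcr (hx.mem_S h0 ht)
    fun a => hx.rho_nonneg h0 hr a ht
  have hnode := hx.negligible_node h0 hr hf hc hcr
  have hm := fun i : Fin n => sub_const_closed DerivClosed.bddDeriv
    (a := fun t => N.vel (x t) (.mu i) - N.zLin (N.vel (x t)) i) ((hX (.mu i)).sub (hz i)) (-N.pd i)
  have nm : ∀ i, Negligible fun t => N.vel (x t) (.mu i) - N.zLin (N.vel (x t)) i := fun i => by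
    refine ((hnode i).2.1.neg.sub (hnode i).2.2.1).congr' fun t _ => ?_
    rw [vel_free hS (x t) (j := .mu i) trivial]; simp only [force, field]
  have nη : Negligible fun t => N.slack (x t) (.rho a) := by
    refine ((hx.negligible_of_le_dissipation h0 hr hf hc
      ((hx.essBdd_slack_Ioi h0 hr hf hc hcr a).mul (EssBdd.const (c (.rho a))))
      (fun t _ => mul_nonneg (slack_nonneg hS _ _) ha.le)
      fun t ht => (hdis t ht).2.2.2.2.2.2.2 (.rho a)).const_mul (c (.rho a))⁻¹).congr' fun t _ => ?_
    field_simp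
  have vpos := fun i : Fin n => pow_pos (N.Vmin_pos i) 2
  have vlow := fun (i : Fin n) (t : ℝ) (ht : 0 ≤ t) => ((hx.mem_S h0 ht : x t ∈ N.S).2 i).1
  -- from the convexity gap of the conic term, weighted by the multiplier of the equilibrium
  have nP : Negligible fun t => x t (.P a) - c (.P a) * (c (.v a.fst))⁻¹ * x t (.v a.fst) := by
    have hd : EssBdd (Set.Ioi 0)
        fun t => x t (.P a) - c (.P a) * (c (.v a.fst))⁻¹ * x t (.v a.fst) :=
      (hX (.P a)).essBdd.sub ((hX (.v a.fst)).essBdd.const_mul _)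
    have hvi := ((hX (.v a.fst)).inv (vpos a.fst) (vlow a.fst)).essBdd
    refine Negligible.of_sq hd (MeanZero.congr' ((hx.negligible_of_le_dissipation h0 hr hf hc
      ((hvi.mul hd.sq).const_mul (c (.rho a)))
      (fun t ht => mul_nonneg ha.le (mul_nonneg (inv_nonneg.2 (v_pos (hx.mem_S h0 ht) _).le)
        (sq_nonneg _))) fun t ht => (hdis t ht).2.2.2.2.2.2.1 a).mul
      ((hX (.v a.fst)).essBdd.const_mul (c (.rho a))⁻¹)).meanZero fun t ht => ?_)
    have := (v_pos (hx.mem_S h0 ht) a.fst).ne'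
    field_simp
  have hforce : ∀ j, N.IsFree j → ∀ t, N.vel (x t) j = -N.force (x t) j := fun j hj t =>
    vel_free hS (x t) hj
  have hslack : ∀ b : N.Arc, ∀ t, N.vel (x t) (.rho b) = cone (x t) b + N.slack (x t) (.rho b) :=
    fun b t => by rw [slack, force_rho]; ring
  obtain ⟨n1, n2, n3, n4, n5, n6, n7⟩ := line_negligible (res_pos a)
    (lt_min (vpos a.fst) (vpos a.snd)) (hX (.v a.fst)) (hX (.v a.snd)) (hX (.P a)) (hX (.P a.symm))
    (hX (.l (lineOf a))) (hX (.lam (lineOf a))) ((hX (.gam (lineOf a))).const_mul (sgn a))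
    (hX (.rho a)) (hX (.rho a.symm)) (hm a.fst) (hm a.snd)
    (fun t ht => (min_le_left _ _).trans (vlow _ t ht))
    (fun t ht => (min_le_right _ _).trans (vlow _ t ht))
    (hnode _).2.2.2.2.1 (hnode _).2.2.2.2.1 (nm _) (nm _) nP
    (Eventually.of_forall fun t _ => by
      rw [hforce (.P a) trivial]; simp only [force, field]; ring)
    (Eventually.of_forall fun t _ => by
      rw [hforce (.P a.symm) trivial]
      simp only [force, field, lineOf_symm, sgn_symm, res_symm]
      simp only [SimpleGraph.Dart.symm_toProd, Prod.fst_swap]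
      ring)
    (Eventually.of_forall fun t _ => by rw [hforce (.l (lineOf a)) trivial, force_l]; ring)
    (Eventually.of_forall fun t _ => by rw [hforce (.lam (lineOf a)) trivial, force_lam]; ring)
    (Eventually.of_forall fun t _ => by
      have := force_gam (x t) a
      rw [hforce (.gam (lineOf a)) trivial]; linarith)
    (Eventually.of_forall fun t _ => by rw [hslack, cone]; ring) nη
    (Eventually.of_forall fun t _ => by
      rw [hslack, cone, lineOf_symm]
      simp only [SimpleGraph.Dart.symm_toProd, Prod.fst_swap]
      ring)
    (Eventually.of_forall fun t _ => slack_nonneg hS (x t) (.rho a.symm))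
  refine ⟨n1, n2, n3, n4, (n5.const_mul (sgn a)).congr' fun t _ => ?_, n6, n7⟩
  rw [← mul_assoc]
  have : sgn a * sgn a = 1 := by unfold sgn; split_ifs <;> norm_num
  rw [this, one_mul]

lemma IsTrajectory.negligible_vel (hVmax : ∀ i j, N.Vmax i = N.Vmax j) (hpd : ∀ i, 0 < N.pd i)
    (j : N.Idx) : Negligible fun t => N.vel (x t) j := by
  have hnode := hx.negligible_node h0 hr hf hc hcr
  have hS : N.S.Nonempty := ⟨_, h0⟩
  have hline : ∀ a : N.Arc,
      Negligible (fun t => N.vel (x t) (.P a)) ∧ Negligible (fun t => N.vel (x t) (.l (lineOf a))) ∧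
      Negligible (fun t => N.vel (x t) (.lam (lineOf a))) ∧
      Negligible (fun t => N.vel (x t) (.gam (lineOf a))) ∧
      Negligible (fun t => N.vel (x t) (.rho a)) := by
    intro a
    rcases exists_rho_pos hVmax hpd hf hc hcr a with h | h
    · obtain ⟨n1, n2, n3, n4, n5, n6, n7⟩ := hx.negligible_line h0 hr hf hc hcr h
      exact ⟨n1, n3, n4, n5, n6⟩
    · obtain ⟨n1, n2, n3, n4, n5, n6, n7⟩ := hx.negligible_line h0 hr hf hc hcr h
      rw [lineOf_symm] at n3 n4 n5
      rw [SimpleGraph.Dart.symm_symm] at n2 n7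
      exact ⟨n2, n3, n4, n5, n7⟩
  cases j with
  | pg i => exact (hnode i).2.2.2.1
  | v i => exact (hnode i).2.2.2.2.1
  | phat i => exact (hnode i).2.2.2.2.2
  | mu i =>
    refine (hnode i).2.1.neg.congr' fun t _ => ?_
    rw [vel_free hS (x t) (j := .mu i) trivial]; simp only [force, field]
  | eps i =>
    refine (hnode i).1.congr' fun t _ => ?_
    rw [vel_free hS (x t) (j := .eps i) trivial]; simp only [force, field, neg_neg]
  | P a => exact (hline a).1
  | rho a => exact (hline a).2.2.2.2
  | l e => simpa using (hline e.1).2.1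
  | lam e => simpa using (hline e.1).2.2.1
  | gam e => simpa using (hline e.1).2.2.2.1

end Trajectory

end DCNetwork

namespace DCNetwork

variable {n : ℕ} {N : DCNetwork n}

/-! ### Limit points are equilibria, and attract the trajectory -/

lemma continuousAt_coord (x : N.State) (j : N.Idx) : ContinuousAt (fun y : N.State => y j) x :=
  (EuclideanSpace.proj j : N.State →L[ℝ] ℝ).continuous.continuousAt

lemma continuousAt_force (hf : N.A1) {x : N.State} (hx : x ∈ N.S) (j : N.Idx) :
    ContinuousAt (fun y : N.State => N.force y j) x := by
  have hp := continuousAt_coord x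
  have hi : ∀ i, ContinuousAt (fun y : N.State => (y (.v i))⁻¹) x := fun i =>
    (hp (.v i)).inv₀ (v_pos hx i).ne'
  have hG : ∀ i, ContinuousAt (fun y : N.State => deriv (N.f i) (y (.pg i))) x := fun i =>
    ContinuousAt.comp (g := deriv (N.f i)) (hf.contDiff_deriv i).continuous.continuousAt (hp _)
  cases j <;> simp only [force, field, yLin, zLin, lossLin, dropLin] <;> fun_prop

/-- A limit of states along which the velocity tends to zero is an equilibrium. -/
lemma mem_equilibria_of_tendsto (hf : N.A1) {y : ℕ → N.State} {x : N.State} (hy : ∀ k, y k ∈ N.S)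
    (hyr : ∀ k a, 0 ≤ y k (.rho a)) (hlim : Tendsto y atTop (𝓝 x))
    (hvel : ∀ j, Tendsto (fun k => N.vel (y k) j) atTop (𝓝 0)) :
    x ∈ N.equilibria ∧ ∀ a, 0 ≤ x (.rho a) := by
  have hS : N.S.Nonempty := ⟨_, hy 0⟩
  have hc : ∀ j, Tendsto (fun k => y k j) atTop (𝓝 (x j)) := fun j =>
    (continuousAt_coord x j).tendsto.comp hlim
  have hxS : x ∈ N.S :=
    ⟨fun i => ⟨ge_of_tendsto' (hc _) fun k => ((hy k).1 i).1, le_of_tendsto' (hc _) fun k =>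
        ((hy k).1 i).2⟩,
      fun i => ⟨ge_of_tendsto' (hc _) fun k => ((hy k).2 i).1, le_of_tendsto' (hc _) fun k =>
          ((hy k).2 i).2⟩⟩
  have hxr : ∀ a, 0 ≤ x (.rho a) := fun a => ge_of_tendsto' (hc _) fun k => hyr k a
  have hF : ∀ j, Tendsto (fun k => N.force (y k) j) atTop (𝓝 (N.force x j)) := fun j =>
    (continuousAt_force hf hxS j).tendsto.comp hlim
  have hclip : ∀ (a b : ℝ) (j : N.Idx),
      Tendsto (fun k => clip a b (y k j - N.force (y k) j) - y k j)
      atTop (𝓝 (clip a b (x j - N.force x j) - x j)) := fun a b j =>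
    (tendsto_const_nhds.max (tendsto_const_nhds.min ((hc j).sub (hF j)))).sub (hc j)
  refine ⟨(equilibrium_iff x).2 ⟨hxS, idx_cases (fun i => ?_) (fun i => ?_) (fun a => ?_)
    fun j hj => ?_⟩, hxr⟩
  · have h := hvel (.pg i)
    simp only [vel_pg hS] at h ⊢
    exact tendsto_nhds_unique (hclip _ _ _) h
  · have h := hvel (.v i)
    simp only [vel_v hS] at h ⊢
    exact tendsto_nhds_unique (hclip _ _ _) h
  · have h := hvel (.rho a)
    rw [vel_rho hS, posProj]
    split_ifs with hpos
    · rcases (hxr a).eq_or_lt with h0 | h0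
      · have hle := le_of_tendsto_of_tendsto' (hF (.rho a)).neg h fun k => by
          have := slack_nonneg hS (y k) (.rho a)
          rw [slack] at this; linarith
        rcases hpos with h1 | h1 <;> linarith
      · refine tendsto_nhds_unique ((hF (.rho a)).neg.congr' ?_) h
        filter_upwards [(hc (.rho a)).eventually (lt_mem_nhds h0)] with k hk
        rw [vel_rho hS, posProj, if_pos (.inl hk)]
    · rfl
  · have h := hvel j
    simp only [vel_free hS _ hj] at h ⊢
    exact tendsto_nhds_unique (hF j).neg h

/-- A limit point along times of small velocity is an equilibrium; relative to it, the energy tends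
to zero along these times and never increases. -/
lemma IsTrajectory.exists_tendsto (hVmax : ∀ i j, N.Vmax i = N.Vmax j) (hpd : ∀ i, 0 < N.pd i)
    (hf : N.A1) {c : N.State} (hc : c ∈ N.equilibria) (hcr : ∀ a, 0 ≤ c (.rho a))
    {x : ℝ → N.State} (hx : N.IsTrajectory x) (h0 : x 0 ∈ N.S)
    (hr : ∀ a : N.Arc, 0 ≤ x 0 (.rho a)) :
    ∃ y ∈ N.equilibria, (∀ a, 0 ≤ y (.rho a)) ∧ Tendsto x atTop (𝓝 y) := by
  have hneg : Negligible fun t => ∑ j, |N.vel (x t) j| := Negligible.sum _ fun j _ => by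
    have h := hx.negligible_vel h0 hr hf hc hcr hVmax hpd j
    exact h.abs.negligible (Eventually.of_forall fun _ _ => abs_nonneg _)
  have hseq : ∀ k : ℕ, ∃ t : ℝ, 0 < t ∧ IsRegularTime x t ∧
      ∀ j, |N.vel (x t) j| ≤ 1 / ((k : ℝ) + 1) := by
    intro k
    obtain ⟨t, ht, hreg, hsmall⟩ := hneg.exists_small (hx.ae_isRegularTime h0 hf)
      (Nat.one_div_pos_of_nat (n := k)) 1
    have ht0 : 0 < t := by linarith
    refine ⟨t, ht0, hreg ht0, fun j => ?_⟩
    have h1 := Finset.single_le_sum (f := fun j => |N.vel (x t) j|) (fun j _ => abs_nonneg _)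
      (Finset.mem_univ j)
    exact h1.trans ((le_abs_self _).trans hsmall.le)
  choose s hs0 hreg hsmall using hseq
  choose C hC using hx.bounded h0 hr hf hc hcr
  have hball : ∀ k, x (s k) ∈ Metric.closedBall (0 : N.State) (√(∑ j, C j ^ 2)) := fun k => by
    rw [mem_closedBall_zero_iff, EuclideanSpace.norm_eq]
    refine Real.sqrt_le_sqrt (Finset.sum_le_sum fun j _ => ?_)
    exact pow_le_pow_left₀ (norm_nonneg _) (hC j _ (hs0 k).le) 2
  obtain ⟨y, -, φ, hφ, hlim⟩ := (isCompact_closedBall _ _).tendsto_subseq hball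
  have hvel : ∀ j, Tendsto (fun k => N.vel (x (s (φ k))) j) atTop (𝓝 0) := fun j => by
    refine squeeze_zero_norm (fun k => hsmall (φ k) j) ?_
    exact tendsto_one_div_add_atTop_nhds_zero_nat.comp hφ.tendsto_atTop
  obtain ⟨hy, hyr⟩ := mem_equilibria_of_tendsto hf (fun k => hx.mem_S h0 (hs0 (φ k)).le)
    (fun k a => hx.rho_nonneg h0 hr a (hs0 (φ k)).le) hlim hvel
  refine ⟨y, hy, hyr, ?_⟩
  -- the energy relative to the limit point tends to zero along the sequence
  have hE : Tendsto (fun k => N.energy y (x (s (φ k)))) atTop (𝓝 0) := by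
    have : (0 : ℝ) =
        ∑ j : N.Idx, (-(N.force y j * 0) - 1 / 2 * 0 ^ 2 + 1 / 2 * (y j - y j) ^ 2) := by
      simp
    rw [this]
    refine tendsto_finsetSum _ fun j _ => ?_
    have h1 := (continuousAt_force hf hy.1 j).tendsto.comp hlim
    have h2 := (continuousAt_coord y j).tendsto.comp hlim
    exact ((h1.mul (hvel j)).neg.sub (((hvel j).pow 2).const_mul _)).add
      (((h2.sub_const (y j)).pow 2).const_mul _)
  refine Metric.tendsto_atTop.2 fun ε hε => ?_
  obtain ⟨k, hk⟩ := (hE.eventually (gt_mem_nhds (by positivity : 0 < ε ^ 2 / 2))).exists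
  refine ⟨s (φ k) + 1, fun t ht => ?_⟩
  have h1 := hx.sum_sq_le_energy h0 hr hf hy hyr (hs0 (φ k)) (by linarith : s (φ k) < t)
      (hreg (φ k))
  rw [← Finset.mul_sum] at h1
  rw [EuclideanSpace.dist_eq, Real.sqrt_lt' hε]
  simp only [Real.dist_eq, sq_abs]
  linarith

end DCNetwork

theorem theorem4 {n : ℕ} (N : DCNetwork n)
    (hVmax : ∀ i j, N.Vmax i = N.Vmax j) (hpd : ∀ i, 0 < N.pd i)
    (hA1 : N.A1) (hA2 : N.A2) (hA4 : N.A4)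
    (x : ℝ → N.State) (hx : N.IsTrajectory x)
    (hA3 : x 0 ∈ N.S) (hrho : ∀ a : N.Arc, 0 ≤ x 0 (.rho a)) :
    ∃ xstar ∈ N.equilibria,
      Tendsto x atTop (𝓝 xstar) ∧ (DCNetwork.State.primal xstar).IsOptimal := by
  obtain ⟨c, hc, hcr⟩ := DCNetwork.exists_equilibrium hpd hA1 hA4
  obtain ⟨y, hy, hyr, hlim⟩ := hx.exists_tendsto hVmax hpd hA1 hc hcr hA3 hrho
  exact ⟨y, hy, hlim, DCNetwork.isOptimal_of_equilibrium hA1 hy hyr⟩
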